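/- Let $k$ be a field and let $\mathsf{C}$ be a finite category with morphism set $S$ that is split (every $s\in S$ has some $t\in S$ with $s\circ t\circ s=s$). Let $\alpha$ be a $2$-cocycle of $\mathsf{C}$ with values in $k^\times$, i.e. $\alpha(t,s)\in k^\times$ is given whenever $t\circ s$ exists and $\alpha(u\circ t,s)\alpha(u,t)=\alpha(u,t\circ s)\alpha(t,s)$. Let $A=k_\alpha\mathsf{C}$ be the twisted category algebra: it has $k$-basis $S$, and $t\cdot s=\alpha(t,s)\,t\circ s$ if $t\circ s$ exists, $t\cdot s=0$ otherwise. Let $S_1,\dots,S_n$ be the $\mathscr{J}$-classes of $\mathsf{C}$ (the classes of $s\sim t:\Leftrightarrow S\circ s\circ S=S\circ t\circ S$), ordered by $\mathscr{J}(s)\le_{\mathscr J}\mathscr{J}(t):\Leftrightarrow S\circ s\circ S\subseteq S\circ t\circ S$ and numbered so that $S_i<_{\mathscr J}S_j$ implies $i<j$. Let $J_j$ be the $k$-span of $S_1\cup\dots\cup S_j$ in $A$, with $J_0=0$. Let $e_i\in S_i$ be an idempotent endomorphism, of the object $X_i$, put $e_i'=\alpha(e_i,e_i)^{-1}e_i$,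 and let $\Gamma_{e_i}$ be the group of units of the monoid $e_i\circ\mathrm{End}(X_i)\circ e_i$. Then $e_i'Ae_i'=k_\alpha\Gamma_{e_i}\oplus kJ_{e_i}$, where $k_\alpha\Gamma_{e_i}$ is the span of $\Gamma_{e_i}$ and the span $kJ_{e_i}$ of $J_{e_i}=(e_i\circ\mathrm{End}(X_i)\circ e_i)\smallsetminus\Gamma_{e_i}$ is an ideal. Suppose that every $|\Gamma_{e_i}|$ is invertible in $k$. Let $T_{(i,1)},\dots,T_{(i,l_i)}$ represent the isomorphism classes of simple $k_\alpha\Gamma_{e_i}$-modules, let $\tilde T_{(i,r)}$ be the inflation of $T_{(i,r)}$ to $e_i'Ae_i'$, and let $\Lambda$ be the set of all pairs $(i,r)$ with $1\le i\le n$, $1\le r\le l_i$. Put $$\Delta_{(i,r)}=Ae_i'\otimes_{e_i'Ae_i'}\tilde T_{(i,r)},\qquad D_{(i,r)}=\Delta_{(i,r)}/\mathrm{Rad}(\Delta_{(i,r)}).$$ The modules $D_\lambda$, $\lambda\in\Lambda$, represent the isomorphism classes of simple $A$-modules. Let $\le$ be the partial order on $\Lambda$ with $(i,r)<(j,s)$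 if and only if $S_j<_{\mathscr J}S_i$. Write $(i,r)\sqsubset(j,s)$ if $S_j<_{\mathscr J}S_i$ and ($fJ_jg\not\subseteq J_{j-1}$ or $gJ_jf\not\subseteq J_{j-1}$), where $f\in k_\alpha\Gamma_{e_i}$ and $g\in k_\alpha\Gamma_{e_j}$ are the block idempotents (primitive central idempotents) corresponding to $T_{(i,r)}$ and $T_{(j,s)}$. Let $\unlhd$ be the reflexive and transitive closure of $\sqsubset$; it is a partial order on $\Lambda$. For each of these two orders, the standard module labelled by $\lambda$ is the largest quotient $M$ of a projective cover of $D_\lambda$ such that all composition factors of $\mathrm{Rad}(M)$ are $D_\mu$ with $\mu$ strictly below $\lambda$, and the costandard module $\nabla_\lambda$ is the largest submodule $N$ of an injective envelope of $D_\lambda$ such that all composition factors of $N/\mathrm{Soc}(N)$ are $D_\mu$ with $\mu$ strictly below $\lambda$. Suppose that $-^\circ:\mathsf{C}\to\mathsf{C}$ is a contravariant functor that is the identity on objects and satisfies $(s^\circ)^\circ=s$ and $s\circ s^\circ\circ s=s$ for all $s\in S$, $\alpha(s,t)=\alpha(t^\circ,s^\circ)$ whenever $s\circ t$ exists, and $e_i^\circ=e_i$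 for all $i$. It induces the anti-involution $\sum a_s s\mapsto\sum a_s s^\circ$ of $A$, which restricts to $e_i'Ae_i'$ and to $k_\alpha\Gamma_{e_i}$. For a finite-dimensional left module $M$ over one of these algebras let $M^\circ=\mathrm{Hom}_k(M,k)$ be the left module with $(a\cdot f)(m)=f(a^\circ m)$. Then for every $(i,r)\in\Lambda$ there are a unique label $(i,r)^\circ\in\Lambda$ with $D_{(i,r)^\circ}\cong D_{(i,r)}^\circ$ and a unique index $r^\circ\in\{1,\dots,l_i\}$ with $T_{(i,r^\circ)}\cong T_{(i,r)}^\circ$, and for all $(i,r),(j,s)\in\Lambda$ the following hold. (a) $\Delta_{(i,r)^\circ}\cong Ae_i'\otimes_{e_i'Ae_i'}\tilde T_{(i,r)}^\circ\cong\Delta_{(i,r^\circ)}$ as $A$-modules, and $(i,r)^\circ=(i,r^\circ)$. (b) $(i,r)\le(j,s)$ if and only if $(i,r)^\circ\le(j,s)^\circ$. (c) $(i,r)\unlhd(j,s)$ if and only if $(i,r)^\circ\unlhd(j,s)^\circ$. (d) With respect to $\le$ as well as with respect to $\unlhd$, the module $\Delta_{(i,r)}$ is the standard module labelled by $(i,r)$,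 the costandard module $\nabla_{(i,r)}$ exists, and $\Delta_{(i,r)^\circ}\cong\nabla_{(i,r)}^\circ$ and $\nabla_{(i,r)^\circ}\cong\Delta_{(i,r)}^\circ$ as $A$-modules. -/

import Mathlib

open CategoryTheory TensorProduct

universe u v w

noncomputable section

namespace TwCat

set_option linter.unusedSectionVars false

/-! ### Standard and costandard modules over an arbitrary ring -/

section General

/-- `π : P → D` is a projective cover: `P` is projective, `π` is surjective and its kernel is
superfluous. -/
def IsProjectiveCover (A : Type*) [Ring A] {P D : Type*} [AddCommGroup P] [Module A P]
    [AddCommGroup D] [Module A D] (π : P →ₗ[A] D) : Prop :=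
  Module.Projective A P ∧ Function.Surjective π ∧
    ∀ N : Submodule A P, N ⊔ LinearMap.ker π = ⊤ → N = ⊤

/-- `ι : D → I` is an injective envelope: `I` is injective, `ι` is injective and its image is
an essential submodule. -/
def IsInjectiveEnvelope (A : Type*) [Ring A] {D I : Type*} [AddCommGroup D] [Module A D]
    [AddCommGroup I] [Module A I] (ι : D →ₗ[A] I) : Prop :=
  Module.Injective A I ∧ Function.Injective ι ∧
    ∀ N : Submodule A I, N ⊓ LinearMap.range ι = ⊥ → N = ⊥

/-- The socle: the sum of all simple submodules. -/
def socle (A M : Type*) [Ring A] [AddCommGroup M] [Module A M] : Submodule A M :=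
  sSup {S : Submodule A M | IsSimpleModule A S}

/-- Every composition factor of `M`, that is, every subquotient `N₂ / N₁` with `N₁` maximal
in `N₂`, is isomorphic to one of the modules `D μ` with `p μ`. -/
def CompositionFactorsIn (A : Type*) [Ring A] {Λ : Type*} (D : Λ → Type*)
    [∀ μ, AddCommGroup (D μ)] [∀ μ, Module A (D μ)] (p : Λ → Prop)
    (M : Type*) [AddCommGroup M] [Module A M] : Prop :=
  ∀ N₁ N₂ : Submodule A M, N₁ ⋖ N₂ →
    ∃ μ, p μ ∧ Nonempty ((N₂ ⧸ N₁.submoduleOf N₂) ≃ₗ[A] D μ)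

/-- `M` is (isomorphic to) the standard module with label `lam` with respect to the strict order
`lt` on the labels of the simple modules `D`: the largest quotient `P ⧸ K` of a projective cover
`P` of `D lam` such that all composition factors of its radical are `D μ` with `lt μ lam`. -/
def IsStandardModule (A : Type*) [Ring A] {Λ : Type*} (D : Λ → Type*)
    [∀ μ, AddCommGroup (D μ)] [∀ μ, Module A (D μ)] (lt : Λ → Λ → Prop) (lam : Λ)
    (M : Type w) [AddCommGroup M] [Module A M] : Prop :=
  ∃ (P : Type w) (_ : AddCommGroup P) (_ : Module A P) (π : P →ₗ[A] D lam) (K : Submodule A P),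
    IsProjectiveCover A π ∧
    IsLeast {K' : Submodule A P |
      CompositionFactorsIn A D (fun μ => lt μ lam) (Module.jacobson A (P ⧸ K'))} K ∧
    Nonempty (M ≃ₗ[A] (P ⧸ K))

/-- `M` is (isomorphic to) the costandard module with label `lam` with respect to the strict order
`lt` on the labels of the simple modules `D`: the largest submodule `N` of an injective envelope
`I` of `D lam` such that all composition factors of `N ⧸ Soc N` are `D μ` with `lt μ lam`. -/
def IsCostandardModule (A : Type*) [Ring A] {Λ : Type*} (D : Λ → Type*)
    [∀ μ, AddCommGroup (D μ)] [∀ μ, Module A (D μ)] (lt : Λ → Λ → Prop) (lam : Λ)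
    (M : Type w) [AddCommGroup M] [Module A M] : Prop :=
  ∃ (I : Type w) (_ : AddCommGroup I) (_ : Module A I) (ι : D lam →ₗ[A] I) (N : Submodule A I),
    IsInjectiveEnvelope A ι ∧
    IsGreatest {N' : Submodule A I |
      CompositionFactorsIn A D (fun μ => lt μ lam) (N' ⧸ socle A N')} N ∧
    Nonempty (M ≃ₗ[A] N)

end General

/-! ### The dual of a left module along an anti-homomorphism -/

section Dual

variable {k : Type*} [Field k] {B : Type*} [Semiring B] [Algebra k B]

/-- The `k`-linear dual of the left `B`-module `M`, as a left `B`-module through the algebra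
anti-homomorphism `σ : B → B`: `(b • f) m = f (σ b • m)`. -/
def CircDual (_σ : B →ₐ[k] Bᵐᵒᵖ) (M : Type*) [AddCommGroup M] [Module k M] : Type _ :=
  Module.Dual k M

variable (σ : B →ₐ[k] Bᵐᵒᵖ) (M : Type*) [AddCommGroup M] [Module k M]

instance : AddCommGroup (CircDual σ M) := inferInstanceAs (AddCommGroup (Module.Dual k M))
instance : Module k (CircDual σ M) := inferInstanceAs (Module k (Module.Dual k M))

/-- The underlying linear form. -/
def CircDual.toDual : CircDual σ M ≃ₗ[k] Module.Dual k M := LinearEquiv.refl k (Module.Dual k M)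

variable [Module B M] [IsScalarTower k B M]

instance : SMul B (CircDual σ M) where
  smul b f := (CircDual.toDual σ M).symm
    (LinearMap.comp (CircDual.toDual σ M f) (Algebra.lsmul k k M (σ b).unop))

theorem circDual_smul_apply (b : B) (f : CircDual σ M) (m : M) :
    CircDual.toDual σ M (b • f) m = CircDual.toDual σ M f ((σ b).unop • m) := rfl

theorem circDual_ext {f g : CircDual σ M}
    (h : ∀ m, CircDual.toDual σ M f m = CircDual.toDual σ M g m) : f = g :=
  (CircDual.toDual σ M).injective (LinearMap.ext h)

instance : Module B (CircDual σ M) where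
  one_smul f := circDual_ext σ M fun m => by simp [circDual_smul_apply]
  mul_smul a b f := circDual_ext σ M fun m => by simp [circDual_smul_apply, mul_smul]
  smul_zero b := circDual_ext σ M fun m => by simp [circDual_smul_apply]
  smul_add b f g := circDual_ext σ M fun m => by simp [circDual_smul_apply]
  add_smul a b f := circDual_ext σ M fun m => by simp [circDual_smul_apply, add_smul]
  zero_smul f := circDual_ext σ M fun m => by simp [circDual_smul_apply]

instance : IsScalarTower k B (CircDual σ M) where
  smul_assoc c b f := circDual_ext σ M fun m => by simp [circDual_smul_apply]

end Dual

/-! ### Corner algebras and induced modules -/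

section Induced

variable (k : Type*) [Field k] {A : Type*} [Ring A] [Algebra k A] {e : A}
  (he : IsIdempotentElem e)

theorem corner_mem (x : he.Corner) : e * x.1 = x.1 ∧ x.1 * e = x.1 :=
  (Subsemigroup.mem_corner_iff he).mp x.2

/-- The corner `eAe` is closed under the scalars of `k`. -/
instance : SMul k he.Corner where
  smul c x := ⟨c • x.1, (Subsemigroup.mem_corner_iff he).mpr
    ⟨by rw [mul_smul_comm, (corner_mem he x).1], by rw [smul_mul_assoc, (corner_mem he x).2]⟩⟩

theorem corner_smul_val (c : k) (x : he.Corner) : (c • x).1 = c • x.1 := rfl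

instance : Module k he.Corner where
  one_smul x := Subtype.ext (one_smul k x.1)
  mul_smul a b x := Subtype.ext (mul_smul a b x.1)
  smul_zero c := Subtype.ext (smul_zero c)
  smul_add c x y := Subtype.ext (smul_add c x.1 y.1)
  add_smul a b x := Subtype.ext (add_smul a b x.1)
  zero_smul x := Subtype.ext (zero_smul k x.1)

/-- The corner `eAe` is a `k`-algebra with unit element `e`. -/
instance : Algebra k he.Corner :=
  Algebra.ofModule (fun c x y => Subtype.ext (smul_mul_assoc c x.1 y.1))
    (fun c x y => Subtype.ext (mul_smul_comm c x.1 y.1))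

/-- The left ideal `Ae`, as a left `A`-module. -/
abbrev leftIdeal (e : A) : Submodule A A := Submodule.span A {e}

/-- The right action of `eAe` on `Ae`. -/
def leftIdealMul (x : leftIdeal e) (b : he.Corner) : leftIdeal e :=
  ⟨x.1 * b.1, Submodule.mem_span_singleton.mpr
    ⟨x.1 * b.1, by rw [smul_eq_mul, mul_assoc, (corner_mem he b).2]⟩⟩

variable (M : Type*) [AddCommGroup M] [Module k M] [Module he.Corner M]
  [IsScalarTower k he.Corner M]

/-- The `A`-submodule of `Ae ⊗ₖ M` generated by the elements `(x b) ⊗ m - x ⊗ (b m)` with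
`b ∈ eAe`. -/
def balancedRelations : Submodule A (leftIdeal e ⊗[k] M) :=
  Submodule.span A {z | ∃ (x : leftIdeal e) (b : he.Corner) (m : M),
    z = leftIdealMul he x b ⊗ₜ[k] m - x ⊗ₜ[k] (b • m)}

/-- The left `A`-module `Ae ⊗_{eAe} M`, for a left `eAe`-module `M`. -/
abbrev Induced : Type _ := (leftIdeal e ⊗[k] M) ⧸ balancedRelations k he M

end Induced

/-! ### Finite split categories, Green's relation `𝒥` -/

section Category

variable (C : Type v) [Category.{w} C]

/-- The set `S` of all morphisms of `C`; the morphism `f : X ⟶ Y` is `⟨X, Y, f⟩`. -/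
abbrev Mor : Type (max v w) := Σ X : C, Σ Y : C, X ⟶ Y

variable {C}

/-- A morphism regarded as an element of the set of all morphisms. -/
abbrev mor {X Y : C} (f : X ⟶ Y) : Mor C := ⟨X, Y, f⟩

variable (C) in
/-- Every morphism `s` has some `t` with `s ∘ t ∘ s = s`. -/
def IsSplitCategory : Prop := ∀ (X Y : C) (s : X ⟶ Y), ∃ t : Y ⟶ X, s ≫ t ≫ s = s

/-- The set `S ∘ s ∘ S`. -/
def twoSided (s : Mor C) : Set (Mor C) :=
  {x | ∃ (p : x.1 ⟶ s.1) (q : s.2.1 ⟶ x.2.1), x.2.2 = p ≫ s.2.2 ≫ q}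

variable (C) in
/-- Green's equivalence relation `𝒥`. -/
def jSetoid : Setoid (Mor C) where
  r s t := twoSided s = twoSided t
  iseqv := ⟨fun _ => rfl, fun h => h.symm, fun h h' => h.trans h'⟩

variable (C) in
/-- The set of `𝒥`-classes of `C`. -/
def JClass : Type (max v w) := Quotient (jSetoid C)

/-- The `𝒥`-class of a morphism. -/
def jClass (s : Mor C) : JClass C := Quotient.mk (jSetoid C) s

/-- The set `S ∘ s ∘ S` attached to the `𝒥`-class of `s`. -/
def JClass.ideal : JClass C → Set (Mor C) := Quotient.lift twoSided fun _ _ h => h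

theorem JClass.ideal_injective : Function.Injective (JClass.ideal (C := C)) := by
  intro a b
  induction a using Quotient.inductionOn
  induction b using Quotient.inductionOn
  exact fun h => Quotient.sound h

/-- The partial order `≤_𝒥`: `𝒥(s) ≤ 𝒥(t)` if and only if `S ∘ s ∘ S ⊆ S ∘ t ∘ S`. -/
instance : PartialOrder (JClass C) := PartialOrder.lift JClass.ideal JClass.ideal_injective

variable (C) in
/-- An enumeration `S₁, …, Sₙ` of the `𝒥`-classes such that `Sᵢ <_𝒥 Sⱼ` implies `i < j`, with an
idempotent endomorphism `eᵢ` in each class `Sᵢ`. -/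
structure JData where
  n : ℕ
  cls : Fin n ≃ JClass C
  lt_of_cls_lt : ∀ i j, cls i < cls j → i < j
  X : Fin n → C
  e : ∀ i, X i ⟶ X i
  e_idem : ∀ i, e i ≫ e i = e i
  e_mem : ∀ i, jClass (mor (e i)) = cls i

/-- The group `Γ_e` of units of the monoid `e ∘ End X ∘ e` (as a set of endomorphisms), for an
idempotent endomorphism `e` of `X`. -/
def unitsAt {X : C} (e : X ⟶ X) : Set (X ⟶ X) :=
  {x | (e ≫ x = x ∧ x ≫ e = x) ∧ ∃ y, (e ≫ y = y ∧ y ≫ e = y) ∧ x ≫ y = e ∧ y ≫ x = e}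

end Category

/-! ### Twisted category algebras -/

section Twisted

variable (k : Type u) [Field k] (C : Type v) [Category.{w} C]

/-- A 2-cocycle of `C` with values in `kˣ`; `toFun t s` is `α(t, s)`, for `t ∘ s` defined. -/
structure TwoCocycle where
  toFun : ∀ {X Y Z : C}, (Y ⟶ Z) → (X ⟶ Y) → kˣ
  cocycle : ∀ {X Y Z W : C} (s : X ⟶ Y) (t : Y ⟶ Z) (r : Z ⟶ W),
    toFun (t ≫ r) s * toFun r t = toFun r (s ≫ t) * toFun t s

variable {k C}

instance : CoeFun (TwoCocycle k C)
    (fun _ => ∀ {X Y Z : C}, (Y ⟶ Z) → (X ⟶ Y) → kˣ) := ⟨fun α => α.toFun⟩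

variable (α : TwoCocycle k C)

/-- The twisted category algebra `k_α C`: the vector space with basis the morphisms of `C`. -/
def TwAlg (_α : TwoCocycle k C) : Type (max u v w) := Mor C →₀ k

instance : AddCommGroup (TwAlg α) := inferInstanceAs (AddCommGroup (Mor C →₀ k))
instance : Module k (TwAlg α) := inferInstanceAs (Module k (Mor C →₀ k))

/-- The basis element of `k_α C` attached to a morphism. -/
def basisElt (s : Mor C) : TwAlg α := Finsupp.single s (1 : k)

open Classical in
/-- The product `t · s` of two basis elements: `α(t, s) t ∘ s` if `t ∘ s` exists, and `0`
otherwise. -/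
def mulBasis (t s : Mor C) : TwAlg α :=
  if h : s.2.1 = t.1 then
    (α t.2.2 (s.2.2 ≫ eqToHom h) : k) • basisElt α (mor ((s.2.2 ≫ eqToHom h) ≫ t.2.2))
  else 0

/-- The bilinear extension of `mulBasis`. -/
def mulHom : TwAlg α →ₗ[k] TwAlg α →ₗ[k] TwAlg α :=
  Finsupp.linearCombination k fun t : Mor C =>
    (Finsupp.linearCombination k fun s : Mor C => mulBasis α t s :
      (Mor C →₀ k) →ₗ[k] TwAlg α)

theorem mulHom_basis (t s : Mor C) :
    mulHom α (basisElt α t) (basisElt α s) = mulBasis α t s := by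
  unfold mulHom basisElt
  erw [Finsupp.linearCombination_single, one_smul, Finsupp.linearCombination_single, one_smul]

theorem mulBasis_comp {X Y Z : C} (t : Y ⟶ Z) (s : X ⟶ Y) :
    mulBasis α (mor t) (mor s) = (α t s : k) • basisElt α (mor (s ≫ t)) := by
  simp [mulBasis]

theorem mulBasis_ne (t s : Mor C) (h : s.2.1 ≠ t.1) : mulBasis α t s = 0 := by
  simp [mulBasis, h]

variable {α} in
theorem twAlg_ext {M : Type*} [AddCommGroup M] [Module k M] {f g : TwAlg α →ₗ[k] M}
    (h : ∀ s, f (basisElt α s) = g (basisElt α s)) : f = g :=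
  Finsupp.lhom_ext' fun s => LinearMap.ext_ring (h s)

theorem mulBasis_assoc (r t s : Mor C) :
    mulHom α (mulBasis α r t) (basisElt α s) = mulHom α (basisElt α r) (mulBasis α t s) := by
  obtain ⟨Z', W, r⟩ := r
  obtain ⟨Y', Z, t⟩ := t
  obtain ⟨X, Y, s⟩ := s
  by_cases h1 : Z = Z'
  · subst h1
    by_cases h2 : Y = Y'
    · subst h2
      rw [mulBasis_comp, mulBasis_comp]
      simp only [map_smul, LinearMap.smul_apply, mulHom_basis, mulBasis_comp, smul_smul,
        Category.assoc]
      congr 1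
      have := congrArg Units.val (α.cocycle s t r)
      push_cast at this
      rw [mul_comm, this, mul_comm]
    · rw [mulBasis_comp, mulBasis_ne α ⟨Y', Z, t⟩ ⟨X, Y, s⟩ h2]
      simp only [map_smul, LinearMap.smul_apply, mulHom_basis, map_zero]
      rw [mulBasis_ne _ _ _ h2, smul_zero]
  · rw [mulBasis_ne α ⟨Z', W, r⟩ ⟨Y', Z, t⟩ h1]
    by_cases h2 : Y = Y'
    · subst h2
      rw [mulBasis_comp]
      simp only [map_smul, mulHom_basis, map_zero, LinearMap.zero_apply]
      rw [mulBasis_ne _ _ _ h1, smul_zero]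
    · rw [mulBasis_ne α ⟨Y', Z, t⟩ ⟨X, Y, s⟩ h2]
      simp

@[elab_as_elim]
theorem twAlg_induction {α : TwoCocycle k C} {p : TwAlg α → Prop} (h0 : p 0)
    (hb : ∀ s, p (basisElt α s))
    (hadd : ∀ x y, p x → p y → p (x + y)) (hsmul : ∀ (c : k) x, p x → p (c • x))
    (x : TwAlg α) : p x := by
  refine Finsupp.induction_linear (motive := p) x h0 hadd fun s c => ?_
  have := hsmul c _ (hb s)
  have e : c • basisElt α s = (Finsupp.single s c : Mor C →₀ k) := Finsupp.smul_single_one s c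
  exact e ▸ this

theorem mulHom_assoc (x y z : TwAlg α) :
    mulHom α (mulHom α x y) z = mulHom α x (mulHom α y z) := by
  induction x using twAlg_induction with
  | h0 => simp
  | hadd a b ha hb => simp only [map_add, LinearMap.add_apply, ha, hb]
  | hsmul c a ha => simp only [map_smul, LinearMap.smul_apply, ha]
  | hb r =>
    induction y using twAlg_induction with
    | h0 => simp
    | hadd a b ha hb => simp only [map_add, LinearMap.add_apply, ha, hb]
    | hsmul c a ha => simp only [map_smul, LinearMap.smul_apply, ha]
    | hb t =>
      induction z using twAlg_induction with
      | h0 => simp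
      | hadd a b ha hb => simp only [map_add, ha, hb]
      | hsmul c a ha => simp only [map_smul, ha]
      | hb s => rw [mulHom_basis, mulHom_basis, mulBasis_assoc]

theorem twoCocycle_id_left {X Y : C} (s : X ⟶ Y) : α (𝟙 Y) s = α (𝟙 Y) (𝟙 Y) := by
  have := α.cocycle s (𝟙 Y) (𝟙 Y)
  simp only [Category.comp_id] at this
  exact (mul_left_cancel this).symm

theorem twoCocycle_id_right {X Y : C} (s : X ⟶ Y) : α s (𝟙 X) = α (𝟙 X) (𝟙 X) := by
  have := α.cocycle (𝟙 X) (𝟙 X) s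
  simp only [Category.id_comp] at this
  exact mul_left_cancel this

variable (C) in
theorem finite_ob [Finite (Mor C)] : Finite C :=
  Finite.of_injective (fun X : C => (mor (𝟙 X) : Mor C)) fun _ _ h => congrArg Sigma.fst h

/-- The unit element `∑_X α(id_X, id_X)⁻¹ id_X` of `k_α C`. -/
def twOne [Finite (Mor C)] : TwAlg α :=
  letI := finite_ob C
  letI := Fintype.ofFinite C
  ∑ X : C, (((α (𝟙 X) (𝟙 X))⁻¹ : kˣ) : k) • basisElt α (mor (𝟙 X))

variable [Finite (Mor C)]

theorem twOne_mul (x : TwAlg α) : mulHom α (twOne α) x = x := by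
  induction x using twAlg_induction with
  | h0 => simp
  | hadd a b ha hb => simp only [map_add, ha, hb]
  | hsmul c a ha => simp only [map_smul, ha]
  | hb s =>
    obtain ⟨X, Y, s⟩ := s
    unfold twOne
    simp only [map_sum, map_smul, LinearMap.sum_apply, LinearMap.smul_apply, mulHom_basis]
    rw [Finset.sum_eq_single Y]
    · rw [mulBasis_comp, smul_smul, twoCocycle_id_left]
      simp
    · intro Z _ hZ
      rw [mulBasis_ne _ _ _ (Ne.symm hZ), smul_zero]
    · simp

theorem mul_twOne (x : TwAlg α) : mulHom α x (twOne α) = x := by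
  induction x using twAlg_induction with
  | h0 => simp
  | hadd a b ha hb => simp only [map_add, LinearMap.add_apply, ha, hb]
  | hsmul c a ha => simp only [map_smul, LinearMap.smul_apply, ha]
  | hb s =>
    obtain ⟨X, Y, s⟩ := s
    unfold twOne
    simp only [map_sum, map_smul, mulHom_basis]
    rw [Finset.sum_eq_single X]
    · rw [mulBasis_comp, smul_smul, twoCocycle_id_right]
      simp
    · intro Z _ hZ
      rw [mulBasis_ne _ _ _ hZ, smul_zero]
    · simp

instance : Ring (TwAlg α) where
  __ := (inferInstance : AddCommGroup (TwAlg α))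
  mul x y := mulHom α x y
  one := twOne α
  left_distrib x y z := map_add (mulHom α x) y z
  right_distrib x y z := LinearMap.map_add₂ (mulHom α) x y z
  zero_mul x := LinearMap.map_zero₂ (mulHom α) x
  mul_zero x := map_zero (mulHom α x)
  mul_assoc := mulHom_assoc α
  one_mul := twOne_mul α
  mul_one := mul_twOne α

instance : Algebra k (TwAlg α) :=
  Algebra.ofModule (fun c x y => LinearMap.map_smul₂ (mulHom α) c x y)
    (fun c x y => map_smul (mulHom α x) c y)

theorem mul_def (x y : TwAlg α) : x * y = mulHom α x y := rfl

theorem basis_mul_basis (t s : Mor C) : basisElt α t * basisElt α s = mulBasis α t s :=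
  mulHom_basis α t s

/-! ### The idempotents `e'`, the corners `e'Ae'` and the twisted group algebras `k_α Γ_e` -/

/-- The `k`-span `kT` in `k_α C` of a set `T` of morphisms. -/
def kSpan (T : Set (Mor C)) : Submodule k (TwAlg α) := Submodule.span k (basisElt α '' T)

open Classical in
/-- The projection of `k_α C` onto `kT` that kills the morphisms outside `T`. -/
def projOn (T : Set (Mor C)) : TwAlg α →ₗ[k] TwAlg α :=
  (Finsupp.linearCombination k fun s : Mor C => if s ∈ T then basisElt α s else 0 :
    (Mor C →₀ k) →ₗ[k] TwAlg α)

theorem projOn_basis_mem {T : Set (Mor C)} {s : Mor C} (h : s ∈ T) :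
    projOn α T (basisElt α s) = basisElt α s := by
  unfold projOn basisElt
  erw [Finsupp.linearCombination_single, one_smul, if_pos h]

theorem projOn_basis_notMem {T : Set (Mor C)} {s : Mor C} (h : s ∉ T) :
    projOn α T (basisElt α s) = 0 := by
  unfold projOn basisElt
  erw [Finsupp.linearCombination_single, one_smul, if_neg h]

theorem projOn_mem (T : Set (Mor C)) (x : TwAlg α) : projOn α T x ∈ kSpan α T := by
  induction x using twAlg_induction with
  | h0 => simp
  | hadd a b ha hb => rw [map_add]; exact add_mem ha hb
  | hsmul c a ha => rw [map_smul]; exact Submodule.smul_mem _ c ha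
  | hb s =>
    by_cases h : s ∈ T
    · rw [projOn_basis_mem α h]; exact Submodule.subset_span ⟨s, h, rfl⟩
    · rw [projOn_basis_notMem α h]; exact zero_mem _

/-- The idempotent `e' = α(e, e)⁻¹ e`. -/
def primeIdem {X : C} (e : X ⟶ X) : TwAlg α :=
  (((α e e)⁻¹ : kˣ) : k) • basisElt α (mor e)

variable {α}

theorem basis_mul_comp {X Y Z : C} (t : Y ⟶ Z) (s : X ⟶ Y) :
    basisElt α (mor t) * basisElt α (mor s) = (α t s : k) • basisElt α (mor (s ≫ t)) := by
  rw [basis_mul_basis, mulBasis_comp]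

theorem twoCocycle_idem_left {X Y : C} {e : X ⟶ X} (he : e ≫ e = e) (s : Y ⟶ X)
    (hs : s ≫ e = s) : α e s = α e e := by
  have := α.cocycle s e e
  rw [he, hs] at this
  exact (mul_left_cancel this).symm

theorem twoCocycle_idem_right {X Y : C} {e : X ⟶ X} (he : e ≫ e = e) (s : X ⟶ Y)
    (hs : e ≫ s = s) : α s e = α e e := by
  have := α.cocycle e e s
  rw [he, hs] at this
  exact mul_left_cancel this

theorem primeIdem_mul {X Y : C} {e : X ⟶ X} (he : e ≫ e = e) (s : Y ⟶ X) (hs : s ≫ e = s) :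
    primeIdem α e * basisElt α (mor s) = basisElt α (mor s) := by
  rw [primeIdem, smul_mul_assoc, basis_mul_comp, hs, smul_smul, twoCocycle_idem_left he s hs]
  simp

theorem mul_primeIdem {X Y : C} {e : X ⟶ X} (he : e ≫ e = e) (s : X ⟶ Y) (hs : e ≫ s = s) :
    basisElt α (mor s) * primeIdem α e = basisElt α (mor s) := by
  rw [primeIdem, mul_smul_comm, basis_mul_comp, hs, smul_smul, twoCocycle_idem_right he s hs]
  simp

variable (α) in
theorem primeIdem_isIdempotentElem {X : C} {e : X ⟶ X} (he : e ≫ e = e) :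
    IsIdempotentElem (primeIdem α e) := by
  unfold IsIdempotentElem
  conv_lhs => rw [primeIdem]
  rw [smul_mul_assoc, ← primeIdem, mul_primeIdem he e he]
  rfl

variable (α) in
/-- The algebra `e'Ae'`, with unit element `e'`. -/
abbrev CornerAlg {X : C} {e : X ⟶ X} (he : e ≫ e = e) : Type _ :=
  (primeIdem_isIdempotentElem α he).Corner

/-- The group `Γ_e` as a subset of `S`. -/
def unitMors {X : C} (e : X ⟶ X) : Set (Mor C) := (fun x => mor x) '' unitsAt e

/-- The monoid `e ∘ End X ∘ e` as a subset of `S`. -/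
def cornerMors {X : C} (e : X ⟶ X) : Set (Mor C) :=
  (fun x => mor x) '' {x : X ⟶ X | e ≫ x = x ∧ x ≫ e = x}

theorem unitMors_subset {X : C} (e : X ⟶ X) : unitMors e ⊆ cornerMors e :=
  Set.image_mono fun _ h => h.1

theorem e_mem_unitsAt {X : C} {e : X ⟶ X} (he : e ≫ e = e) : e ∈ unitsAt e :=
  ⟨⟨he, he⟩, e, ⟨he, he⟩, he, he⟩

theorem mul_mem_unitsAt {X : C} {e x y : X ⟶ X} (hx : x ∈ unitsAt e) (hy : y ∈ unitsAt e) :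
    x ≫ y ∈ unitsAt e := by
  obtain ⟨⟨h1, h2⟩, x', ⟨h3, h4⟩, h5, h6⟩ := hx
  obtain ⟨⟨g1, g2⟩, y', ⟨g3, g4⟩, g5, g6⟩ := hy
  refine ⟨⟨by rw [← Category.assoc, h1], by rw [Category.assoc, g2]⟩, y' ≫ x',
    ⟨by rw [← Category.assoc, g3], by rw [Category.assoc, h4]⟩, ?_, ?_⟩
  · rw [Category.assoc, ← Category.assoc y, g5, h3, h5]
  · rw [Category.assoc, ← Category.assoc x', h6, g1, g6]

theorem mem_corner_of_mem_kSpan {X : C} {e : X ⟶ X} (he : e ≫ e = e) {x : TwAlg α}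
    (hx : x ∈ kSpan α (cornerMors e)) : primeIdem α e * x = x ∧ x * primeIdem α e = x := by
  induction hx using Submodule.span_induction with
  | mem x h =>
    obtain ⟨_, ⟨s, ⟨h1, h2⟩, rfl⟩, rfl⟩ := h
    exact ⟨primeIdem_mul he s h2, mul_primeIdem he s h1⟩
  | zero => simp
  | add x y _ _ hx hy => exact ⟨by rw [mul_add, hx.1, hy.1], by rw [add_mul, hx.2, hy.2]⟩
  | smul c x _ hx => exact ⟨by rw [mul_smul_comm, hx.1], by rw [smul_mul_assoc, hx.2]⟩

theorem mem_kSpan_of_mem_corner {X : C} {e : X ⟶ X} (he : e ≫ e = e) (x : CornerAlg α he) :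
    x.1 ∈ kSpan α (cornerMors e) := by
  have key : ∀ y : TwAlg α, primeIdem α e * y * primeIdem α e ∈ kSpan α (cornerMors e) := by
    intro y
    induction y using twAlg_induction with
    | h0 => simp
    | hadd a b ha hb => rw [mul_add, add_mul]; exact add_mem ha hb
    | hsmul c a ha =>
      rw [mul_smul_comm, smul_mul_assoc]; exact Submodule.smul_mem _ c ha
    | hb s =>
      obtain ⟨Y, Z, s⟩ := s
      by_cases h1 : Z = X
      · subst h1
        by_cases h2 : Y = Z
        · subst h2
          simp only [primeIdem, smul_mul_assoc, mul_smul_comm, basis_mul_comp]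
          refine Submodule.smul_mem _ _ (Submodule.smul_mem _ _ (Submodule.smul_mem _ _
            (Submodule.smul_mem _ _ (Submodule.subset_span ⟨_, ⟨e ≫ s ≫ e, ⟨?_, ?_⟩, rfl⟩, rfl⟩))))
          · rw [← Category.assoc, he]
          · simp only [Category.assoc, he]
        · simp only [primeIdem, smul_mul_assoc, mul_smul_comm, mul_assoc]
          rw [basis_mul_basis α ⟨Y, Z, s⟩, mulBasis_ne α ⟨Y, Z, s⟩ (mor e) (Ne.symm h2)]
          simp
      · simp only [primeIdem, smul_mul_assoc, mul_smul_comm]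
        rw [basis_mul_basis α (mor e) ⟨Y, Z, s⟩, mulBasis_ne α (mor e) ⟨Y, Z, s⟩ h1]
        simp
  have h := key x.1
  rwa [(corner_mem _ x).1, (corner_mem _ x).2] at h

theorem unitMors_span_mul_mem {X : C} (e : X ⟶ X) {x y : TwAlg α}
    (hx : x ∈ kSpan α (unitMors e)) (hy : y ∈ kSpan α (unitMors e)) :
    x * y ∈ kSpan α (unitMors e) := by
  induction hx using Submodule.span_induction with
  | mem x h =>
    obtain ⟨_, ⟨s, hs, rfl⟩, rfl⟩ := h
    induction hy using Submodule.span_induction with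
    | mem y h' =>
      obtain ⟨_, ⟨t, ht, rfl⟩, rfl⟩ := h'
      rw [basis_mul_comp]
      exact Submodule.smul_mem _ _ (Submodule.subset_span ⟨_, ⟨_, mul_mem_unitsAt ht hs, rfl⟩, rfl⟩)
    | zero => simp
    | add y z _ _ hy hz => rw [mul_add]; exact add_mem hy hz
    | smul c y _ hy => rw [mul_smul_comm]; exact Submodule.smul_mem _ c hy
  | zero => simp
  | add x z _ _ hx hz => rw [add_mul]; exact add_mem hx hz
  | smul c x _ hx => rw [smul_mul_assoc]; exact Submodule.smul_mem _ c hx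

theorem primeIdem_mem {X : C} {e : X ⟶ X} (he : e ≫ e = e) :
    primeIdem α e ∈ kSpan α (unitMors e) :=
  Submodule.smul_mem _ _ (Submodule.subset_span ⟨_, ⟨e, e_mem_unitsAt he, rfl⟩, rfl⟩)

variable (α) in
/-- The twisted group algebra `k_α Γ_e`, as a unitary subalgebra of `e'Ae'`: the `k`-span
of `Γ_e`. -/
def grpAlg {X : C} {e : X ⟶ X} (he : e ≫ e = e) : Subalgebra k (CornerAlg α he) where
  carrier := {x | x.1 ∈ kSpan α (unitMors e)}
  mul_mem' hx hy := unitMors_span_mul_mem e hx hy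
  add_mem' {x y} hx hy := Submodule.add_mem (kSpan α (unitMors e)) (x := x.1) (y := y.1) hx hy
  algebraMap_mem' c := by
    rw [Algebra.algebraMap_eq_smul_one]
    exact Submodule.smul_mem _ c (primeIdem_mem he)

theorem mem_grpAlg {X : C} {e : X ⟶ X} (he : e ≫ e = e) (x : CornerAlg α he) :
    x ∈ grpAlg α he ↔ x.1 ∈ kSpan α (unitMors e) := Iff.rfl

theorem unitsAt_of_comp_eq {X : C} {e x y : X ⟶ X}
    (hx : e ≫ x = x ∧ x ≫ e = x) (hy : e ≫ y = y ∧ y ≫ e = y) (h : x ≫ y = e) :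
    x ∈ unitsAt e ∧ y ∈ unitsAt e := by
  have : Finite (X ⟶ X) := Finite.of_injective (fun f => (mor f : Mor C)) fun f g h => by
    simpa using h
  let M := {z : X ⟶ X // e ≫ z = z ∧ z ≫ e = z}
  let φ : M → M := fun z => ⟨z.1 ≫ x, by
    rw [← Category.assoc, z.2.1], by rw [Category.assoc, hx.2]⟩
  have inj : Function.Injective φ := by
    intro z z' hz
    have hz : z.1 ≫ x = z'.1 ≫ x := congrArg Subtype.val hz
    have := congrArg (· ≫ y) hz
    simp only [Category.assoc, h, z.2.2, z'.2.2] at this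
    exact Subtype.ext this
  have hee : e ≫ e = e := by
    calc e ≫ e = e ≫ x ≫ y := by rw [h]
      _ = x ≫ y := by rw [← Category.assoc, hx.1]
      _ = e := h
  obtain ⟨z, hz⟩ := Finite.injective_iff_surjective.mp inj ⟨e, hee, hee⟩
  have hz : z.1 ≫ x = e := congrArg Subtype.val hz
  have hzy : z.1 = y := by
    calc z.1 = z.1 ≫ e := z.2.2.symm
      _ = z.1 ≫ x ≫ y := by rw [h]
      _ = y := by rw [← Category.assoc, hz, hy.1]
  rw [hzy] at hz
  exact ⟨⟨hx, y, hy, h, hz⟩, ⟨hy, x, hx, hz, h⟩⟩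

theorem unitsAt_of_comp_mem {X : C} {e x y : X ⟶ X}
    (hx : e ≫ x = x ∧ x ≫ e = x) (hy : e ≫ y = y ∧ y ≫ e = y) (h : x ≫ y ∈ unitsAt e) :
    x ∈ unitsAt e ∧ y ∈ unitsAt e := by
  obtain ⟨-, z, ⟨h1, h2⟩, h3, h4⟩ := h
  refine ⟨(unitsAt_of_comp_eq hx (y := y ≫ z) ⟨?_, ?_⟩ ?_).1,
    (unitsAt_of_comp_eq (x := z ≫ x) ⟨?_, ?_⟩ hy ?_).2⟩
  · rw [← Category.assoc, hy.1]
  · rw [Category.assoc, h2]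
  · rw [← Category.assoc, h3]
  · rw [← Category.assoc, h1]
  · rw [Category.assoc, hx.2]
  · rw [Category.assoc, h4]

theorem projOn_mul {X : C} {e : X ⟶ X} {x y : TwAlg α}
    (hx : x ∈ kSpan α (cornerMors e)) (hy : y ∈ kSpan α (cornerMors e)) :
    projOn α (unitMors e) (x * y) = projOn α (unitMors e) x * projOn α (unitMors e) y := by
  have inj : ∀ z : X ⟶ X, mor z ∈ unitMors e ↔ z ∈ unitsAt e := fun z =>
    ⟨fun ⟨z', h, hz⟩ => by simp at hz; exact hz ▸ h, fun h => ⟨z, h, rfl⟩⟩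
  induction hx using Submodule.span_induction with
  | mem x h =>
    obtain ⟨_, ⟨s, hs, rfl⟩, rfl⟩ := h
    induction hy using Submodule.span_induction with
    | mem y h' =>
      obtain ⟨_, ⟨t, ht, rfl⟩, rfl⟩ := h'
      rw [basis_mul_comp, map_smul]
      by_cases h1 : t ≫ s ∈ unitsAt e
      · obtain ⟨h2, h3⟩ := unitsAt_of_comp_mem ht hs h1
        rw [projOn_basis_mem α ((inj _).2 h1), projOn_basis_mem α ((inj _).2 h2),
          projOn_basis_mem α ((inj _).2 h3), basis_mul_comp]
      · rw [projOn_basis_notMem α (fun h => h1 ((inj _).1 h)), smul_zero]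
        by_cases h2 : t ∈ unitsAt e
        · have h3 : s ∉ unitsAt e := fun h3 => h1 (mul_mem_unitsAt h2 h3)
          rw [projOn_basis_notMem α (fun h => h3 ((inj _).1 h)), zero_mul]
        · rw [projOn_basis_notMem α (s := mor t) (fun h => h2 ((inj _).1 h)), mul_zero]
    | zero => simp
    | add y z _ _ hy hz => rw [mul_add, map_add, hy, hz, map_add, mul_add]
    | smul c y _ hy => rw [mul_smul_comm, map_smul, hy, map_smul, mul_smul_comm]
  | zero => simp
  | add x z _ _ hx hz => rw [add_mul, map_add, hx, hz, map_add, add_mul]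
  | smul c x _ hx => rw [smul_mul_assoc, map_smul, hx, map_smul, smul_mul_assoc]

/-- An element of `kΓ_e ⊆ A`, as an element of `k_α Γ_e`. -/
def grpMk {X : C} {e : X ⟶ X} (he : e ≫ e = e) (x : TwAlg α)
    (hx : x ∈ kSpan α (unitMors e)) : grpAlg α he :=
  ⟨⟨x, (Subsemigroup.mem_corner_iff (primeIdem_isIdempotentElem α he)).mpr
    (mem_corner_of_mem_kSpan he (Submodule.span_mono (Set.image_mono (unitMors_subset e)) hx))⟩,
    hx⟩

variable (α) in
/-- The projection `e'Ae' = k_α Γ_e ⊕ kJ_e → k_α Γ_e`, where `J_e` is the complement of `Γ_e` in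
`e ∘ End X ∘ e`. -/
def inflHom {X : C} {e : X ⟶ X} (he : e ≫ e = e) : CornerAlg α he →ₐ[k] grpAlg α he :=
  AlgHom.ofLinearMap
    { toFun := fun x => grpMk he (projOn α (unitMors e) x.1) (projOn_mem α (unitMors e) x.1)
      map_add' := fun x y => Subtype.ext (Subtype.ext (map_add (projOn α (unitMors e)) x.1 y.1))
      map_smul' := fun c x => Subtype.ext (Subtype.ext (map_smul (projOn α (unitMors e)) c x.1)) }
    (Subtype.ext (Subtype.ext (by
      change projOn α (unitMors e) (primeIdem α e) = primeIdem α e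
      have hm : mor e ∈ unitMors e := ⟨e, e_mem_unitsAt he, rfl⟩
      rw [primeIdem, map_smul, projOn_basis_mem α hm])))
    (fun x y => Subtype.ext (Subtype.ext
      (projOn_mul (mem_kSpan_of_mem_corner he x) (mem_kSpan_of_mem_corner he y))))

/-! ### Simple and standard modules of `k_α C`, the orders on their labels -/

variable (α) in
/-- Representatives `T i r`, `r < l i`, of the isomorphism classes of simple `k_α Γ_{eᵢ}`-modules,
for each `i`. -/
structure SimpleData (J : JData C) where
  l : Fin J.n → ℕ
  T : ∀ i, Fin (l i) → Type (max u v w)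
  [addCommGroup : ∀ i r, AddCommGroup (T i r)]
  [module : ∀ i r, Module (grpAlg α (J.e_idem i)) (T i r)]
  simple : ∀ i r, IsSimpleModule (grpAlg α (J.e_idem i)) (T i r)
  eq_of_equiv : ∀ i r s, Nonempty (T i r ≃ₗ[grpAlg α (J.e_idem i)] T i s) → r = s
  exists_equiv : ∀ i (M : Type (max u v w)) [AddCommGroup M] [Module (grpAlg α (J.e_idem i)) M],
    IsSimpleModule (grpAlg α (J.e_idem i)) M →
      ∃ r, Nonempty (M ≃ₗ[grpAlg α (J.e_idem i)] T i r)

namespace SimpleData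

variable {J : JData C} (D : SimpleData α J)

instance (i : Fin J.n) (r : Fin (D.l i)) : AddCommGroup (D.T i r) := D.addCommGroup i r

instance (i : Fin J.n) (r : Fin (D.l i)) : Module (grpAlg α (J.e_idem i)) (D.T i r) :=
  D.module i r

instance (i : Fin J.n) (r : Fin (D.l i)) : Module k (D.T i r) :=
  Module.compHom (D.T i r) (algebraMap k (grpAlg α (J.e_idem i)))

instance (i : Fin J.n) (r : Fin (D.l i)) :
    IsScalarTower k (grpAlg α (J.e_idem i)) (D.T i r) :=
  IsScalarTower.of_algebraMap_smul fun _ _ => rfl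

/-- The set `Λ` of labels `(i, r)`. -/
abbrev Label : Type := Σ i : Fin J.n, Fin (D.l i)

/-- The inflation `T̃ i r` of `T i r` to `eᵢ'Aeᵢ'`. -/
def Infl (i : Fin J.n) (r : Fin (D.l i)) : Type (max u v w) := D.T i r

instance (i : Fin J.n) (r : Fin (D.l i)) : AddCommGroup (D.Infl i r) :=
  inferInstanceAs (AddCommGroup (D.T i r))

instance (i : Fin J.n) (r : Fin (D.l i)) : Module k (D.Infl i r) :=
  inferInstanceAs (Module k (D.T i r))

instance (i : Fin J.n) (r : Fin (D.l i)) : Module (CornerAlg α (J.e_idem i)) (D.Infl i r) :=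
  Module.compHom (D.T i r) (inflHom α (J.e_idem i)).toRingHom

instance (i : Fin J.n) (r : Fin (D.l i)) :
    IsScalarTower k (CornerAlg α (J.e_idem i)) (D.Infl i r) where
  smul_assoc c b m := by
    have h : inflHom α (J.e_idem i) (c • b) = c • inflHom α (J.e_idem i) b := map_smul _ c b
    have h' := smul_assoc (M := k) (N := grpAlg α (J.e_idem i)) (α := D.T i r) c
      (inflHom α (J.e_idem i) b) m
    rw [← h] at h'
    exact h'

/-- The module `Δ_{(i,r)} = A eᵢ' ⊗_{eᵢ'Aeᵢ'} T̃ i r`. -/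
abbrev Delta (lam : D.Label) : Type (max u v w) :=
  Induced k (primeIdem_isIdempotentElem α (J.e_idem lam.1)) (D.Infl lam.1 lam.2)

/-- The head `D_{(i,r)}` of `Δ_{(i,r)}`. -/
abbrev Head (lam : D.Label) : Type (max u v w) :=
  D.Delta lam ⧸ Module.jacobson (TwAlg α) (D.Delta lam)

/-- The strict order on labels: `(i, r) < (j, s)` if and only if `S_j <_𝒥 S_i`. -/
def lt (lam mu : D.Label) : Prop := J.cls mu.1 < J.cls lam.1

/-- The partial order `≤` on labels. -/
def le (lam mu : D.Label) : Prop := lam = mu ∨ D.lt lam mu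

/-- `f` is the block idempotent (primitive central idempotent) of `k_α Γ_{eᵢ}` corresponding
to the simple module `T i r`. -/
def IsBlockIdempotent (lam : D.Label) (f : grpAlg α (J.e_idem lam.1)) : Prop :=
  f ∈ Subring.center (grpAlg α (J.e_idem lam.1)) ∧ IsIdempotentElem f ∧
    (∀ g ∈ Subring.center (grpAlg α (J.e_idem lam.1)), IsIdempotentElem g →
      g * f = g → g = 0 ∨ g = f) ∧
    ∃ m : D.T lam.1 lam.2, f • m ≠ 0

variable (α J) in
/-- The ideal `J_j` of `k_α C` spanned by `S₁ ∪ … ∪ S_j`. -/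
def idealLE (j : Fin J.n) : Submodule k (TwAlg α) := kSpan α {s | ∃ i ≤ j, jClass s = J.cls i}

variable (α J) in
/-- The ideal `J_{j-1}` of `k_α C` spanned by `S₁ ∪ … ∪ S_{j-1}`. -/
def idealLT (j : Fin J.n) : Submodule k (TwAlg α) := kSpan α {s | ∃ i < j, jClass s = J.cls i}

/-- The relation `(i, r) ⊏ (j, s)`: `S_j <_𝒥 S_i`, and, with `f` and `g` the block idempotents of
`(i, r)` and `(j, s)`, `f J_j g ⊄ J_{j-1}` or `g J_j f ⊄ J_{j-1}`. -/
def sqsubset (lam mu : D.Label) : Prop :=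
  J.cls mu.1 < J.cls lam.1 ∧ ∃ f g, D.IsBlockIdempotent lam f ∧ D.IsBlockIdempotent mu g ∧
    ((∃ x ∈ idealLE α J mu.1, f.1.1 * x * g.1.1 ∉ idealLT α J mu.1) ∨
      ∃ x ∈ idealLE α J mu.1, g.1.1 * x * f.1.1 ∉ idealLT α J mu.1)

/-- The partial order `⊴` on labels: the reflexive and transitive closure of `⊏`. -/
def unlhd : D.Label → D.Label → Prop := Relation.ReflTransGen D.sqsubset

/-- The strict order belonging to `⊴`. -/
def lhd (lam mu : D.Label) : Prop := D.unlhd lam mu ∧ lam ≠ mu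

end SimpleData

/-! ### Duality -/

variable (α) in
/-- A contravariant functor `s ↦ s°` from `C` to `C` that is the identity on objects, such that
`s°° = s`, `s ∘ s° ∘ s = s`, `α(s, t) = α(t°, s°)` and `eᵢ° = eᵢ`. -/
structure Duality (J : JData C) where
  map : ∀ {X Y : C}, (X ⟶ Y) → (Y ⟶ X)
  map_id : ∀ X : C, map (𝟙 X) = 𝟙 X
  map_comp : ∀ {X Y Z : C} (f : X ⟶ Y) (g : Y ⟶ Z), map (f ≫ g) = map g ≫ map f
  map_map : ∀ {X Y : C} (s : X ⟶ Y), map (map s) = s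
  comp_map_comp : ∀ {X Y : C} (s : X ⟶ Y), s ≫ map s ≫ s = s
  cocycle_map : ∀ {X Y Z : C} (s : Y ⟶ Z) (t : X ⟶ Y), α s t = α (map t) (map s)
  map_e : ∀ i, map (J.e i) = J.e i

namespace Duality

variable {J : JData C} (o : Duality α J)

/-- The linear map `∑ aₛ s ↦ ∑ aₛ s°`. -/
def circLin : TwAlg α →ₗ[k] TwAlg α :=
  (Finsupp.linearCombination k fun s : Mor C => basisElt α (mor (o.map s.2.2)) :
    (Mor C →₀ k) →ₗ[k] TwAlg α)

theorem circLin_basis {X Y : C} (s : X ⟶ Y) :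
    o.circLin (basisElt α (mor s)) = basisElt α (mor (o.map s)) := by
  unfold circLin basisElt
  erw [Finsupp.linearCombination_single, one_smul]

theorem circLin_one : o.circLin 1 = 1 := by
  change o.circLin (twOne α) = twOne α
  unfold twOne
  simp only [map_sum, map_smul, circLin_basis, o.map_id]

theorem circLin_mul (x y : TwAlg α) : o.circLin (x * y) = o.circLin y * o.circLin x := by
  induction x using twAlg_induction with
  | h0 => simp
  | hadd a b ha hb => rw [add_mul, map_add, ha, hb, map_add, mul_add]
  | hsmul c a ha => rw [smul_mul_assoc, map_smul, ha, map_smul, mul_smul_comm]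
  | hb t =>
    induction y using twAlg_induction with
    | h0 => simp
    | hadd a b ha hb => rw [mul_add, map_add, ha, hb, map_add, add_mul]
    | hsmul c a ha => rw [mul_smul_comm, map_smul, ha, map_smul, smul_mul_assoc]
    | hb s =>
      obtain ⟨Y', Z, t⟩ := t
      obtain ⟨X, Y, s⟩ := s
      by_cases h : Y = Y'
      · subst h
        rw [basis_mul_comp, map_smul, circLin_basis, circLin_basis, circLin_basis,
          basis_mul_comp, o.map_comp, o.cocycle_map t s]
      · rw [circLin_basis, circLin_basis, basis_mul_basis, basis_mul_basis,
          mulBasis_ne α ⟨Y', Z, t⟩ ⟨X, Y, s⟩ h,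
          mulBasis_ne α (mor (o.map s)) (mor (o.map t)) (Ne.symm h), map_zero]

theorem circLin_circLin (x : TwAlg α) : o.circLin (o.circLin x) = x := by
  induction x using twAlg_induction with
  | h0 => simp
  | hadd a b ha hb => rw [map_add, map_add, ha, hb]
  | hsmul c a ha => rw [map_smul, map_smul, ha]
  | hb s => rw [circLin_basis, circLin_basis, o.map_map]

/-- The anti-involution `∑ aₛ s ↦ ∑ aₛ s°` of `A = k_α C`. -/
def circ : TwAlg α →ₐ[k] (TwAlg α)ᵐᵒᵖ :=
  AlgHom.ofLinearMap ((MulOpposite.opLinearEquiv k).toLinearMap ∘ₗ o.circLin)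
    (congrArg MulOpposite.op o.circLin_one)
    (fun x y => congrArg MulOpposite.op (o.circLin_mul x y))

theorem circLin_primeIdem (i : Fin J.n) :
    o.circLin (primeIdem α (J.e i)) = primeIdem α (J.e i) := by
  rw [primeIdem, map_smul, circLin_basis, o.map_e]

/-- The restriction of the anti-involution to `eᵢ'Aeᵢ'`. -/
def circCorner (i : Fin J.n) :
    CornerAlg α (J.e_idem i) →ₐ[k] (CornerAlg α (J.e_idem i))ᵐᵒᵖ :=
  AlgHom.ofLinearMap
    { toFun := fun x => MulOpposite.op ⟨o.circLin x.1, (Subsemigroup.mem_corner_iff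
        (primeIdem_isIdempotentElem α (J.e_idem i))).mpr (by
          have h := corner_mem _ x
          have h1 := congrArg o.circLin h.1
          have h2 := congrArg o.circLin h.2
          rw [circLin_mul, circLin_primeIdem] at h1 h2
          exact ⟨h2, h1⟩)⟩
      map_add' := fun x y => congrArg MulOpposite.op (Subtype.ext (map_add o.circLin x.1 y.1))
      map_smul' := fun c x => congrArg MulOpposite.op (Subtype.ext (map_smul o.circLin c x.1)) }
    (congrArg MulOpposite.op (Subtype.ext (o.circLin_primeIdem i)))
    (fun x y => congrArg MulOpposite.op (Subtype.ext (o.circLin_mul x.1 y.1)))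

theorem map_mem_unitsAt (i : Fin J.n) {x : J.X i ⟶ J.X i} (hx : x ∈ unitsAt (J.e i)) :
    o.map x ∈ unitsAt (J.e i) := by
  obtain ⟨⟨h1, h2⟩, y, ⟨h3, h4⟩, h5, h6⟩ := hx
  refine ⟨⟨?_, ?_⟩, o.map y, ⟨?_, ?_⟩, ?_, ?_⟩
  · rw [← congrArg o.map h2, o.map_comp, o.map_e, ← Category.assoc, J.e_idem]
  · rw [← congrArg o.map h1, o.map_comp, o.map_e, Category.assoc, J.e_idem]
  · rw [← congrArg o.map h4, o.map_comp, o.map_e, ← Category.assoc, J.e_idem]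
  · rw [← congrArg o.map h3, o.map_comp, o.map_e, Category.assoc, J.e_idem]
  · rw [← o.map_comp, h6, o.map_e]
  · rw [← o.map_comp, h5, o.map_e]

theorem circLin_mem (i : Fin J.n) {x : TwAlg α} (hx : x ∈ kSpan α (unitMors (J.e i))) :
    o.circLin x ∈ kSpan α (unitMors (J.e i)) := by
  induction hx using Submodule.span_induction with
  | mem x h =>
    obtain ⟨_, ⟨s, hs, rfl⟩, rfl⟩ := h
    rw [circLin_basis]
    exact Submodule.subset_span ⟨_, ⟨_, o.map_mem_unitsAt i hs, rfl⟩, rfl⟩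
  | zero => simp
  | add x z _ _ hx hz => rw [map_add]; exact add_mem hx hz
  | smul c x _ hx => rw [map_smul]; exact Submodule.smul_mem _ c hx

/-- The restriction of the anti-involution to `k_α Γ_{eᵢ}`. -/
def circGrp (i : Fin J.n) :
    grpAlg α (J.e_idem i) →ₐ[k] (grpAlg α (J.e_idem i))ᵐᵒᵖ :=
  AlgHom.ofLinearMap
    { toFun := fun x => MulOpposite.op ⟨(o.circCorner i x.1).unop, o.circLin_mem i x.2⟩
      map_add' := fun x y => congrArg MulOpposite.op (Subtype.ext (Subtype.ext
        (map_add o.circLin x.1.1 y.1.1)))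
      map_smul' := fun c x => congrArg MulOpposite.op (Subtype.ext (Subtype.ext
        (map_smul o.circLin c x.1.1))) }
    (congrArg MulOpposite.op (Subtype.ext (Subtype.ext (o.circLin_primeIdem i))))
    (fun x y => congrArg MulOpposite.op (Subtype.ext (Subtype.ext
      (o.circLin_mul x.1.1 y.1.1))))

end Duality

end Twisted

end TwCat

end

open TwCat

/-! The functor `M ↦ M°` is an exact contravariant involution on finite-dimensional modules, and
everything follows from what it does to submodule lattices. Taking annihilators is an
order-reversing bijection from the submodules of `M` to those of `M°` (`circAnnIso`). It exchanges
subquotients with their duals, radical with socle, superfluous kernels with essential images, and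
projective with injective modules. The dual of a standard module is therefore costandard, as soon as
the permutation of labels induced on the simple modules preserves the order.

Labels. Write `Δ = Ae' ⊗ T̃` and `D` for its head. The `e'`-component of `Δ` is `T̃`, and since `T̃`
is simple, `Δ` has a unique maximal submodule, on which `e'` is zero. The projection `D → T̃`
dualises to a nonzero `e'Ae'`-map `T̃° → D°`. As `D°` is simple, it is the head of `Ae' ⊗ T̃°`
(`nonempty_inducedHead_circDual_equiv`). Hence `(i,r)° = (i,r°)`, which gives (a), and (b) because
the class index is unchanged. For (c), `s ∘ s° ∘ s = s` makes `s` and `s°` `𝒥`-equivalent, so the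
involution preserves the ideals `J_j`. It sends block idempotents to block idempotents of the dual
labels, and reversing products merely swaps the two alternatives in `⊏`.

Standard modules. Splitness implies that every morphism not above `S_i` kills `Δ_{(i,r)}`
(`notAbove_smul_delta`). This bounds the composition factors of the radical of `Δ_λ`: they are `D_μ`
with `μ ⊏ λ` (`compositionFactorsIn_jacobson_delta`). Conversely, `e_i'` kills every `D_μ` with `μ <
λ`, and this forces every admissible quotient of the projective cover to be a quotient of `Δ_λ`
(`exists_isLeast_equiv_induced`). The argument works for any relation between `⊏` and `<`, so it
treats both orders at once. -/

namespace TwCat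

set_option linter.unusedSectionVars false

/-! ### Subquotients, radicals and socles -/

section ModuleTheory

variable {A : Type*} [Ring A]

/-- A linear map that carries `N₂` onto `N₂'`, and under which membership in `N₁` corresponds to
membership in `N₁'`, induces an isomorphism of the subquotients. -/
theorem nonempty_subquotient_equiv {M M' : Type*} [AddCommGroup M] [Module A M]
    [AddCommGroup M'] [Module A M'] (f : M →ₗ[A] M') {N₁ N₂ : Submodule A M}
    {N₁' N₂' : Submodule A M'} (h₂ : N₂' = N₂.map f) (h₁ : ∀ x ∈ N₂, x ∈ N₁ ↔ f x ∈ N₁') :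
    Nonempty ((N₂ ⧸ N₁.submoduleOf N₂) ≃ₗ[A] (N₂' ⧸ N₁'.submoduleOf N₂')) := by
  have hf : ∀ x ∈ N₂, f x ∈ N₂' := fun x hx => h₂ ▸ Submodule.mem_map_of_mem hx
  let g : N₂ →ₗ[A] (N₂' ⧸ N₁'.submoduleOf N₂') := (N₁'.submoduleOf N₂').mkQ ∘ₗ f.restrict hf
  have hker : LinearMap.ker g = N₁.submoduleOf N₂ := by
    ext x
    exact (Submodule.Quotient.mk_eq_zero (N₁'.submoduleOf N₂')).trans (h₁ x.1 x.2).symm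
  have hsurj : Function.Surjective g := by
    intro y
    obtain ⟨⟨y, hy⟩, rfl⟩ := Submodule.mkQ_surjective _ y
    subst h₂
    obtain ⟨x, hx, rfl⟩ := hy
    exact ⟨⟨x, hx⟩, rfl⟩
  exact ⟨(Submodule.quotEquivOfEq _ _ hker.symm).trans (g.quotKerEquivOfSurjective hsurj)⟩

theorem covBy_of_subquotient_equiv {M M' : Type*} [AddCommGroup M] [Module A M]
    [AddCommGroup M'] [Module A M'] {N₁ N₂ : Submodule A M} {N₁' N₂' : Submodule A M'}
    (h : N₁ ⋖ N₂) (h' : N₁' ≤ N₂')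
    (e : (N₂ ⧸ N₁.submoduleOf N₂) ≃ₗ[A] (N₂' ⧸ N₁'.submoduleOf N₂')) : N₁' ⋖ N₂' := by
  have : IsSimpleModule A (N₂ ⧸ N₁.submoduleOf N₂) := (covBy_iff_quot_is_simple h.le).mp h
  exact (covBy_iff_quot_is_simple h').mpr (IsSimpleModule.congr e.symm)

section CompositionFactors

variable {Λ : Type*} {D : Λ → Type*} [∀ μ, AddCommGroup (D μ)] [∀ μ, Module A (D μ)]
  {p : Λ → Prop} {M M' : Type*} [AddCommGroup M] [Module A M] [AddCommGroup M'] [Module A M']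

theorem CompositionFactorsIn.congr (e : M ≃ₗ[A] M') (h : CompositionFactorsIn A D p M) :
    CompositionFactorsIn A D p M' := by
  intro N₁ N₂ hN
  obtain ⟨g⟩ := nonempty_subquotient_equiv (e.symm : M' →ₗ[A] M) (N₁ := N₁) (N₂ := N₂)
    (N₁' := N₁.map (e.symm : M' →ₗ[A] M)) rfl
    (fun x _ => ⟨Submodule.mem_map_of_mem, fun ⟨y, hy, hxy⟩ => e.symm.injective hxy ▸ hy⟩)
  obtain ⟨μ, hμ, ⟨g'⟩⟩ := h _ _ (covBy_of_subquotient_equiv hN (Submodule.map_mono hN.le) g)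
  exact ⟨μ, hμ, ⟨g.trans g'⟩⟩

/-- An idempotent that kills all admissible composition factors of a module kills the module. -/
theorem CompositionFactorsIn.smul_eq_zero (h : CompositionFactorsIn A D p M) {a : A}
    (ha : IsIdempotentElem a) (hD : ∀ μ, p μ → ∀ d : D μ, a • d = 0) (x : M) : a • x = 0 := by
  by_contra hx
  -- A nonzero cyclic module has a maximal submodule `N`. The simple quotient is killed by `a`, yet
  -- `a` fixes the generator `a • x`; so the generator lies in `N`, which is absurd.
  obtain ⟨N, hN⟩ : ∃ N : Submodule A M, N ⋖ Submodule.span A {a • x} := by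
    let S := Submodule.span A {a • x}
    have : Nontrivial S := Submodule.nontrivial_iff_ne_bot.mpr (by simpa [S] using hx)
    obtain ⟨m, hm, -⟩ := (eq_top_or_exists_le_coatom (⊥ : Submodule A S)).resolve_left bot_ne_top
    refine ⟨m.map S.subtype, (covBy_iff_quot_is_simple (Submodule.map_subtype_le S m)).mpr ?_⟩
    rw [Submodule.comap_map_eq_of_injective S.injective_subtype]
    exact isSimpleModule_iff_isCoatom.mpr hm
  obtain ⟨μ, hμ, ⟨g⟩⟩ := h _ _ hN
  refine hN.lt.not_ge ?_
  rw [Submodule.span_singleton_le_iff_mem]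
  let y : Submodule.span A {a • x} := ⟨a • x, Submodule.mem_span_singleton_self _⟩
  have hy : g (Submodule.Quotient.mk y) = 0 := by
    have : a • y = y := Subtype.ext (by
      change a • a • x = a • x
      rw [← mul_smul, ha])
    rw [← this, Submodule.Quotient.mk_smul, map_smul]
    exact hD μ hμ _
  rw [map_eq_zero_iff g g.injective, Submodule.Quotient.mk_eq_zero] at hy
  exact hy

end CompositionFactors

variable {M M' : Type*} [AddCommGroup M] [Module A M] [AddCommGroup M'] [Module A M']

theorem nonempty_jacobson_equiv (e : M ≃ₗ[A] M') :
    Nonempty (Module.jacobson A M ≃ₗ[A] Module.jacobson A M') := by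
  have h := Module.map_jacobson_of_bijective (f := (e : M →ₗ[A] M')) e.bijective
  exact ⟨e.ofSubmodules _ _ h⟩

theorem socle_le_map (e : M ≃ₗ[A] M') : (socle A M).map (e : M →ₗ[A] M') ≤ socle A M' := by
  rw [socle, sSup_eq_iSup', Submodule.map_iSup]
  refine iSup_le fun S => le_sSup ?_
  have : IsSimpleModule A S.1 := S.2
  exact IsSimpleModule.congr (e.submoduleMap S.1).symm

theorem map_socle (e : M ≃ₗ[A] M') : (socle A M).map (e : M →ₗ[A] M') = socle A M' := by
  refine le_antisymm (socle_le_map e) ?_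
  have h := Submodule.map_mono (f := (e : M →ₗ[A] M')) (socle_le_map e.symm)
  rwa [← Submodule.map_comp, LinearEquiv.comp_coe, LinearEquiv.symm_trans_self,
    LinearEquiv.refl_toLinearMap, Submodule.map_id] at h

theorem nonempty_quotient_socle_equiv (e : M ≃ₗ[A] M') :
    Nonempty ((M ⧸ socle A M) ≃ₗ[A] (M' ⧸ socle A M')) :=
  ⟨Submodule.Quotient.equiv _ _ e (map_socle e)⟩

/-! ### Projective covers and injective envelopes -/

/-- Choose `P` minimal among the projective left ideals that map onto `D`. If `N + ker π = P`, then
`π` lifts to a map `P → N`, giving an endomorphism `g` with image in `N` and `πg = π`. By Fitting's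
lemma the image of a high power of `g` is a direct summand of `P`, still mapping onto `D`, so by
minimality it is all of `P`. -/
theorem exists_projectiveCover {A : Type v} [Ring A] [IsArtinianRing A] [IsNoetherianRing A]
    (D : Type*) [AddCommGroup D] [Module A D] [IsSimpleModule A D] :
    ∃ (P : Submodule A A) (π : P →ₗ[A] D), IsProjectiveCover A π := by
  let S : Set (Submodule A A) := {P | Module.Projective A P ∧ ∃ π : P →ₗ[A] D, Function.Surjective π}
  have hS : S.Nonempty := by
    refine ⟨⊤, Module.Projective.of_equiv Submodule.topEquiv.symm, ?_⟩
    have := IsSimpleModule.nontrivial A D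
    obtain ⟨d, hd⟩ := exists_ne (0 : D)
    exact ⟨LinearMap.toSpanSingleton A D d ∘ₗ Submodule.topEquiv.toLinearMap,
      (IsSimpleModule.toSpanSingleton_surjective A hd).comp Submodule.topEquiv.surjective⟩
  obtain ⟨P, ⟨hP, π, hπ⟩, hmin⟩ := WellFounded.has_min (wellFounded_lt (α := Submodule A A)) S hS
  refine ⟨P, π, hP, hπ, fun N hN => ?_⟩
  have hNsurj : Function.Surjective (π ∘ₗ N.subtype) := by
    intro d
    obtain ⟨x, rfl⟩ := hπ d
    obtain ⟨y, hy, z, hz, rfl⟩ := Submodule.mem_sup.mp (hN ▸ Submodule.mem_top : x ∈ N ⊔ LinearMap.ker π)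
    exact ⟨⟨y, hy⟩, by simp [LinearMap.mem_ker.mp hz]⟩
  obtain ⟨f, hf⟩ := Module.projective_lifting_property (π ∘ₗ N.subtype) π hNsurj
  let g : Module.End A P := N.subtype ∘ₗ f
  have hg : ∀ x, π (g x) = π x := fun x => LinearMap.congr_fun hf x
  have hgn : ∀ n x, π ((g ^ n) x) = π x := by
    intro n
    induction n with
    | zero => simp
    | succ n ih => intro x; rw [pow_succ', Module.End.mul_apply, hg, ih]
  obtain ⟨n, hn⟩ := Filter.eventually_atTop.mp g.eventually_isCompl_ker_pow_range_pow
  -- The exponent is positive, so that the power has the form `g ∘ g ^ n` and its image lies in `N`.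
  have hc := hn (n + 1) (Nat.le_succ n)
  set Q := LinearMap.range (g ^ (n + 1)) with hQ
  have hQproj : Module.Projective A Q := by
    refine Module.Projective.of_split Q.subtype (Submodule.projectionOnto _ _ hc.symm) ?_
    ext x
    rw [LinearMap.comp_apply, Submodule.subtype_apply, Submodule.projectionOnto_apply_left,
      LinearMap.id_apply]
  have hQS : Q.map P.subtype ∈ S := by
    let e := P.equivSubtypeMap Q
    refine ⟨Module.Projective.of_equiv e, π ∘ₗ Q.subtype ∘ₗ e.symm.toLinearMap, ?_⟩
    intro d
    obtain ⟨x, rfl⟩ := hπ d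
    refine ⟨e ⟨(g ^ (n + 1)) x, ⟨x, rfl⟩⟩, ?_⟩
    simp [hgn]
  have hQtop : Q = ⊤ := by
    by_contra hne
    refine hmin _ hQS ((Submodule.map_subtype_le P Q).lt_of_ne fun h : Q.map P.subtype = P => hne ?_)
    rw [eq_top_iff]
    intro x _
    obtain ⟨y, hy, hyx⟩ := h.ge x.2
    exact Subtype.ext hyx ▸ hy
  rw [eq_top_iff, ← hQtop]
  rintro _ ⟨x, rfl⟩
  rw [pow_succ', Module.End.mul_apply]
  exact (f _).2

/-- Extend `ι'` along `ι` to `f : I → I'`. Essentiality of `ι` makes `f` injective, injectivity of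
`I` gives a retraction `g` of `f`, and essentiality of `ι'` makes `g` injective. So `f` and `g` are
mutually inverse. -/
theorem IsInjectiveEnvelope.nonempty_equiv {D I I' : Type w} [AddCommGroup D]
    [Module A D] [AddCommGroup I] [Module A I] [AddCommGroup I'] [Module A I']
    {ι : D →ₗ[A] I} {ι' : D →ₗ[A] I'} (h : IsInjectiveEnvelope A ι)
    (h' : IsInjectiveEnvelope A ι') : Nonempty (I ≃ₗ[A] I') := by
  obtain ⟨hI, hinj, hess⟩ := h
  obtain ⟨hI', hinj', hess'⟩ := h'
  obtain ⟨f, hf⟩ := hI'.out ι hinj ι'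
  have hfker : LinearMap.ker f = ⊥ := by
    refine hess _ ((Submodule.eq_bot_iff _).mpr ?_)
    rintro _ ⟨hx, d, rfl⟩
    rw [SetLike.mem_coe, LinearMap.mem_ker, hf, map_eq_zero_iff _ hinj'] at hx
    rw [hx, map_zero]
  have hfinj := LinearMap.ker_eq_bot.mp hfker
  obtain ⟨g, hg⟩ := hI.out f hfinj LinearMap.id
  have hgker : LinearMap.ker g = ⊥ := by
    refine hess' _ ((Submodule.eq_bot_iff _).mpr ?_)
    rintro _ ⟨hx, d, rfl⟩
    rw [SetLike.mem_coe, LinearMap.mem_ker, ← hf, hg, LinearMap.id_apply,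
      map_eq_zero_iff _ hinj] at hx
    rw [hx, map_zero]
  exact ⟨LinearEquiv.ofBijective f ⟨hfinj, fun y =>
    ⟨g y, LinearMap.ker_eq_bot.mp hgker (hg (g y))⟩⟩⟩

end ModuleTheory

/-! ### Duality of modules along an anti-involution -/

section DualTheory

variable {k : Type*} [Field k] {B : Type*} [Ring B] [Algebra k B] (σ : B →ₐ[k] Bᵐᵒᵖ)
  {M : Type*} [AddCommGroup M] [Module k M] [Module B M] [IsScalarTower k B M]
  {N : Type*} [AddCommGroup N] [Module k N] [Module B N] [IsScalarTower k B N]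

/-- The transpose of a `B`-linear map. -/
def circMap (f : M →ₗ[B] N) : CircDual σ N →ₗ[B] CircDual σ M where
  toFun φ := (CircDual.toDual σ M).symm (CircDual.toDual σ N φ ∘ₗ f.restrictScalars k)
  map_add' _ _ := rfl
  map_smul' b φ := circDual_ext σ M fun m => by
    simp [circDual_smul_apply]

theorem circMap_apply (f : M →ₗ[B] N) (φ : CircDual σ N) (m : M) :
    CircDual.toDual σ M (circMap σ f φ) m = CircDual.toDual σ N φ (f m) := rfl

/-- The transpose of a `B`-linear equivalence. -/
def circEquiv (e : M ≃ₗ[B] N) : CircDual σ M ≃ₗ[B] CircDual σ N :=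
  LinearEquiv.ofLinearMap (circMap σ (e.symm : N →ₗ[B] M)) (circMap σ (e : M →ₗ[B] N))
    (LinearMap.ext fun φ => circDual_ext σ N fun n => by simp [circMap_apply])
    (LinearMap.ext fun φ => circDual_ext σ M fun m => by simp [circMap_apply])

theorem circMap_injective {f : M →ₗ[B] N} (hf : Function.Surjective f) :
    Function.Injective (circMap σ f) := by
  intro φ ψ h
  refine circDual_ext σ N fun n => ?_
  obtain ⟨m, rfl⟩ := hf n
  rw [← circMap_apply, h, circMap_apply]

/-- Over a field `f` has a `k`-linear retraction; `B`-linearity of the retraction is not needed to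
extend a linear form. -/
theorem circMap_surjective {f : M →ₗ[B] N} (hf : Function.Injective f) :
    Function.Surjective (circMap σ f) := by
  intro φ
  obtain ⟨g, hg⟩ := LinearMap.exists_leftInverse_of_injective (f.restrictScalars k)
    (LinearMap.ker_eq_bot.mpr hf)
  refine ⟨(CircDual.toDual σ N).symm (CircDual.toDual σ M φ ∘ₗ g), circDual_ext σ M fun m => ?_⟩
  exact congrArg (CircDual.toDual σ M φ) (LinearMap.congr_fun hg m)

instance [Module.Finite k M] : Module.Finite k (CircDual σ M) :=
  inferInstanceAs (Module.Finite k (Module.Dual k M))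

variable (M) in
/-- The annihilator in `M°` of a submodule of `M`. -/
def circAnn (L : Submodule B M) : Submodule B (CircDual σ M) where
  carrier := {φ | ∀ m ∈ L, CircDual.toDual σ M φ m = 0}
  add_mem' hφ hψ m hm := by rw [map_add, LinearMap.add_apply, hφ m hm, hψ m hm, add_zero]
  zero_mem' m _ := by rw [map_zero, LinearMap.zero_apply]
  smul_mem' b φ hφ m hm := by
    rw [circDual_smul_apply]
    exact hφ _ (L.smul_mem _ hm)

theorem mem_circAnn {L : Submodule B M} {φ : CircDual σ M} :
    φ ∈ circAnn σ M L ↔ ∀ m ∈ L, CircDual.toDual σ M φ m = 0 := Iff.rfl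

/-- A vector outside `L'` is detected by a linear form that vanishes on `L'`. -/
theorem circAnn_le_circAnn {L L' : Submodule B M} :
    circAnn σ M L' ≤ circAnn σ M L ↔ L ≤ L' := by
  refine ⟨fun h m hm => ?_, fun h φ hφ m hm => hφ m (h hm)⟩
  by_contra hm'
  obtain ⟨φ, hφ, hL⟩ := Submodule.exists_le_ker_of_notMem (p := L'.restrictScalars k) hm'
  exact hφ (h (x := (CircDual.toDual σ M).symm φ) (fun x hx => LinearMap.mem_ker.mp (hL hx)) m hm)

/-- The quotient of `M°` by the annihilator of `L` is `L°`. -/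
theorem nonempty_quotient_circAnn_equiv (L : Submodule B M) :
    Nonempty ((CircDual σ M ⧸ circAnn σ M L) ≃ₗ[B] CircDual σ L) := by
  have hker : LinearMap.ker (circMap σ L.subtype) = circAnn σ M L := by
    ext φ
    rw [LinearMap.mem_ker, mem_circAnn]
    exact ⟨fun h m hm => LinearMap.congr_fun (congrArg (CircDual.toDual σ L) h) ⟨m, hm⟩,
      fun h => circDual_ext σ L fun m => h m.1 m.2⟩
  exact ⟨(Submodule.quotEquivOfEq _ _ hker.symm).trans
    ((circMap σ L.subtype).quotKerEquivOfSurjective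
      (circMap_surjective σ L.injective_subtype))⟩

/-- The annihilator of `L` is `(M / L)°`. -/
theorem nonempty_circAnn_equiv (L : Submodule B M) :
    Nonempty (circAnn σ M L ≃ₗ[B] CircDual σ (M ⧸ L)) := by
  have hrange : LinearMap.range (circMap σ L.mkQ) = circAnn σ M L := by
    ext φ
    constructor
    · rintro ⟨ψ, rfl⟩ m hm
      rw [circMap_apply, Submodule.mkQ_apply, (Submodule.Quotient.mk_eq_zero L).mpr hm, map_zero]
    · intro h
      refine ⟨(CircDual.toDual σ (M ⧸ L)).symm ((Submodule.liftQ (L.restrictScalars k)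
        (CircDual.toDual σ M φ) h) ∘ₗ LinearMap.id), circDual_ext σ M fun m => rfl⟩
  exact ⟨((LinearEquiv.ofInjective _ (circMap_injective σ L.mkQ_surjective)).trans
    (LinearEquiv.ofEq _ _ hrange)).symm⟩

variable {σ} (hσ : ∀ b, (σ (σ b).unop).unop = b)

include hσ

/-- The natural map to the double dual. -/
def circEval : M →ₗ[B] CircDual σ (CircDual σ M) where
  toFun m := (CircDual.toDual σ _).symm
    (Module.Dual.eval k M m ∘ₗ (CircDual.toDual σ M).toLinearMap)
  map_add' m m' := circDual_ext σ _ fun φ => map_add (CircDual.toDual σ M φ) m m'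
  map_smul' b m := circDual_ext σ _ fun φ => by
    rw [RingHom.id_apply, circDual_smul_apply]
    change CircDual.toDual σ M φ (b • m) = CircDual.toDual σ M ((σ b).unop • φ) m
    rw [circDual_smul_apply, hσ]

variable (M) in
theorem nonempty_circBidual [Module.Finite k M] :
    Nonempty (M ≃ₗ[B] CircDual σ (CircDual σ M)) :=
  ⟨LinearEquiv.ofBijective (circEval hσ) (Module.bijective_dual_eval k M)⟩

/-- The submodule is recovered from its set of common zeros. Finite dimension enters because a
linear form on `M°` separating `φ` from `L` must be evaluation at a vector of `M`. -/
theorem exists_circAnn_eq [Module.Finite k M] (L : Submodule B (CircDual σ M)) :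
    ∃ L' : Submodule B M, circAnn σ M L' = L := by
  let L' : Submodule B M :=
    { carrier := {m | ∀ φ ∈ L, CircDual.toDual σ M φ m = 0}
      add_mem' := fun hm hm' φ hφ => by rw [map_add, hm φ hφ, hm' φ hφ, add_zero]
      zero_mem' := fun φ _ => map_zero _
      smul_mem' := fun b m hm φ hφ => by
        have := hm _ (L.smul_mem (σ b).unop hφ)
        rwa [circDual_smul_apply, hσ] at this }
  refine ⟨L', le_antisymm (fun φ hφ => ?_) fun φ hφ m hm => hm φ hφ⟩
  by_contra h
  obtain ⟨x, hx, hL⟩ := Submodule.exists_le_ker_of_notMem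
    (p := L.restrictScalars k) (v := φ) h
  obtain ⟨m, hm⟩ := (Module.bijective_dual_eval k M).2 (x ∘ₗ (CircDual.toDual σ M).symm.toLinearMap)
  have key : ∀ ψ : CircDual σ M, x ψ = CircDual.toDual σ M ψ m := fun ψ =>
    (LinearMap.congr_fun hm (CircDual.toDual σ M ψ)).symm
  refine hx ?_
  rw [key]
  exact hφ m fun ψ hψ => by rw [← key]; exact hL hψ

variable (M) in
/-- The inclusion-reversing bijection between submodules of `M` and submodules of `M°`. -/
noncomputable def circAnnIso [Module.Finite k M] : Submodule B M ≃o (Submodule B (CircDual σ M))ᵒᵈ :=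
  RelIso.ofSurjective (OrderEmbedding.ofMapLEIff (fun L => OrderDual.toDual (circAnn σ M L))
    fun _ _ => circAnn_le_circAnn σ) fun L =>
      (exists_circAnn_eq hσ (OrderDual.ofDual L)).imp fun _ h => congrArg OrderDual.toDual h

theorem circAnnIso_apply [Module.Finite k M] (L : Submodule B M) :
    circAnnIso M hσ L = OrderDual.toDual (circAnn σ M L) := rfl

theorem isAtom_circAnn_iff [Module.Finite k M] {L : Submodule B M} :
    IsAtom (circAnn σ M L) ↔ IsCoatom L := by
  rw [← OrderIso.isCoatom_iff (circAnnIso M hσ), circAnnIso_apply, isCoatom_dual_iff_isAtom]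

theorem circAnn_covBy_iff [Module.Finite k M] {L L' : Submodule B M} :
    circAnn σ M L' ⋖ circAnn σ M L ↔ L ⋖ L' := by
  rw [← apply_covBy_apply_iff (circAnnIso M hσ), circAnnIso_apply, circAnnIso_apply,
    toDual_covBy_toDual_iff]

theorem isSimpleModule_circDual [Module.Finite k M] [IsSimpleModule B M] :
    IsSimpleModule B (CircDual σ M) := by
  have h : IsSimpleOrder (Submodule B M) := isSimpleModule_iff B M |>.mp inferInstance
  rw [isSimpleModule_iff]
  exact isSimpleOrder_iff_isSimpleOrder_orderDual.mpr
    ((circAnnIso M hσ).isSimpleOrder_iff.mp h)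

variable (M) in
-- Annihilators turn maximal submodules into simple ones, hence the intersection of the former into
-- the sum of the latter.
theorem circAnn_jacobson [Module.Finite k M] :
    circAnn σ M (Module.jacobson B M) = socle B (CircDual σ M) := by
  refine le_antisymm ?_ (sSup_le fun S hS => ?_)
  · obtain ⟨L, hL⟩ := exists_circAnn_eq hσ (socle B (CircDual σ M))
    rw [← hL, circAnn_le_circAnn]
    refine le_sInf fun L' hL' => ?_
    rw [← circAnn_le_circAnn σ, hL]
    exact le_sSup (isSimpleModule_iff_isAtom.mpr ((isAtom_circAnn_iff hσ).mpr hL'))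
  · obtain ⟨L, rfl⟩ := exists_circAnn_eq hσ S
    rw [circAnn_le_circAnn]
    exact sInf_le ((isAtom_circAnn_iff hσ).mp (isSimpleModule_iff_isAtom.mp hS))

variable (M) in
theorem nonempty_quotient_socle_circDual_equiv [Module.Finite k M] :
    Nonempty ((CircDual σ M ⧸ socle B (CircDual σ M)) ≃ₗ[B]
      CircDual σ (Module.jacobson B M)) := by
  rw [← circAnn_jacobson M hσ]
  exact nonempty_quotient_circAnn_equiv σ _

omit hσ in
variable (σ) in
-- Restricting forms to `L` maps the annihilator of `K` onto the annihilator of `K` inside `L°`,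
-- which is `(L / K)°`; the kernel is the annihilator of `L`.
theorem nonempty_circAnn_subquotient_equiv {K L : Submodule B M} (h : K ≤ L) :
    Nonempty ((circAnn σ M K ⧸ (circAnn σ M L).submoduleOf (circAnn σ M K)) ≃ₗ[B]
      CircDual σ (L ⧸ K.submoduleOf L)) := by
  have h₂ : circAnn σ L (K.submoduleOf L) = (circAnn σ M K).map (circMap σ L.subtype) := by
    ext φ
    constructor
    · intro hφ
      obtain ⟨ψ, rfl⟩ := circMap_surjective σ L.injective_subtype φ
      exact ⟨ψ, fun m hm => hφ ⟨m, h hm⟩ hm, rfl⟩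
    · rintro ⟨ψ, hψ, rfl⟩ m hm
      exact hψ m.1 hm
  obtain ⟨e⟩ := nonempty_subquotient_equiv (circMap σ L.subtype) (N₁ := circAnn σ M L)
    (N₁' := ⊥) h₂ (fun φ _ => by
      rw [Submodule.mem_bot, mem_circAnn]
      exact ⟨fun h => circDual_ext σ L fun m => h m.1 m.2,
        fun h m hm => LinearMap.congr_fun (congrArg (CircDual.toDual σ L) h) ⟨m, hm⟩⟩)
  obtain ⟨e'⟩ := nonempty_circAnn_equiv σ (K.submoduleOf L)
  have hbot : (⊥ : Submodule B (CircDual σ L)).submoduleOf (circAnn σ L (K.submoduleOf L)) = ⊥ := by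
    exact (Submodule.comap_bot _).trans (Submodule.ker_subtype _)
  exact ⟨(e.trans (Submodule.quotEquivOfEqBot _ hbot)).trans e'⟩

/-- Covering pairs of submodules of `M°` are the reversed covering pairs of `M`, with dual
subquotients; `hpq` then translates the labels. -/
theorem CompositionFactorsIn.circDual [Module.Finite k M] {Λ : Type*} {D : Λ → Type*}
    [∀ μ, AddCommGroup (D μ)] [∀ μ, Module k (D μ)] [∀ μ, Module B (D μ)]
    [∀ μ, IsScalarTower k B (D μ)] {p q : Λ → Prop} (h : CompositionFactorsIn B D p M)
    (hpq : ∀ μ, p μ → ∃ ν, q ν ∧ Nonempty (CircDual σ (D μ) ≃ₗ[B] D ν)) :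
    CompositionFactorsIn B D q (CircDual σ M) := by
  intro N₁ N₂ hN
  obtain ⟨L, rfl⟩ := exists_circAnn_eq hσ N₁
  obtain ⟨K, rfl⟩ := exists_circAnn_eq hσ N₂
  rw [circAnn_covBy_iff hσ] at hN
  obtain ⟨μ, hμ, ⟨e⟩⟩ := h K L hN
  obtain ⟨ν, hν, ⟨e'⟩⟩ := hpq μ hμ
  obtain ⟨g⟩ := nonempty_circAnn_subquotient_equiv σ hN.le
  exact ⟨ν, hν, ⟨(g.trans (circEquiv σ e)).trans e'⟩⟩

/-- Transposition turns the problem of extending `X → M°` along `X → Y` into that of lifting `M →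
X°` along the surjection `Y° → X°`. Only the evaluation maps into double duals are used, so `X` and
`Y` may be infinite-dimensional. -/
theorem injective_circDual [Module.Projective B M] : Module.Injective B (CircDual σ M) where
  out := fun X Y _ _ _ _ f hf g => by
    let _ : Module k X := Module.compHom X (algebraMap k B)
    let _ : Module k Y := Module.compHom Y (algebraMap k B)
    have _ : IsScalarTower k B X := IsScalarTower.of_algebraMap_smul fun _ _ => rfl
    have _ : IsScalarTower k B Y := IsScalarTower.of_algebraMap_smul fun _ _ => rfl
    obtain ⟨h, hh⟩ := Module.projective_lifting_property (circMap σ f)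
      (circMap σ g ∘ₗ circEval hσ) (circMap_surjective σ hf)
    refine ⟨circMap σ h ∘ₗ circEval hσ, fun x => circDual_ext σ M fun m => ?_⟩
    exact LinearMap.congr_fun (congrArg (CircDual.toDual σ X) (LinearMap.congr_fun hh m)) x

/-- The image of the transpose of `π` contains the annihilator of `ker π`. If the annihilator of `K`
meets this image trivially, then only the zero form kills `K + ker π`, so `K + ker π = M` and `K =
M` by superfluity. -/
theorem IsProjectiveCover.circDual [Module.Finite k M] {π : M →ₗ[B] N}
    (h : IsProjectiveCover B π) : IsInjectiveEnvelope B (circMap σ π) := by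
  obtain ⟨hproj, hsurj, hsup⟩ := h
  refine ⟨injective_circDual hσ, circMap_injective σ hsurj, fun L hL => ?_⟩
  obtain ⟨K, rfl⟩ := exists_circAnn_eq hσ L
  have hK : K = ⊤ := by
    refine hsup K ?_
    rw [eq_top_iff, ← circAnn_le_circAnn σ]
    refine le_trans (le_trans (le_inf ((circAnn_le_circAnn σ).mpr le_sup_left) ?_) hL.le) bot_le
    refine le_trans ((circAnn_le_circAnn σ).mpr le_sup_right) ?_
    intro φ hφ
    -- A form vanishing on `ker π` descends to `N`; a `k`-linear section of `π` writes down the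
    -- descended form.
    obtain ⟨g, hg⟩ := (π.restrictScalars k).exists_rightInverse_of_surjective
      (LinearMap.range_eq_top.mpr hsurj)
    refine ⟨(CircDual.toDual σ N).symm (CircDual.toDual σ M φ ∘ₗ g), circDual_ext σ M fun m => ?_⟩
    have := hφ (g (π m) - m) (by
      rw [LinearMap.mem_ker, map_sub, sub_eq_zero]
      exact LinearMap.congr_fun hg (π m))
    rw [map_sub, sub_eq_zero] at this
    exact this
  refine (Submodule.eq_bot_iff _).mpr fun φ hφ => circDual_ext σ M fun m => ?_
  exact hφ m (hK ▸ Submodule.mem_top)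

end DualTheory

/-! ### Costandard modules as duals of standard modules. -/

section Costandard

variable {k : Type u} [Field k] {B : Type*} [Ring B] [Algebra k B] {σ : B →ₐ[k] Bᵐᵒᵖ}
  {Λ : Type*} {D : Λ → Type (max u w)}
  [∀ μ, AddCommGroup (D μ)] [∀ μ, Module k (D μ)] [∀ μ, Module B (D μ)]
  [∀ μ, IsScalarTower k B (D μ)] {d : Λ → Λ} {lt : Λ → Λ → Prop} {lam : Λ}
  {P : Type (max u w)} [AddCommGroup P] [Module k P] [Module B P] [IsScalarTower k B P]
  [Module.Finite k P] {π : P →ₗ[B] D (d lam)} {K : Submodule B P}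

/-- The annihilator of `K` is `(P / K)°`, so its quotient by the socle is the dual of the radical of
`P / K`. Dualising replaces each factor `D μ` by `D (d μ)`, and `d` respects `lt`. The opposite
implication passes through the double dual. -/
theorem compositionFactorsIn_circAnn_quotient_socle_iff (hσ : ∀ b, (σ (σ b).unop).unop = b)
    (hd : ∀ μ, d (d μ) = μ) (hD : ∀ μ ν, ν = d μ → Nonempty (CircDual σ (D μ) ≃ₗ[B] D ν))
    (hlt : ∀ μ ν, lt μ ν → lt (d μ) (d ν)) (K : Submodule B P) :
    CompositionFactorsIn B D (fun μ => lt μ lam) (circAnn σ P K ⧸ socle B (circAnn σ P K)) ↔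
      CompositionFactorsIn B D (fun μ => lt μ (d lam)) (Module.jacobson B (P ⧸ K)) := by
  have : Module.Finite k (Module.jacobson B (P ⧸ K)) :=
    Module.Finite.of_injective ((Module.jacobson B (P ⧸ K)).subtype.restrictScalars k)
      Subtype.val_injective
  obtain ⟨e₁⟩ := nonempty_circAnn_equiv σ K
  obtain ⟨e₂⟩ := nonempty_quotient_socle_equiv e₁
  obtain ⟨e₃⟩ := nonempty_quotient_socle_circDual_equiv (P ⧸ K) hσ
  obtain ⟨e₄⟩ := nonempty_circBidual (Module.jacobson B (P ⧸ K)) hσ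
  constructor
  · intro h
    refine CompositionFactorsIn.congr e₄.symm (CompositionFactorsIn.circDual hσ
      (h.congr (e₂.trans e₃)) fun μ hμ => ⟨d μ, hlt μ lam hμ, hD μ _ rfl⟩)
  · intro h
    refine (h.circDual hσ fun μ hμ => ⟨d μ, ?_, hD μ _ rfl⟩).congr (e₂.trans e₃).symm
    have := hlt _ _ hμ
    rwa [hd] at this

/-- Annihilators reverse inclusions, so the least admissible kernel in the projective cover becomes
the greatest admissible submodule of its dual. -/
theorem exists_isInjectiveEnvelope_isGreatest (hσ : ∀ b, (σ (σ b).unop).unop = b)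
    (hd : ∀ μ, d (d μ) = μ) (hD : ∀ μ ν, ν = d μ → Nonempty (CircDual σ (D μ) ≃ₗ[B] D ν))
    (hlt : ∀ μ ν, lt μ ν → lt (d μ) (d ν)) (hπ : IsProjectiveCover B π)
    (hK : IsLeast {K' : Submodule B P |
      CompositionFactorsIn B D (fun μ => lt μ (d lam)) (Module.jacobson B (P ⧸ K'))} K) :
    ∃ ι : D lam →ₗ[B] CircDual σ P, IsInjectiveEnvelope B ι ∧
      IsGreatest {N : Submodule B (CircDual σ P) |
        CompositionFactorsIn B D (fun μ => lt μ lam) (N ⧸ socle B N)} (circAnn σ P K) := by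
  -- Since `d (d lam) = lam` is only a propositional equality, `hD` takes the dual label as a
  -- variable with an equation; no transport between types is needed.
  obtain ⟨e⟩ := hD (d lam) lam (hd lam).symm
  obtain ⟨hinj, hι, hess⟩ := hπ.circDual hσ
  have hiff := compositionFactorsIn_circAnn_quotient_socle_iff (P := P) (lam := lam) hσ hd hD hlt
  refine ⟨circMap σ π ∘ₗ (e.symm : D lam →ₗ[B] _), ⟨hinj, hι.comp e.symm.injective, ?_⟩,
    (hiff K).mpr hK.1, fun N hN => ?_⟩
  · rwa [LinearMap.range_comp_of_range_eq_top _ (LinearEquiv.range e.symm)]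
  · obtain ⟨K', rfl⟩ := exists_circAnn_eq hσ N
    exact (circAnn_le_circAnn σ).mpr (hK.2 ((hiff K').mp hN))

/-- The dual of a standard module is a costandard module. -/
theorem isCostandardModule_circDual (hσ : ∀ b, (σ (σ b).unop).unop = b)
    (hd : ∀ μ, d (d μ) = μ) (hD : ∀ μ ν, ν = d μ → Nonempty (CircDual σ (D μ) ≃ₗ[B] D ν))
    (hlt : ∀ μ ν, lt μ ν → lt (d μ) (d ν)) (hπ : IsProjectiveCover B π)
    (hK : IsLeast {K' : Submodule B P |
      CompositionFactorsIn B D (fun μ => lt μ (d lam)) (Module.jacobson B (P ⧸ K'))} K) :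
    IsCostandardModule B D lt lam (CircDual σ (P ⧸ K)) := by
  obtain ⟨ι, hι, hg⟩ := exists_isInjectiveEnvelope_isGreatest hσ hd hD hlt hπ hK
  exact ⟨CircDual σ P, inferInstance, inferInstance, ι, _, hι, hg,
    (nonempty_circAnn_equiv σ K).map LinearEquiv.symm⟩

/-- Every costandard module is the dual of a given standard module. -/
theorem IsCostandardModule.nonempty_equiv_circDual (hσ : ∀ b, (σ (σ b).unop).unop = b)
    (hd : ∀ μ, d (d μ) = μ) (hD : ∀ μ ν, ν = d μ → Nonempty (CircDual σ (D μ) ≃ₗ[B] D ν))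
    (hlt : ∀ μ ν, lt μ ν → lt (d μ) (d ν)) (hπ : IsProjectiveCover B π)
    (hK : IsLeast {K' : Submodule B P |
      CompositionFactorsIn B D (fun μ => lt μ (d lam)) (Module.jacobson B (P ⧸ K'))} K)
    {N : Type (max u w)} [AddCommGroup N] [Module B N] (hN : IsCostandardModule B D lt lam N) :
    Nonempty (N ≃ₗ[B] CircDual σ (P ⧸ K)) := by
  obtain ⟨ι, hι, hg⟩ := exists_isInjectiveEnvelope_isGreatest hσ hd hD hlt hπ hK
  obtain ⟨I, _, _, ι', L, hι', hg', ⟨e⟩⟩ := hN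
  obtain ⟨f⟩ := hι'.nonempty_equiv hι
  have hcf : ∀ L' : Submodule B I,
      CompositionFactorsIn B D (fun μ => lt μ lam) (L' ⧸ socle B L') ↔
      CompositionFactorsIn B D (fun μ => lt μ lam)
        (L'.map (f : I →ₗ[B] _) ⧸ socle B (L'.map (f : I →ₗ[B] CircDual σ P))) := by
    intro L'
    obtain ⟨g⟩ := nonempty_quotient_socle_equiv (f.submoduleMap L')
    exact ⟨fun h => h.congr g, fun h => h.congr g.symm⟩
  -- Admissibility is invariant under isomorphism, so `f` must match the two greatest admissible
  -- submodules.
  have hL : L.map (f : I →ₗ[B] CircDual σ P) = circAnn σ P K := by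
    refine le_antisymm (hg.2 ((hcf L).mp hg'.1)) ?_
    have hs : ((circAnn σ P K).comap (f : I →ₗ[B] CircDual σ P)).map (f : I →ₗ[B] CircDual σ P)
        = circAnn σ P K := Submodule.map_comap_eq_of_surjective f.surjective _
    rw [← hs]
    refine Submodule.map_mono (hg'.2 ((hcf _).mpr ?_))
    rw [hs]
    exact hg.1
  obtain ⟨g⟩ := nonempty_circAnn_equiv σ K
  exact ⟨((e.trans (f.submoduleMap L)).trans (LinearEquiv.ofEq _ _ hL)).trans g⟩

end Costandard

/-! ### Modules induced from a corner algebra -/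

section InducedTheory

variable {k : Type*} [Field k] {A : Type*} [Ring A] [Algebra k A] {e : A}
  (he : IsIdempotentElem e)

/-- The element `eae` of the corner `eAe`. -/
def cornerMk (a : A) : he.Corner :=
  ⟨e * a * e, (Subsemigroup.mem_corner_iff he).mpr
    ⟨by rw [mul_assoc, ← mul_assoc e e, he.eq], by rw [mul_assoc, he.eq]⟩⟩

theorem corner_one_val : (1 : he.Corner).1 = e := rfl

variable {M : Type*} [AddCommGroup M] [Module k M] [Module he.Corner M]
  [IsScalarTower k he.Corner M]

variable (k M) in
/-- The map `m ↦ e ⊗ m`. -/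
def inducedUnit : M →ₗ[k] Induced k he M :=
  (balancedRelations k he M).mkQ.restrictScalars k ∘ₗ
    TensorProduct.mk k (leftIdeal e) M ⟨e, Submodule.mem_span_singleton_self e⟩

theorem mk_tmul_eq (x : leftIdeal e) (m : M) :
    (Submodule.Quotient.mk (x ⊗ₜ[k] m) : Induced k he M) = x.1 • inducedUnit k he M m := by
  obtain ⟨x, hx⟩ := x
  obtain ⟨a, rfl⟩ := Submodule.mem_span_singleton.mp hx
  have h : (⟨a • e, hx⟩ : leftIdeal e) = (a • e) • ⟨e, Submodule.mem_span_singleton_self e⟩ :=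
    Subtype.ext (by simp [mul_assoc, he.eq])
  exact congrArg (fun y : leftIdeal e => (Submodule.Quotient.mk (y ⊗ₜ[k] m) : Induced k he M)) h

theorem smul_inducedUnit (b : he.Corner) (m : M) :
    b.1 • inducedUnit k he M m = inducedUnit k he M (b • m) := by
  have h : leftIdealMul he ⟨e, Submodule.mem_span_singleton_self e⟩ b =
      b.1 • ⟨e, Submodule.mem_span_singleton_self e⟩ := Subtype.ext (by
    change e * b.1 = b.1 * e
    rw [(corner_mem he b).1, (corner_mem he b).2])
  refine ((Submodule.Quotient.eq _).mpr ?_ :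
    (Submodule.Quotient.mk _ : Induced k he M) = Submodule.Quotient.mk _)
  refine Submodule.subset_span ⟨⟨e, Submodule.mem_span_singleton_self e⟩, b, m, ?_⟩
  rw [h]
  rfl

theorem idem_smul_inducedUnit (m : M) : e • inducedUnit k he M m = inducedUnit k he M m := by
  have := smul_inducedUnit (k := k) he 1 m
  rwa [one_smul] at this

theorem mul_idem_smul_inducedUnit (a : A) (m : M) :
    (a * e) • inducedUnit k he M m = a • inducedUnit k he M m := by
  rw [mul_smul, idem_smul_inducedUnit]

@[elab_as_elim]
theorem induced_induction {p : Induced k he M → Prop} (h0 : p 0)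
    (hadd : ∀ x y, p x → p y → p (x + y)) (hs : ∀ (a : A) m, p (a • inducedUnit k he M m))
    (z : Induced k he M) : p z := by
  obtain ⟨z, rfl⟩ := Submodule.mkQ_surjective _ z
  induction z using TensorProduct.induction_on with
  | zero => rwa [map_zero]
  | tmul x m => rw [Submodule.mkQ_apply, mk_tmul_eq]; exact hs _ _
  | add x y hx hy => rw [map_add]; exact hadd _ _ hx hy

theorem finite_quotient {N : Type*} [AddCommGroup N] [Module k N] [Module A N]
    [IsScalarTower k A N] [Module.Finite k N] (L : Submodule A N) : Module.Finite k (N ⧸ L) :=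
  Module.Finite.of_surjective (L.mkQ.restrictScalars k) L.mkQ_surjective

theorem finite_induced [Module.Finite k A] [Module.Finite k M] :
    Module.Finite k (Induced k he M) := by
  have : Module.Finite k (leftIdeal e) :=
    Module.Finite.of_injective ((leftIdeal e).subtype.restrictScalars k) Subtype.val_injective
  exact finite_quotient _

section Lift

variable {N : Type*} [AddCommGroup N] [Module k N] [Module A N] [IsScalarTower k A N]

/-- The universal property of `Ae ⊗_{eAe} M`. -/
def inducedLift (φ : M →ₗ[k] N) (hφ : ∀ (b : he.Corner) m, φ (b • m) = b.1 • φ m) :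
    Induced k he M →ₗ[A] N :=
  (balancedRelations k he M).liftQ
    (TensorProduct.AlgebraTensorModule.lift
      { toFun := fun x => x.1 • φ
        map_add' := fun x y => LinearMap.ext fun m => add_smul x.1 y.1 (φ m)
        map_smul' := fun a x => LinearMap.ext fun m => mul_smul a x.1 (φ m) }) (by
    rw [balancedRelations, Submodule.span_le]
    rintro _ ⟨x, b, m, rfl⟩
    rw [SetLike.mem_coe, LinearMap.mem_ker, map_sub, sub_eq_zero]
    change (x.1 * b.1) • φ m = x.1 • φ (b • m)
    rw [hφ, mul_smul])

theorem inducedLift_unit (φ : M →ₗ[k] N) (hφ : ∀ (b : he.Corner) m, φ (b • m) = b.1 • φ m)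
    (m : M) : inducedLift he φ hφ (inducedUnit k he M m) = φ m := by
  change e • φ m = φ m
  rw [← corner_one_val he, ← hφ, one_smul]

theorem induced_hom_ext {f g : Induced k he M →ₗ[A] N}
    (h : ∀ m, f (inducedUnit k he M m) = g (inducedUnit k he M m)) : f = g := by
  refine LinearMap.ext fun z => ?_
  induction z using induced_induction with
  | h0 => simp
  | hadd x y hx hy => rw [map_add, map_add, hx, hy]
  | hs a m => rw [map_smul, map_smul, h]

end Lift

/-- An isomorphism of `eAe`-modules induces an isomorphism of the induced modules. -/
theorem nonempty_induced_equiv {M' : Type*} [AddCommGroup M'] [Module k M'] [Module he.Corner M']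
    [IsScalarTower k he.Corner M'] (g : M ≃ₗ[he.Corner] M') :
    Nonempty (Induced k he M ≃ₗ[A] Induced k he M') := by
  refine ⟨LinearEquiv.ofLinearMap
    (inducedLift he (inducedUnit k he M' ∘ₗ (g.restrictScalars k).toLinearMap) fun b m => ?_)
    (inducedLift he (inducedUnit k he M ∘ₗ (g.symm.restrictScalars k).toLinearMap) fun b m => ?_)
    (induced_hom_ext he fun m => ?_) (induced_hom_ext he fun m => ?_)⟩
  · simp [smul_inducedUnit]
  · simp [smul_inducedUnit]
  · simp [inducedLift_unit]
  · simp [inducedLift_unit]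

variable (k M) in
/-- The map `x ⊗ m ↦ (exe) m` on `Ae ⊗ M`. -/
def tensorCounit : leftIdeal e ⊗[k] M →ₗ[k] M :=
  TensorProduct.lift (LinearMap.mk₂ k (fun x m => cornerMk he x.1 • m)
    (fun x y m => by
      rw [← add_smul]; congr 1; exact Subtype.ext (show e * (x.1 + y.1) * e = e * x.1 * e + e * y.1 * e by
        rw [mul_add, add_mul]))
    (fun c x m => by
      rw [← smul_assoc]; congr 1; exact Subtype.ext (show e * (c • x.1) * e = c • (e * x.1 * e) by
        rw [mul_smul_comm, smul_mul_assoc]))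
    (fun x m m' => smul_add _ _ _)
    (fun c x m => by
      rw [← algebraMap_smul he.Corner c m, ← mul_smul, ← Algebra.commutes, mul_smul,
        algebraMap_smul]))

/-- The counit is not `A`-linear, while the relations generate an `A`-submodule. The claim is
therefore proved for all multiples `a • z`, which makes the induction over the span work. -/
theorem tensorCounit_smul_eq_zero {z : leftIdeal e ⊗[k] M} (hz : z ∈ balancedRelations k he M)
    (a : A) : tensorCounit k he M (a • z) = 0 := by
  induction hz using Submodule.span_induction generalizing a with
  | mem z h =>
    obtain ⟨x, b, m, rfl⟩ := h
    rw [smul_sub, map_sub, sub_eq_zero, TensorProduct.smul_tmul', TensorProduct.smul_tmul']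
    change cornerMk he (a * (x.1 * b.1)) • m = cornerMk he (a * x.1) • b • m
    rw [← mul_smul]
    congr 1
    refine Subtype.ext ?_
    change e * (a * (x.1 * b.1)) * e = e * (a * x.1) * e * b.1
    simp only [mul_assoc, (corner_mem he b).2, (corner_mem he b).1]
  | zero => simp
  | add x y _ _ hx hy => rw [smul_add, map_add, hx, hy, add_zero]
  | smul c x _ hx => rw [← mul_smul, hx]

variable (k M) in
/-- The projection of `Ae ⊗_{eAe} M` onto its `e`-component `M`. -/
def inducedCounit : Induced k he M →ₗ[k] M :=
  ((balancedRelations k he M).restrictScalars k).liftQ (tensorCounit k he M) fun z hz => by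
    have := tensorCounit_smul_eq_zero (k := k) he hz 1
    rwa [one_smul] at this

theorem inducedCounit_smul_unit (a : A) (m : M) :
    inducedCounit k he M (a • inducedUnit k he M m) = cornerMk he a • m := by
  change cornerMk he (a * e) • m = _
  congr 1
  exact Subtype.ext (by simp [cornerMk, mul_assoc, he.eq])

/-- Together with `inducedCounit_unit` this identifies `M` with the `e`-component of the induced
module. -/
theorem inducedUnit_counit (z : Induced k he M) :
    inducedUnit k he M (inducedCounit k he M z) = e • z := by
  induction z using induced_induction with
  | h0 => simp
  | hadd x y hx hy => rw [map_add, map_add, hx, hy, smul_add]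
  | hs a m =>
    rw [inducedCounit_smul_unit, ← smul_inducedUnit, ← mul_smul]
    change (e * a * e) • _ = _
    rw [mul_idem_smul_inducedUnit]

theorem inducedCounit_unit (m : M) : inducedCounit k he M (inducedUnit k he M m) = m := by
  have h := inducedCounit_smul_unit (k := k) he e m
  rw [idem_smul_inducedUnit] at h
  rw [h]
  have h1 : cornerMk he e = 1 := Subtype.ext (by
    change e * e * e = e
    rw [he.eq, he.eq])
  rw [h1, one_smul]

theorem inducedCounit_corner_smul (b : he.Corner) (z : Induced k he M) :
    inducedCounit k he M (b.1 • z) = b • inducedCounit k he M z := by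
  have h : b.1 • z = inducedUnit k he M (b • inducedCounit k he M z) := by
    rw [← smul_inducedUnit, inducedUnit_counit, ← mul_smul, (corner_mem he b).2]
  rw [h, inducedCounit_unit]

/-! ### Modules induced from simple modules: radical and head. -/

section Simple

variable [IsSimpleModule he.Corner M]

/-- The submodule generated by `z` contains a nonzero element of the `e`-component. That component
is the simple module `M`, so all of it is reached, and it generates the induced module. -/
theorem span_singleton_eq_top_of_counit_ne_zero {z : Induced k he M} {a : A}
    (h : inducedCounit k he M (a • z) ≠ 0) : Submodule.span A {z} = ⊤ := by
  have hu : ∀ m, inducedUnit k he M m ∈ Submodule.span A {z} := by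
    intro m
    obtain ⟨b, rfl⟩ := IsSimpleModule.toSpanSingleton_surjective he.Corner h m
    rw [LinearMap.toSpanSingleton_apply, ← smul_inducedUnit, inducedUnit_counit]
    exact Submodule.smul_mem _ _ (Submodule.smul_mem _ _ (Submodule.smul_mem _ _
      (Submodule.mem_span_singleton_self z)))
  rw [eq_top_iff]
  intro y _
  induction y using induced_induction with
  | h0 => exact zero_mem _
  | hadd x y hx hy => exact add_mem (hx trivial) (hy trivial)
  | hs a m => exact Submodule.smul_mem _ _ (hu m)

variable (k M) in
/-- The largest proper submodule of `Ae ⊗_{eAe} M`, for a simple module `M`. -/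
def inducedRadical : Submodule A (Induced k he M) where
  carrier := {z | ∀ a : A, inducedCounit k he M (a • z) = 0}
  add_mem' hx hy a := by rw [smul_add, map_add, hx, hy, add_zero]
  zero_mem' a := by rw [smul_zero, map_zero]
  smul_mem' c x hx a := by rw [← mul_smul, hx]

theorem inducedRadical_ne_top : inducedRadical k he M ≠ ⊤ := by
  have := IsSimpleModule.nontrivial he.Corner M
  obtain ⟨m, hm⟩ := exists_ne (0 : M)
  intro h
  have h1 : inducedUnit k he M m ∈ inducedRadical k he M := h ▸ Submodule.mem_top
  have := h1 1
  rw [one_smul, inducedCounit_unit] at this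
  exact hm this

theorem le_inducedRadical {L : Submodule A (Induced k he M)} (hL : L ≠ ⊤) :
    L ≤ inducedRadical k he M := by
  intro z hz a
  by_contra h
  refine hL (eq_top_iff.mpr ?_)
  rw [← span_singleton_eq_top_of_counit_ne_zero he h]
  exact (Submodule.span_singleton_le_iff_mem z L).mpr hz

theorem isCoatom_inducedRadical : IsCoatom (inducedRadical k he M) :=
  ⟨inducedRadical_ne_top he, fun L hL => by
    by_contra h
    exact hL.not_ge (le_inducedRadical he h)⟩

variable (k M) in
theorem jacobson_induced : Module.jacobson A (Induced k he M) = inducedRadical k he M :=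
  le_antisymm (sInf_le (isCoatom_inducedRadical he)) (le_sInf fun L hL => by
    rcases hL.le_iff.mp (le_inducedRadical he hL.1) with h | h
    · exact absurd h (inducedRadical_ne_top he)
    · exact h.le)

variable (k M) in
/-- The head of `Ae ⊗_{eAe} M`. -/
abbrev InducedHead : Type _ := Induced k he M ⧸ Module.jacobson A (Induced k he M)

instance : IsSimpleModule A (InducedHead k he M) := by
  rw [isSimpleModule_iff_isCoatom, jacobson_induced]
  exact isCoatom_inducedRadical he

theorem idem_smul_eq_zero_of_mem_jacobson {z : Induced k he M}
    (hz : z ∈ Module.jacobson A (Induced k he M)) : e • z = 0 := by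
  rw [jacobson_induced] at hz
  have := hz 1
  rw [one_smul] at this
  rw [← inducedUnit_counit, this, map_zero]

theorem inducedUnit_notMem_jacobson {m : M} (hm : m ≠ 0) :
    inducedUnit k he M m ∉ Module.jacobson A (Induced k he M) := by
  intro h
  have := idem_smul_eq_zero_of_mem_jacobson he h
  rw [idem_smul_inducedUnit] at this
  have h' := inducedCounit_unit (k := k) he m
  rw [this, map_zero] at h'
  exact hm h'.symm

variable {N : Type*} [AddCommGroup N] [Module k N] [Module A N] [IsScalarTower k A N]

/-- A simple module `N` such that `M` maps to `eN` is the head of `Ae ⊗_{eAe} M`. -/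
theorem nonempty_inducedHead_equiv [IsSimpleModule A N] (φ : M →ₗ[k] N)
    (hφ : ∀ (b : he.Corner) m, φ (b • m) = b.1 • φ m) (h0 : φ ≠ 0) :
    Nonempty (InducedHead k he M ≃ₗ[A] N) := by
  have hf : inducedLift he φ hφ ≠ 0 := by
    intro h
    refine h0 (LinearMap.ext fun m => ?_)
    rw [← inducedLift_unit he φ hφ, h]
    rfl
  have hsurj := LinearMap.surjective_of_ne_zero hf
  have hker : LinearMap.ker (inducedLift he φ hφ) = Module.jacobson A (Induced k he M) := by
    rw [jacobson_induced]
    have hc : IsCoatom (LinearMap.ker (inducedLift he φ hφ)) := by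
      rw [← isSimpleModule_iff_isCoatom]
      exact IsSimpleModule.congr ((inducedLift he φ hφ).quotKerEquivOfSurjective hsurj)
    exact (hc.le_iff.mp (le_inducedRadical he hc.1)).resolve_left (inducedRadical_ne_top he) |>.symm
  exact ⟨(Submodule.quotEquivOfEq _ _ hker.symm).trans
    ((inducedLift he φ hφ).quotKerEquivOfSurjective hsurj)⟩

end Simple

end InducedTheory

/-! ### Induced modules as standard modules -/

section Standard

variable {k : Type*} [Field k] {A : Type*} [Ring A] [Algebra k A]

/-- The kernel is maximal because `D` is simple. A submodule not contained in it spans `P` together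
with it, hence is `P` by superfluity. -/
theorem IsProjectiveCover.le_ker {P D : Type*} [AddCommGroup P] [Module A P] [AddCommGroup D]
    [Module A D] [IsSimpleModule A D] {π : P →ₗ[A] D} (hπ : IsProjectiveCover A π)
    {L : Submodule A P} (hL : L ≠ ⊤) : L ≤ LinearMap.ker π := by
  obtain ⟨-, hsurj, hsup⟩ := hπ
  have hc : IsCoatom (LinearMap.ker π) := by
    rw [← isSimpleModule_iff_isCoatom]
    exact IsSimpleModule.congr (π.quotKerEquivOfSurjective hsurj)
  by_contra h
  refine hL (hsup L ?_)
  by_contra hne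
  exact h (((hc.le_iff.mp le_sup_right).resolve_left hne).symm ▸ le_sup_left)

variable {e : A} (he : IsIdempotentElem e)
  {M : Type*} [AddCommGroup M] [Module k M] [Module he.Corner M]
  [IsScalarTower k he.Corner M] [IsSimpleModule he.Corner M]
  {P : Type*} [AddCommGroup P] [Module k P] [Module A P] [IsScalarTower k A P]
  {π : P →ₗ[A] InducedHead k he M}

/-- A quotient `N` of the projective cover of the head of `Δ = Ae ⊗_{eAe} M` is a quotient of `Δ`
if `e` kills the kernel of the map from `N` to the head. -/
theorem ker_le_ker_of_idem_smul_eq_zero (hπ : IsProjectiveCover A π)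
    {p : P →ₗ[A] Induced k he M}
    (hp : (Module.jacobson A (Induced k he M)).mkQ ∘ₗ p = π)
    {N : Type*} [AddCommGroup N] [Module k N] [Module A N] [IsScalarTower k A N]
    (q : P →ₗ[A] N) (π' : N →ₗ[A] InducedHead k he M) (hq : π' ∘ₗ q = π)
    (hN : ∀ n ∈ LinearMap.ker π', e • n = 0) : LinearMap.ker p ≤ LinearMap.ker q := by
  have hπ'surj : Function.Surjective π' := fun y => by
    obtain ⟨x, rfl⟩ := hπ.2.1 y
    exact ⟨q x, LinearMap.congr_fun hq x⟩
  let proj := (Module.jacobson A (Induced k he M)).mkQ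
  obtain ⟨s, hs⟩ := (π'.restrictScalars k).exists_rightInverse_of_surjective
    (LinearMap.range_eq_top.mpr hπ'surj)
  have hs : ∀ y, π' (s y) = y := fun y => LinearMap.congr_fun hs y
  -- The section `s` is only `k`-linear, but it fails to be `A`-linear by elements of `ker π'`.
  -- These are killed by `e`, so `φ` is linear over the corner and extends to a map from `Δ` to `N`.
  let φ : M →ₗ[k] N := (Algebra.lsmul k k N e) ∘ₗ s ∘ₗ proj.restrictScalars k ∘ₗ inducedUnit k he M
  have hφ' : ∀ m, φ m = e • s (proj (inducedUnit k he M m)) := fun m => rfl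
  have hφ : ∀ (b : he.Corner) m, φ (b • m) = b.1 • φ m := by
    intro b m
    rw [hφ', hφ', ← smul_inducedUnit, map_smul, ← mul_smul, (corner_mem he b).2]
    have h := hN (s (b.1 • proj (inducedUnit k he M m)) - b.1 • s (proj (inducedUnit k he M m)))
      (by rw [LinearMap.mem_ker, map_sub, map_smul π', hs, hs, sub_self])
    rw [smul_sub, sub_eq_zero] at h
    rw [h, ← mul_smul, (corner_mem he b).1]
  have hcomp : π' ∘ₗ inducedLift he φ hφ = proj := induced_hom_ext he fun m => by
    rw [LinearMap.comp_apply, inducedLift_unit, hφ', map_smul, hs, ← map_smul,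
      idem_smul_inducedUnit]
  have := IsSimpleModule.nontrivial he.Corner M
  obtain ⟨m, hm⟩ := exists_ne (0 : M)
  obtain ⟨y, hy⟩ := hπ.2.1 (proj (inducedUnit k he M m))
  -- The element `e • y` has nonzero image in the head, so it generates `P`. It thus suffices to
  -- compare `q` with the map through `Δ` at `e • y`, where their difference is `e` times an element
  -- of `ker π'`.
  have hspan : Submodule.span A {e • y} = ⊤ := by
    by_contra h
    have h1 := hπ.le_ker h (Submodule.mem_span_singleton_self _)
    rw [LinearMap.mem_ker, map_smul, hy, ← map_smul, idem_smul_inducedUnit] at h1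
    exact inducedUnit_notMem_jacobson he hm ((Submodule.Quotient.mk_eq_zero _).mp h1)
  have hd : ∀ x, π' (q x - inducedLift he φ hφ (p x)) = 0 := by
    intro x
    rw [map_sub, sub_eq_zero]
    exact (LinearMap.congr_fun hq x).trans
      ((LinearMap.congr_fun hp x).symm.trans (LinearMap.congr_fun hcomp (p x)).symm)
  have hq' : ∀ x, q x = inducedLift he φ hφ (p x) := by
    intro x
    obtain ⟨a, rfl⟩ := Submodule.mem_span_singleton.mp (hspan ▸ Submodule.mem_top : x ∈ _)
    rw [map_smul, map_smul, map_smul, map_smul, map_smul, map_smul]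
    congr 1
    rw [← sub_eq_zero, ← smul_sub]
    exact hN _ (hd y)
  intro x hx
  rw [LinearMap.mem_ker, hq', LinearMap.mem_ker.mp hx, map_zero]

/-- If the composition factors of the radical of `Δ = Ae ⊗_{eAe} M` are below the label of its
head, and `e` kills all simple modules below this label, then `Δ` is a standard module. -/
theorem exists_isLeast_equiv_induced (hπ : IsProjectiveCover A π) {Λ : Type*} {D : Λ → Type*}
    [∀ μ, AddCommGroup (D μ)] [∀ μ, Module A (D μ)] {p : Λ → Prop}
    (hrad : CompositionFactorsIn A D p (Module.jacobson A (Induced k he M)))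
    (hD : ∀ μ, p μ → ∀ d : D μ, e • d = 0) :
    ∃ K : Submodule A P, IsLeast {K' : Submodule A P |
      CompositionFactorsIn A D p (Module.jacobson A (P ⧸ K'))} K ∧
      Nonempty (Induced k he M ≃ₗ[A] (P ⧸ K)) := by
  have := hπ.1
  obtain ⟨f, hf⟩ := Module.projective_lifting_property
    (Module.jacobson A (Induced k he M)).mkQ π (Submodule.mkQ_surjective _)
  have hsurj : Function.Surjective f := by
    rw [← LinearMap.range_eq_top]
    by_contra h
    have hle := le_inducedRadical he h
    rw [← jacobson_induced] at hle
    have := IsSimpleModule.nontrivial A (InducedHead k he M)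
    obtain ⟨y, hy⟩ := exists_ne (0 : InducedHead k he M)
    obtain ⟨x, rfl⟩ := hπ.2.1 y
    refine hy ?_
    rw [← hf]
    exact (Submodule.Quotient.mk_eq_zero _).mpr (hle ⟨x, rfl⟩)
  have e₀ := f.quotKerEquivOfSurjective hsurj
  refine ⟨LinearMap.ker f, ⟨?_, fun K' hK' => ?_⟩, ⟨e₀.symm⟩⟩
  · obtain ⟨g⟩ := nonempty_jacobson_equiv e₀.symm
    exact hrad.congr g
  -- For `K' ≠ ⊤`, every maximal submodule of `P / K'` pulls back to `ker π`. Hence the kernel of `P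
  -- / K' → D` lies in the radical, whose admissible composition factors are all killed by `e`.
  · by_cases htop : K' = ⊤
    · exact htop ▸ le_top
    have hK'le := hπ.le_ker htop
    have hker : ∀ n ∈ LinearMap.ker (K'.liftQ π hK'le), e • n = 0 := by
      intro n hn
      have hmem : n ∈ Module.jacobson A (P ⧸ K') := by
        refine (Submodule.mem_sInf.mpr fun L hL => ?_ : n ∈ sInf {L : Submodule A (P ⧸ K') | IsCoatom L})
        obtain ⟨x, rfl⟩ := Submodule.mkQ_surjective _ n
        have hx : x ∈ LinearMap.ker π := hn
        have hcomap : IsCoatom (L.comap K'.mkQ) :=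
          Submodule.isCoatom_comap_iff K'.mkQ_surjective |>.mpr hL
        have hker := (hcomap.le_iff.mp (hπ.le_ker hcomap.1))
        rcases hker with h | h
        · have := IsSimpleModule.nontrivial A (InducedHead k he M)
          obtain ⟨y, hy⟩ := exists_ne (0 : InducedHead k he M)
          obtain ⟨z, rfl⟩ := hπ.2.1 y
          exact absurd (h ▸ Submodule.mem_top : z ∈ LinearMap.ker π) hy
        · exact (h ▸ hx : x ∈ L.comap K'.mkQ)
      exact congrArg Subtype.val (CompositionFactorsIn.smul_eq_zero hK' he hD ⟨n, hmem⟩)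
    have := ker_le_ker_of_idem_smul_eq_zero he hπ hf K'.mkQ (K'.liftQ π hK'le)
      (K'.liftQ_mkQ π hK'le) hker
    rwa [Submodule.ker_mkQ] at this

end Standard

/-! ### `𝒥`-classes and ideals of the twisted category algebra -/

section JClasses

variable {C : Type v} [Category.{w} C]

theorem jClass_le_iff {s t : Mor C} : jClass s ≤ jClass t ↔ s ∈ twoSided t := by
  refine ⟨fun h => h ⟨𝟙 _, 𝟙 _, by simp⟩, ?_⟩
  rintro ⟨p, q, h⟩ x ⟨p', q', h'⟩
  exact ⟨p' ≫ p, q ≫ q', by rw [h', h]; simp⟩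

theorem jClass_comp_le_left {X Y Z : C} (s : X ⟶ Y) (t : Y ⟶ Z) :
    jClass (mor (s ≫ t)) ≤ jClass (mor s) :=
  jClass_le_iff.mpr ⟨𝟙 _, t, by simp⟩

theorem jClass_comp_le_right {X Y Z : C} (s : X ⟶ Y) (t : Y ⟶ Z) :
    jClass (mor (s ≫ t)) ≤ jClass (mor t) :=
  jClass_le_iff.mpr ⟨s, 𝟙 _, by simp⟩

/-- If `e` factors through `x`, the two cofactors can be cut down by `e` to lie in `e ∘ End X ∘ e`.
In this finite monoid a factor of a unit is a unit. -/
theorem mem_unitsAt_of_jClass_le [Finite (Mor C)] {X : C} {e x : X ⟶ X} (he : e ≫ e = e)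
    (hx : e ≫ x = x ∧ x ≫ e = x) (h : jClass (mor e) ≤ jClass (mor x)) : x ∈ unitsAt e := by
  obtain ⟨p, q, hpq⟩ := jClass_le_iff.mp h
  change e = p ≫ x ≫ q at hpq
  change X ⟶ X at p q
  have h1 : (e ≫ p ≫ e) ≫ x ≫ e ≫ q ≫ e = e := by
    calc (e ≫ p ≫ e) ≫ x ≫ e ≫ q ≫ e = e ≫ p ≫ (e ≫ x) ≫ e ≫ q ≫ e := by simp
      _ = e ≫ p ≫ (x ≫ e) ≫ q ≫ e := by rw [hx.1]; simp
      _ = e ≫ (p ≫ x ≫ q) ≫ e := by rw [hx.2]; simp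
      _ = e := by rw [← hpq, he, he]
  have h2 := (unitsAt_of_comp_eq (e := e) (x := e ≫ p ≫ e) (y := x ≫ e ≫ q ≫ e)
    ⟨by rw [← Category.assoc, he], by simp [he]⟩
    ⟨by rw [← Category.assoc, hx.1], by simp [he]⟩ h1).2
  exact (unitsAt_of_comp_mem hx ⟨by rw [← Category.assoc, he], by simp [he]⟩ h2).1

theorem mem_unitMors_iff {X : C} {e x : X ⟶ X} : mor x ∈ unitMors e ↔ x ∈ unitsAt e :=
  ⟨fun ⟨z, h, hz⟩ => by simp at hz; exact hz ▸ h, fun h => ⟨x, h, rfl⟩⟩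

end JClasses

section Ideals

variable {k : Type u} [Field k] {C : Type v} [Category.{w} C] [Finite (Mor C)]
  {α : TwoCocycle k C}

theorem basis_mul_basis_eq (t s : Mor C) : basisElt α t * basisElt α s = 0 ∨
    ∃ (c : k) (x : Mor C), basisElt α t * basisElt α s = c • basisElt α x ∧
      jClass x ≤ jClass t ∧ jClass x ≤ jClass s := by
  obtain ⟨Y', Z, t⟩ := t
  obtain ⟨X, Y, s⟩ := s
  by_cases h : Y = Y'
  · subst h
    exact Or.inr ⟨_, _, basis_mul_comp t s, jClass_comp_le_right s t, jClass_comp_le_left s t⟩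
  · exact Or.inl (by rw [basis_mul_basis, mulBasis_ne _ _ _ h])

theorem basisElt_mem_kSpan {T : Set (Mor C)} {s : Mor C} (hs : s ∈ T) :
    basisElt α s ∈ kSpan α T := Submodule.subset_span ⟨s, hs, rfl⟩

/-- The span of a set of morphisms that is closed under going down in the `𝒥`-order is an
ideal. -/
theorem mul_mem_kSpan {T : Set (Mor C)} (hT : ∀ s t, s ∈ T → jClass t ≤ jClass s → t ∈ T)
    {x : TwAlg α} (hx : x ∈ kSpan α T) (a : TwAlg α) :
    a * x ∈ kSpan α T ∧ x * a ∈ kSpan α T := by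
  induction a using twAlg_induction with
  | h0 => simp
  | hadd a b ha hb => exact ⟨by rw [add_mul]; exact add_mem ha.1 hb.1,
      by rw [mul_add]; exact add_mem ha.2 hb.2⟩
  | hsmul c a ha => exact ⟨by rw [smul_mul_assoc]; exact Submodule.smul_mem _ _ ha.1,
      by rw [mul_smul_comm]; exact Submodule.smul_mem _ _ ha.2⟩
  | hb t =>
    induction hx using Submodule.span_induction with
    | mem x h =>
      obtain ⟨s, hs, rfl⟩ := h
      constructor
      · rcases basis_mul_basis_eq (α := α) t s with h | ⟨c, u, h, -, h2⟩
        · rw [h]; exact zero_mem _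
        · rw [h]; exact Submodule.smul_mem _ _ (basisElt_mem_kSpan (hT _ _ hs h2))
      · rcases basis_mul_basis_eq (α := α) s t with h | ⟨c, u, h, h1, -⟩
        · rw [h]; exact zero_mem _
        · rw [h]; exact Submodule.smul_mem _ _ (basisElt_mem_kSpan (hT _ _ hs h1))
    | zero => simp
    | add x y _ _ hx hy => exact ⟨by rw [mul_add]; exact add_mem hx.1 hy.1,
        by rw [add_mul]; exact add_mem hx.2 hy.2⟩
    | smul c x _ hx => exact ⟨by rw [mul_smul_comm]; exact Submodule.smul_mem _ _ hx.1,
        by rw [smul_mul_assoc]; exact Submodule.smul_mem _ _ hx.2⟩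

/-- The span of the morphisms that are not above the `𝒥`-class `c`. -/
noncomputable abbrev notAbove (α : TwoCocycle k C) (c : JClass C) : Submodule k (TwAlg α) :=
  kSpan α {s | ¬ c ≤ jClass s}

theorem mul_mem_notAbove {c : JClass C} {x : TwAlg α} (hx : x ∈ notAbove α c) (a : TwAlg α) :
    a * x ∈ notAbove α c ∧ x * a ∈ notAbove α c :=
  mul_mem_kSpan (T := {s | ¬ c ≤ jClass s}) (fun _ _ hs ht h => hs (h.trans ht)) hx a

theorem primeIdem_mem_notAbove {c : JClass C} {X : C} {e : X ⟶ X}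
    (h : ¬ c ≤ jClass (mor e)) : primeIdem α e ∈ notAbove α c :=
  Submodule.smul_mem _ _ (basisElt_mem_kSpan h)

theorem basisElt_eq_smul_primeIdem {X : C} (e : X ⟶ X) :
    basisElt α (mor e) = (α e e : k) • primeIdem α e := by
  rw [primeIdem, smul_smul]
  simp

/-- If `e'` kills a module, then so do all morphisms below `e`. -/
theorem basisElt_smul_eq_zero {M : Type*} [AddCommGroup M] [Module (TwAlg α) M] {X : C}
    {e : X ⟶ X} (hM : ∀ m : M, primeIdem α e • m = 0) {s : Mor C}
    (hs : jClass s ≤ jClass (mor e)) (m : M) : basisElt α s • m = 0 := by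
  let _ : Module k M := Module.compHom M (algebraMap k (TwAlg α))
  have _ : IsScalarTower k (TwAlg α) M := IsScalarTower.of_algebraMap_smul fun _ _ => rfl
  obtain ⟨p, q, hpq⟩ := jClass_le_iff.mp hs
  obtain ⟨Y, Z, s⟩ := s
  change s = p ≫ e ≫ q at hpq
  change Y ⟶ X at p
  change X ⟶ Z at q
  have h : basisElt α (mor q) * basisElt α (mor e) * basisElt α (mor p) =
      ((α q e : k) * (α (e ≫ q) p : k)) • basisElt α (mor s) := by
    rw [basis_mul_comp, smul_mul_assoc, basis_mul_comp, smul_smul, hpq]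
  -- The cocycle has invertible values, so `s` is a scalar multiple of a product containing `e`.
  have h0 : ((α q e : k) * (α (e ≫ q) p : k)) ≠ 0 := mul_ne_zero (Units.ne_zero _) (Units.ne_zero _)
  have h1 : ((α q e : k) * (α (e ≫ q) p : k)) • basisElt α (mor s) • m = 0 := by
    rw [← smul_assoc, ← h, mul_smul, mul_smul, basisElt_eq_smul_primeIdem, smul_assoc, hM,
      smul_zero, smul_zero]
  exact (smul_eq_zero_iff_right h0).mp h1

theorem inflHom_coe {X : C} {e : X ⟶ X} (he : e ≫ e = e) (b : grpAlg α he) :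
    inflHom α he b.1 = b := by
  refine Subtype.ext (Subtype.ext ?_)
  change projOn α (unitMors e) b.1.1 = b.1.1
  have hb : b.1.1 ∈ kSpan α (unitMors e) := b.2
  generalize b.1.1 = y at hb ⊢
  induction hb using Submodule.span_induction with
  | mem x h =>
    obtain ⟨s, hs, rfl⟩ := h
    exact projOn_basis_mem α hs
  | zero => simp
  | add x y _ _ hx hy => rw [map_add, hx, hy]
  | smul c x _ hx => rw [map_smul, hx]

/-- The difference of an element of the corner and its projection to the group algebra lies in
the ideal of the morphisms strictly below `e`. -/
theorem sub_inflHom_mem {X : C} {e : X ⟶ X} (he : e ≫ e = e) (b : CornerAlg α he) :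
    b.1 - (inflHom α he b).1.1 ∈
      kSpan α {s | jClass s < jClass (mor e)} := by
  change b.1 - projOn α (unitMors e) b.1 ∈ _
  have hb := mem_kSpan_of_mem_corner he b
  generalize b.1 = y at hb ⊢
  induction hb using Submodule.span_induction with
  | mem x h =>
    obtain ⟨_, ⟨s, hs, rfl⟩, rfl⟩ := h
    by_cases h : s ∈ unitsAt e
    · rw [projOn_basis_mem α (mem_unitMors_iff.mpr h), sub_self]
      exact zero_mem _
    · rw [projOn_basis_notMem α (fun h' => h (mem_unitMors_iff.mp h')), sub_zero]
      refine basisElt_mem_kSpan (lt_of_le_not_ge ?_ fun h' => h (mem_unitsAt_of_jClass_le he hs h'))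
      exact hs.1 ▸ jClass_comp_le_left e s
  | zero => simp
  | add x y _ _ hx hy => rw [map_add, add_sub_add_comm]; exact add_mem hx hy
  | smul c x _ hx => rw [map_smul, ← smul_sub]; exact Submodule.smul_mem _ _ hx

end Ideals

/-! ### Finite-dimensionality of the algebras and modules, and simplicity of the inflated modules.
-/

section FiniteDimensional

variable {k : Type u} [Field k] {C : Type v} [Category.{w} C] [Finite (Mor C)]
  {α : TwoCocycle k C}

instance : Module.Finite k (TwAlg α) := inferInstanceAs (Module.Finite k (Mor C →₀ k))

instance : IsNoetherianRing (TwAlg α) := IsNoetherianRing.of_finite k (TwAlg α)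

instance : IsArtinianRing (TwAlg α) := IsArtinianRing.of_finite k (TwAlg α)

instance {X : C} {e : X ⟶ X} (he : e ≫ e = e) : Module.Finite k (CornerAlg α he) :=
  Module.Finite.of_injective
    ({ toFun := fun x => x.1, map_add' := fun _ _ => rfl, map_smul' := fun _ _ => rfl } :
      CornerAlg α he →ₗ[k] TwAlg α) Subtype.val_injective

instance {X : C} {e : X ⟶ X} (he : e ≫ e = e) : Module.Finite k (grpAlg α he) :=
  Module.Finite.of_injective (grpAlg α he).val.toLinearMap Subtype.val_injective

variable {J : JData C} (D : SimpleData α J)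

instance (i : Fin J.n) (r : Fin (D.l i)) : IsSimpleModule (grpAlg α (J.e_idem i)) (D.T i r) :=
  D.simple i r

theorem exists_grpAlg_smul_eq {i : Fin J.n} {r : Fin (D.l i)} {m : D.T i r} (hm : m ≠ 0)
    (y : D.T i r) : ∃ b : grpAlg α (J.e_idem i), b • m = y :=
  IsSimpleModule.toSpanSingleton_surjective (grpAlg α (J.e_idem i)) hm y

instance (i : Fin J.n) (r : Fin (D.l i)) : Nontrivial (D.T i r) :=
  IsSimpleModule.nontrivial (grpAlg α (J.e_idem i)) (D.T i r)

instance (i : Fin J.n) (r : Fin (D.l i)) : Module.Finite k (D.T i r) := by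
  obtain ⟨m, hm⟩ := exists_ne (0 : D.T i r)
  exact Module.Finite.of_surjective
    ((LinearMap.toSpanSingleton (grpAlg α (J.e_idem i)) (D.T i r) m).restrictScalars k)
    (exists_grpAlg_smul_eq D hm)

instance (i : Fin J.n) (r : Fin (D.l i)) : Module.Finite k (D.Infl i r) :=
  inferInstanceAs (Module.Finite k (D.T i r))

theorem infl_smul_def {i : Fin J.n} {r : Fin (D.l i)} (b : CornerAlg α (J.e_idem i))
    (m : D.T i r) :
    (b • (show D.Infl i r from m) : D.Infl i r) = inflHom α (J.e_idem i) b • m := rfl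

theorem infl_smul_eq_zero {i : Fin J.n} {r : Fin (D.l i)} {b : CornerAlg α (J.e_idem i)}
    (hb : inflHom α (J.e_idem i) b = 0) (m : D.Infl i r) : b • m = 0 := by
  have h : inflHom α (J.e_idem i) b • (id m : D.T i r) = 0 := by rw [hb, zero_smul]
  exact h

instance (i : Fin J.n) (r : Fin (D.l i)) :
    IsSimpleModule (CornerAlg α (J.e_idem i)) (D.Infl i r) := by
  rw [isSimpleModule_iff_toSpanSingleton_surjective]
  refine ⟨inferInstanceAs (Nontrivial (D.T i r)), fun m hm y => ?_⟩
  obtain ⟨b, hb⟩ := exists_grpAlg_smul_eq D (m := m) hm y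
  refine ⟨b.1, ?_⟩
  have h := infl_smul_def D b.1 m
  rw [inflHom_coe] at h
  exact h.trans hb

instance (lam : D.Label) : Module.Finite k (D.Delta lam) :=
  finite_induced _

instance (lam : D.Label) : Module.Finite k (D.Head lam) :=
  finite_quotient _

end FiniteDimensional

/-! ### Block idempotents -/

section Blocks

variable {B T : Type*} [Ring B] [AddCommGroup T] [Module B T]

/-- Take `f` with `Bf` minimal among the central idempotents that do not kill `T`. For a central
idempotent `g` with `gf = g`, either `g` or `f - g` acts nontrivially on `T`, and minimality makes
that one equal to `f`. -/
theorem exists_block_idempotent [IsArtinianRing B] [Nontrivial T] :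
    ∃ f ∈ Subring.center B, IsIdempotentElem f ∧
      (∀ g ∈ Subring.center B, IsIdempotentElem g → g * f = g → g = 0 ∨ g = f) ∧
      ∃ m : T, f • m ≠ 0 := by
  let S : Set B := {f | f ∈ Subring.center B ∧ IsIdempotentElem f ∧ ∃ m : T, f • m ≠ 0}
  obtain ⟨m, hm⟩ := exists_ne (0 : T)
  obtain ⟨f, ⟨hf, hff, m, hm⟩, hmin⟩ := WellFounded.has_min
    (InvImage.wf (fun f : B => Submodule.span B {f}) wellFounded_lt) S
    ⟨1, one_mem _, IsIdempotentElem.one, m, by rwa [one_smul]⟩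
  have key : ∀ g ∈ S, g * f = g → g = f := by
    intro g hg hgf
    have hle : Submodule.span B {g} ≤ Submodule.span B {f} := by
      rw [Submodule.span_singleton_le_iff_mem, ← hgf]
      exact Submodule.mem_span_singleton.mpr ⟨g, rfl⟩
    have heq : Submodule.span B {g} = Submodule.span B {f} :=
      hle.eq_of_not_lt (hmin g hg)
    obtain ⟨b, hb⟩ := Submodule.mem_span_singleton.mp
      (heq ▸ Submodule.mem_span_singleton_self f : f ∈ Submodule.span B {g})
    rw [← hgf, ← Subring.mem_center_iff.mp hg.1 f, ← hb, smul_eq_mul, mul_assoc, hg.2.1.eq]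
  refine ⟨f, hf, hff, fun g hg hgg hgf => ?_, m, hm⟩
  by_cases hgm : g • m = 0
  · left
    have hfg : f * g = g := (Subring.mem_center_iff.mp hg f).trans hgf
    have h := key (f - g) ⟨sub_mem hf hg, ?_, m, by rwa [sub_smul, hgm, sub_zero]⟩
      (by rw [sub_mul, hff.eq, hgf])
    · simpa using h
    · rw [IsIdempotentElem, sub_mul, mul_sub, mul_sub, hff.eq, hgg.eq, hgf, hfg]
      simp
  · exact Or.inr (key g ⟨hg, hgg, m, hgm⟩ hgf)

/-- The module is generated by some `f • m₀`, which `f` fixes, and `f` commutes with all scalars. -/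
theorem central_idempotent_smul_eq [IsSimpleModule B T] {f : B} (hf : f ∈ Subring.center B)
    (hff : IsIdempotentElem f) (h : ∃ m : T, f • m ≠ 0) (m : T) : f • m = m := by
  obtain ⟨m₀, hm₀⟩ := h
  obtain ⟨b, rfl⟩ := IsSimpleModule.toSpanSingleton_surjective B hm₀ m
  rw [LinearMap.toSpanSingleton_apply, ← mul_smul, ← mul_smul, ← mul_smul,
    ← Subring.mem_center_iff.mp hf b, mul_assoc, hff.eq]

end Blocks

/-! ### The simple modules of the twisted category algebra -/

section Simples

variable {k : Type u} [Field k] {C : Type v} [Category.{w} C] [Finite (Mor C)]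
  {α : TwoCocycle k C}

/-- The subgroup `e'M` of a module `M`. -/
def idemPart (α : TwoCocycle k C) {X : C} (e : X ⟶ X) (M : Type*) [AddCommGroup M]
    [Module (TwAlg α) M] : AddSubgroup M where
  carrier := {m | primeIdem α e • m = m}
  add_mem' hx hy := (smul_add _ _ _).trans (congrArg₂ (· + ·) hx hy)
  zero_mem' := smul_zero _
  neg_mem' hx := (smul_neg _ _).trans (congrArg Neg.neg hx)

noncomputable instance {X : C} {e : X ⟶ X} (he : e ≫ e = e) (M : Type*) [AddCommGroup M]
    [Module (TwAlg α) M] : Module (grpAlg α he) (idemPart α e M) where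
  smul b m := ⟨b.1.1 • m.1, by
    change primeIdem α e • b.1.1 • m.1 = b.1.1 • m.1
    rw [← mul_smul, (corner_mem _ b.1).1]⟩
  one_smul m := Subtype.ext m.2
  mul_smul b c m := Subtype.ext (mul_smul b.1.1 c.1.1 m.1)
  smul_zero b := Subtype.ext (smul_zero b.1.1)
  smul_add b m n := Subtype.ext (smul_add b.1.1 m.1 n.1)
  add_smul b c m := Subtype.ext (add_smul b.1.1 c.1.1 m.1)
  zero_smul m := Subtype.ext (zero_smul (TwAlg α) m.1)

theorem idemPart_smul_val {X : C} {e : X ⟶ X} (he : e ≫ e = e) {M : Type*} [AddCommGroup M]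
    [Module (TwAlg α) M] (b : grpAlg α he) (m : idemPart α e M) : (b • m).1 = b.1.1 • m.1 := rfl

/-- The two elements differ by a combination of morphisms strictly below `e`, which act as zero by
`hM`. -/
theorem corner_smul_eq_inflHom_smul {X : C} {e : X ⟶ X} (he : e ≫ e = e) {M : Type*}
    [AddCommGroup M] [Module (TwAlg α) M]
    (hM : ∀ s : Mor C, jClass s < jClass (mor e) → ∀ m : M, basisElt α s • m = 0)
    (b : CornerAlg α he) (m : M) : b.1 • m = (inflHom α he b).1.1 • m := by
  rw [← sub_eq_zero, ← sub_smul]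
  have h := sub_inflHom_mem he b
  generalize b.1 - (inflHom α he b).1.1 = y at h ⊢
  induction h using Submodule.span_induction with
  | mem x h =>
    obtain ⟨s, hs, rfl⟩ := h
    exact hM s hs m
  | zero => exact zero_smul _ _
  | add x y _ _ hx hy => rw [add_smul, hx, hy, add_zero]
  | smul c x _ hx =>
    rw [← one_mul x, ← smul_mul_assoc, mul_smul, hx, smul_zero]

/-- If `a` carries `m` to `y` and both are fixed by `e'`, then `e'ae'` also carries `m` to `y`, and
it acts through its projection to the twisted group algebra. -/
theorem isSimpleModule_idemPart {X : C} {e : X ⟶ X} (he : e ≫ e = e) {M : Type*}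
    [AddCommGroup M] [Module (TwAlg α) M] [IsSimpleModule (TwAlg α) M]
    (hM : ∀ s : Mor C, jClass s < jClass (mor e) → ∀ m : M, basisElt α s • m = 0)
    (h0 : ∃ m : M, primeIdem α e • m ≠ 0) : IsSimpleModule (grpAlg α he) (idemPart α e M) := by
  have hidem := primeIdem_isIdempotentElem α he
  rw [isSimpleModule_iff_toSpanSingleton_surjective]
  refine ⟨?_, fun m hm y => ?_⟩
  · obtain ⟨m, hm⟩ := h0
    refine ⟨⟨⟨primeIdem α e • m, ?_⟩, 0, fun h => hm (congrArg Subtype.val h)⟩⟩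
    change primeIdem α e • primeIdem α e • m = _
    rw [← mul_smul, hidem.eq]
  · have hm' : m.1 ≠ 0 := fun h => hm (Subtype.ext h)
    obtain ⟨a, ha⟩ := IsSimpleModule.toSpanSingleton_surjective (TwAlg α) hm' y.1
    rw [LinearMap.toSpanSingleton_apply] at ha
    refine ⟨inflHom α he (cornerMk hidem a), Subtype.ext ?_⟩
    rw [LinearMap.toSpanSingleton_apply, idemPart_smul_val, ← corner_smul_eq_inflHom_smul he hM]
    change (primeIdem α e * a * primeIdem α e) • m.1 = y.1
    rw [mul_smul, mul_smul, m.2, ha, y.2]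

variable {J : JData C}

theorem exists_jClass_eq (J : JData C) (s : Mor C) : ∃ i, jClass (mor (J.e i)) = jClass s := by
  refine ⟨J.cls.symm (jClass s), ?_⟩
  rw [J.e_mem, Equiv.apply_symm_apply]

/-- Take the least `i` for which `eᵢ'` does not kill `M`; if there were none, every morphism would
kill `M`. The numbering refines the `𝒥`-order, so the idempotents of all lower classes kill `M`, and
with them all morphisms of those classes. -/
theorem exists_primeIdem_smul_ne_zero (J : JData C) (M : Type*) [AddCommGroup M]
    [Module (TwAlg α) M] [Nontrivial M] :
    ∃ i, (∃ m : M, primeIdem α (J.e i) • m ≠ 0) ∧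
      ∀ s : Mor C, jClass s < jClass (mor (J.e i)) → ∀ m : M, basisElt α s • m = 0 := by
  have hne : {i | ∃ m : M, primeIdem α (J.e i) • m ≠ 0}.Nonempty := by
    by_contra hne
    rw [Set.not_nonempty_iff_eq_empty, Set.eq_empty_iff_forall_notMem] at hne
    have hb : ∀ (s : Mor C) (m : M), basisElt α s • m = 0 := by
      intro s m
      obtain ⟨i, hi⟩ := exists_jClass_eq J s
      exact basisElt_smul_eq_zero (fun m => by_contra fun h => hne i ⟨m, h⟩) hi.ge m
    have ha : ∀ (a : TwAlg α) (m : M), a • m = 0 := by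
      intro a m
      induction a using twAlg_induction with
      | h0 => exact zero_smul _ _
      | hadd a b ha hb => rw [add_smul, ha, hb, add_zero]
      | hsmul c a ha => rw [← one_mul a, ← smul_mul_assoc, mul_smul, ha, smul_zero]
      | hb s => exact hb s m
    obtain ⟨m, hm⟩ := exists_ne (0 : M)
    exact hm (by rw [← one_smul (TwAlg α) m, ha])
  obtain ⟨i, hi, hmin⟩ := WellFounded.has_min (wellFounded_lt (α := Fin J.n)) _ hne
  refine ⟨i, hi, fun s hs m => ?_⟩
  obtain ⟨j, hj⟩ := exists_jClass_eq J s
  refine basisElt_smul_eq_zero (fun m => by_contra fun h => hmin j ⟨m, h⟩ ?_) hj.ge m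
  refine J.lt_of_cls_lt j i ?_
  rw [← J.e_mem, ← J.e_mem, hj]
  exact hs

namespace SimpleData

variable (D : SimpleData α J)

/-- The map `t ↦ eᵢ' ⊗ t` from `T̃` to `Δ`. -/
noncomputable abbrev unit (lam : D.Label) : D.Infl lam.1 lam.2 →ₗ[k] D.Delta lam :=
  inducedUnit k (primeIdem_isIdempotentElem α (J.e_idem lam.1)) (D.Infl lam.1 lam.2)

theorem grpAlg_smul_unit (lam : D.Label) (f : grpAlg α (J.e_idem lam.1)) (t : D.T lam.1 lam.2) :
    f.1.1 • D.unit lam t = D.unit lam (f • t : D.T lam.1 lam.2) := by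
  refine (smul_inducedUnit _ f.1 _).trans ?_
  have h := infl_smul_def D f.1 t
  rw [inflHom_coe] at h
  exact congrArg (D.unit lam) h

/-- For a minimal class acting nontrivially on `M`, the part `eᵢ'M` is a simple module over the
twisted group algebra, hence some `T i r`. Its inclusion in `M` is linear over the corner for the
inflated action, so `M` is the head of the induced module. -/
theorem exists_head_equiv (M : Type (max u v w)) [AddCommGroup M] [Module (TwAlg α) M]
    [IsSimpleModule (TwAlg α) M] : ∃ lam, Nonempty (M ≃ₗ[TwAlg α] D.Head lam) := by
  have := IsSimpleModule.nontrivial (TwAlg α) M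
  obtain ⟨i, h0, hM⟩ := exists_primeIdem_smul_ne_zero (α := α) J M
  have hs := isSimpleModule_idemPart (J.e_idem i) hM h0
  obtain ⟨r, ⟨g⟩⟩ := D.exists_equiv i (idemPart α (J.e i) M) hs
  let _ : Module k M := Module.compHom M (algebraMap k (TwAlg α))
  have _ : IsScalarTower k (TwAlg α) M := IsScalarTower.of_algebraMap_smul fun _ _ => rfl
  let φ : D.Infl i r →ₗ[k] M :=
    { toFun := fun t => (g.symm t).1
      map_add' := fun x y => congrArg Subtype.val (map_add g.symm x y)
      map_smul' := fun c x => by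
        refine (congrArg Subtype.val
          (g.symm.map_smul (algebraMap k (grpAlg α (J.e_idem i)) c) x)).trans ?_
        rw [idemPart_smul_val]
        change (c • primeIdem α (J.e i)) • _ = _
        rw [smul_assoc, (g.symm x).2]
        rfl }
  obtain ⟨e⟩ := nonempty_inducedHead_equiv (primeIdem_isIdempotentElem α (J.e_idem i)) φ
    (fun b m => by
      refine (congrArg Subtype.val (g.symm.map_smul (inflHom α (J.e_idem i) b) m)).trans ?_
      rw [idemPart_smul_val, ← corner_smul_eq_inflHom_smul (J.e_idem i) hM]
      rfl)
    (fun h => by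
      obtain ⟨t, ht⟩ := exists_ne (0 : D.T i r)
      exact ht (g.symm.map_eq_zero_iff.mp (Subtype.ext (LinearMap.congr_fun h t))))
  exact ⟨⟨i, r⟩, ⟨e.symm⟩⟩

end SimpleData

end Simples

/-! ### The composition factors of `Δ` -/

/-- If the modules `D μ` represent all simple modules, then the composition factors of `M` are
among those `D μ` that are killed by all scalars that kill `M`. -/
theorem compositionFactorsIn_of_forall_annihilator {A : Type*} [Ring A] {Λ : Type*}
    {D : Λ → Type*} [∀ μ, AddCommGroup (D μ)] [∀ μ, Module A (D μ)] {p : Λ → Prop}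
    {M : Type w} [AddCommGroup M] [Module A M]
    (hD : ∀ (Q : Type w) [AddCommGroup Q] [Module A Q] [IsSimpleModule A Q],
      ∃ μ, Nonempty (Q ≃ₗ[A] D μ))
    (hp : ∀ μ, (∀ a : A, (∀ x : M, a • x = 0) → ∀ d : D μ, a • d = 0) → p μ) :
    CompositionFactorsIn A D p M := by
  intro N₁ N₂ hN
  have : IsSimpleModule A (N₂ ⧸ N₁.submoduleOf N₂) := (covBy_iff_quot_is_simple hN.le).mp hN
  obtain ⟨μ, ⟨g⟩⟩ := hD (N₂ ⧸ N₁.submoduleOf N₂)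
  refine ⟨μ, hp μ fun a ha y => ?_, ⟨g⟩⟩
  obtain ⟨q, rfl⟩ := g.surjective y
  obtain ⟨z, rfl⟩ := Submodule.mkQ_surjective _ q
  rw [← map_smul, ← map_smul]
  have : a • z = 0 := Subtype.ext (ha z.1)
  rw [this, map_zero, map_zero]

section Factors

variable {k : Type u} [Field k] {C : Type v} [Category.{w} C] [Finite (Mor C)]
  {α : TwoCocycle k C} {J : JData C}

namespace SimpleData

theorem idealLT_le_notAbove (j : Fin J.n) : idealLT α J j ≤ notAbove α (J.cls j) := by
  refine Submodule.span_mono (Set.image_mono ?_)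
  rintro s ⟨i, hij, hs⟩ h
  rw [hs] at h
  rcases h.lt_or_eq with h | h
  · exact lt_asymm hij (J.lt_of_cls_lt _ _ h)
  · exact hij.ne (J.cls.injective h.symm)

theorem mul_mem_idealLE {j : Fin J.n} {x : TwAlg α} (hx : x ∈ idealLE α J j) (a : TwAlg α) :
    a * x ∈ idealLE α J j ∧ x * a ∈ idealLE α J j := by
  refine mul_mem_kSpan (T := {s | ∃ i ≤ j, jClass s = J.cls i}) ?_ hx a
  rintro s t ⟨i, hij, hs⟩ ht
  refine ⟨J.cls.symm (jClass t), ?_, (J.cls.apply_symm_apply _).symm⟩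
  rcases ht.lt_or_eq with h | h
  · refine le_trans (J.lt_of_cls_lt _ _ ?_).le hij
    rwa [J.cls.apply_symm_apply, ← hs]
  · rwa [h, hs, J.cls.symm_apply_apply]

theorem primeIdem_mem_idealLE (j : Fin J.n) : primeIdem α (J.e j) ∈ idealLE α J j :=
  Submodule.smul_mem _ _ (basisElt_mem_kSpan ⟨j, le_rfl, J.e_mem j⟩)

variable (D : SimpleData α J)

/-- This is where splitness is used. One may replace `s` by its composite `s'` with `eᵢ`. A
generalised inverse gives `s' = s' ∘ x` with `x` in `eᵢ ∘ End ∘ eᵢ`. If `x` were a unit, then `eᵢ`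
would lie below `s`; so `x` is a non-unit and acts as zero on the inflated module. -/
theorem basisElt_smul_unit_eq_zero {lam : D.Label} {s : Mor C}
    (hs : ¬ J.cls lam.1 ≤ jClass s) (hsplit : IsSplitCategory C) (t : D.Infl lam.1 lam.2) :
    basisElt α s • D.unit lam t = 0 := by
  obtain ⟨X, Z, s⟩ := s
  have he := J.e_idem lam.1
  have hidem := primeIdem_isIdempotentElem α he
  rw [← mul_idem_smul_inducedUnit hidem]
  by_cases hX : X = J.X lam.1
  · subst hX
    obtain ⟨s', hs'⟩ : ∃ s', s' = J.e lam.1 ≫ s := ⟨_, rfl⟩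
    have hmul : ∃ c : k, basisElt α (mor s) * primeIdem α (J.e lam.1) =
        c • basisElt α (mor s') :=
      ⟨_, by rw [primeIdem, mul_smul_comm, basis_mul_comp, smul_smul, hs']⟩
    obtain ⟨c, hc⟩ := hmul
    rw [hc]
    have hes' : J.e lam.1 ≫ s' = s' := by rw [hs', ← Category.assoc, he]
    obtain ⟨t', ht'⟩ := hsplit _ _ s'
    let x : J.X lam.1 ⟶ J.X lam.1 := s' ≫ t' ≫ J.e lam.1
    have hx : J.e lam.1 ≫ x = x ∧ x ≫ J.e lam.1 = x :=
      ⟨by simp only [x]; rw [← Category.assoc, hes'], by simp only [x, Category.assoc, he]⟩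
    have hxs : x ≫ s' = s' := by
      simp only [x, Category.assoc, hes']
      exact ht'
    have hxu : x ∉ unitsAt (J.e lam.1) := by
      rintro ⟨-, y, -, hxy, -⟩
      refine hs ?_
      rw [← J.e_mem, ← hxy]
      simp only [x, Category.assoc]
      refine (jClass_comp_le_left _ _).trans ?_
      rw [hs']
      exact jClass_comp_le_right _ _
    have hx0 : basisElt α (mor x) • D.unit lam t = 0 := by
      let b : CornerAlg α he := ⟨basisElt α (mor x), (Subsemigroup.mem_corner_iff hidem).mpr
        ⟨primeIdem_mul he x hx.2, mul_primeIdem he x hx.1⟩⟩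
      have hb : inflHom α he b = 0 := by
        refine Subtype.ext (Subtype.ext ?_)
        change projOn α (unitMors (J.e lam.1)) (basisElt α (mor x)) = 0
        exact projOn_basis_notMem α fun h => hxu (mem_unitMors_iff.mp h)
      refine (smul_inducedUnit hidem b t).trans ?_
      exact (congrArg (D.unit lam) (infl_smul_eq_zero D hb t)).trans (map_zero _)
    have h := basis_mul_comp (α := α) s' x
    rw [hxs] at h
    have h1 : (α s' x : k) • basisElt α (mor s') • D.unit lam t = 0 := by
      rw [← smul_assoc, ← h, mul_smul, hx0, smul_zero]
    rw [smul_assoc, (smul_eq_zero_iff_right (Units.ne_zero _)).mp h1, smul_zero]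
  · have hmul : basisElt α ⟨X, Z, s⟩ * primeIdem α (J.e lam.1) = 0 := by
      rw [primeIdem, mul_smul_comm, basis_mul_basis, mulBasis_ne _ _ _ (Ne.symm hX), smul_zero]
    rw [hmul, zero_smul]

/-- The span is a two-sided ideal: `x * a` again kills the generators `D.unit lam t`, for every `a`.
-/
theorem notAbove_smul_delta (hsplit : IsSplitCategory C) {lam : D.Label} {x : TwAlg α}
    (hx : x ∈ notAbove α (J.cls lam.1)) (z : D.Delta lam) : x • z = 0 := by
  have key : ∀ y ∈ notAbove α (J.cls lam.1), ∀ t, y • D.unit lam t = 0 := by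
    intro y hy t
    induction hy using Submodule.span_induction with
    | mem y h =>
      obtain ⟨s, hs, rfl⟩ := h
      exact D.basisElt_smul_unit_eq_zero hs hsplit t
    | zero => exact zero_smul _ _
    | add x y _ _ hx hy => rw [add_smul, hx, hy, add_zero]
    | smul c x _ hx => rw [smul_assoc, hx, smul_zero]
  induction z using induced_induction with
  | h0 => exact smul_zero _
  | hadd y z hy hz => rw [smul_add, hy, hz, add_zero]
  | hs a t => rw [← mul_smul, key _ (mul_mem_notAbove hx a).2]

theorem notAbove_smul_head (hsplit : IsSplitCategory C) {lam : D.Label} {x : TwAlg α}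
    (hx : x ∈ notAbove α (J.cls lam.1)) (z : D.Head lam) : x • z = 0 := by
  obtain ⟨z, rfl⟩ := Submodule.mkQ_surjective _ z
  rw [← map_smul, D.notAbove_smul_delta hsplit hx, map_zero]

theorem primeIdem_smul_head (hsplit : IsSplitCategory C) {lam : D.Label} {j : Fin J.n}
    (h : ¬ J.cls lam.1 ≤ J.cls j) (z : D.Head lam) : primeIdem α (J.e j) • z = 0 :=
  D.notAbove_smul_head hsplit (primeIdem_mem_notAbove (by rwa [J.e_mem])) z

/-- The image of `t` in the head of `Δ`. -/
noncomputable abbrev headUnit (lam : D.Label) (t : D.T lam.1 lam.2) : D.Head lam :=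
  (Module.jacobson (TwAlg α) (D.Delta lam)).mkQ (D.unit lam t)

theorem headUnit_ne_zero (lam : D.Label) {t : D.T lam.1 lam.2} (ht : t ≠ 0) :
    D.headUnit lam t ≠ 0 := fun h =>
  inducedUnit_notMem_jacobson (primeIdem_isIdempotentElem α (J.e_idem lam.1))
    (M := D.Infl lam.1 lam.2) ht ((Submodule.Quotient.mk_eq_zero _).mp h)

theorem primeIdem_smul_headUnit (lam : D.Label) (t : D.T lam.1 lam.2) :
    primeIdem α (J.e lam.1) • D.headUnit lam t = D.headUnit lam t := by
  refine (map_smul _ _ _).symm.trans (congrArg _ ?_)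
  exact idem_smul_inducedUnit (primeIdem_isIdempotentElem α (J.e_idem lam.1)) _

theorem grpAlg_smul_headUnit (lam : D.Label) (f : grpAlg α (J.e_idem lam.1))
    (t : D.T lam.1 lam.2) : f.1.1 • D.headUnit lam t = D.headUnit lam (f • t) := by
  rw [← map_smul, grpAlg_smul_unit]

/-- The idempotent of the class of `mu` is nonzero on `D.Head mu`, but kills `D.Head lam` unless the
class of `lam` lies below that of `mu`. -/
theorem cls_le_of_head_equiv (hsplit : IsSplitCategory C) {lam mu : D.Label}
    (g : D.Head lam ≃ₗ[TwAlg α] D.Head mu) : J.cls lam.1 ≤ J.cls mu.1 := by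
  by_contra h
  obtain ⟨t, ht⟩ := exists_ne (0 : D.T mu.1 mu.2)
  refine D.headUnit_ne_zero mu ht ?_
  rw [← D.primeIdem_smul_headUnit, ← g.apply_symm_apply (D.headUnit mu t), ← map_smul,
    D.primeIdem_smul_head hsplit h, map_zero]

/-- An element of the head that is fixed by `eᵢ'` comes from `T`. -/
theorem exists_headUnit_eq (lam : D.Label) (z : D.Head lam) :
    ∃ t, primeIdem α (J.e lam.1) • z = D.headUnit lam t := by
  obtain ⟨z, rfl⟩ := Submodule.mkQ_surjective _ z
  exact ⟨inducedCounit k (primeIdem_isIdempotentElem α (J.e_idem lam.1)) (D.Infl lam.1 lam.2) z,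
    by rw [← map_smul]; exact congrArg _ (inducedUnit_counit _ z).symm⟩

/-- Both labels have the same class, and the isomorphism restricts to the `eᵢ'`-components. These
are the simple modules `T`, so Schur's lemma applies to the nonzero restriction. -/
theorem eq_of_head_equiv (hsplit : IsSplitCategory C) {lam mu : D.Label}
    (g : D.Head lam ≃ₗ[TwAlg α] D.Head mu) : lam = mu := by
  have h1 := J.cls.injective (le_antisymm (D.cls_le_of_head_equiv hsplit g)
    (D.cls_le_of_head_equiv hsplit g.symm))
  obtain ⟨i, r⟩ := lam
  obtain ⟨j, s⟩ := mu
  dsimp only at h1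
  subst h1
  have hex : ∀ t : D.T i r, ∃ t' : D.T i s, g (D.headUnit ⟨i, r⟩ t) = D.headUnit ⟨i, s⟩ t' := by
    intro t
    rw [← D.primeIdem_smul_headUnit, map_smul]
    exact D.exists_headUnit_eq ⟨i, s⟩ _
  have hinj : ∀ t t' : D.T i s, D.headUnit ⟨i, s⟩ t = D.headUnit ⟨i, s⟩ t' → t = t' := by
    intro t t' h
    by_contra hne
    refine D.headUnit_ne_zero ⟨i, s⟩ (t := t - t') (sub_ne_zero.mpr hne) ?_
    refine Eq.trans ?_ (sub_eq_zero.mpr h)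
    exact (congrArg _ (map_sub (D.unit ⟨i, s⟩) t t')).trans (map_sub _ _ _)
  choose φ hφ using hex
  let Φ : D.T i r →ₗ[grpAlg α (J.e_idem i)] D.T i s :=
    { toFun := φ
      map_add' := fun x y => hinj _ _ (by
        rw [← hφ]
        have hx : D.headUnit ⟨i, r⟩ (x + y) = D.headUnit ⟨i, r⟩ x + D.headUnit ⟨i, r⟩ y :=
          (congrArg _ (map_add (D.unit ⟨i, r⟩) x y)).trans (map_add _ _ _)
        have hy : D.headUnit ⟨i, s⟩ (φ x + φ y) =
            D.headUnit ⟨i, s⟩ (φ x) + D.headUnit ⟨i, s⟩ (φ y) :=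
          (congrArg _ (map_add (D.unit ⟨i, s⟩) (φ x) (φ y))).trans (map_add _ _ _)
        rw [hx, hy, map_add, hφ, hφ])
      map_smul' := fun f x => hinj _ _ (by
        rw [← hφ, RingHom.id_apply, ← D.grpAlg_smul_headUnit ⟨i, s⟩,
          ← D.grpAlg_smul_headUnit ⟨i, r⟩, map_smul, hφ]) }
  have h0 : Φ ≠ 0 := by
    intro h
    obtain ⟨t, ht⟩ := exists_ne (0 : D.T i r)
    refine D.headUnit_ne_zero ⟨i, r⟩ ht (g.map_eq_zero_iff.mp ?_)
    rw [hφ t, show φ t = 0 from LinearMap.congr_fun h t]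
    exact (congrArg _ (map_zero (D.unit ⟨i, s⟩))).trans (map_zero _)
  have hbij : Function.Bijective Φ := 
    LinearMap.bijective_of_ne_zero (R := grpAlg α (J.e_idem i)) h0
  exact congrArg (Sigma.mk i) (D.eq_of_equiv i r s
    ⟨LinearEquiv.ofBijective Φ hbij⟩)

theorem exists_isBlockIdempotent (lam : D.Label) : ∃ f, D.IsBlockIdempotent lam f := by
  have : IsArtinianRing (grpAlg α (J.e_idem lam.1)) := 
    IsArtinianRing.of_finite k (grpAlg α (J.e_idem lam.1))
  obtain ⟨f, h1, h2, h3, h4⟩ :=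
    exists_block_idempotent (B := grpAlg α (J.e_idem lam.1)) (T := D.T lam.1 lam.2)
  exact ⟨f, h1, h2, h3, h4⟩

theorem IsBlockIdempotent.smul_eq {D : SimpleData α J} {lam : D.Label}
    {f : grpAlg α (J.e_idem lam.1)} (hf : D.IsBlockIdempotent lam f) (t : D.T lam.1 lam.2) :
    f • t = t :=
  central_idempotent_smul_eq hf.1 hf.2.1 hf.2.2.2 t

/-- If `D_μ`, with `μ` in a different `𝒥`-class, is such that its block idempotent acts on
`Δ_λ` by a non-zero map, then `μ ⊏ λ`. -/
theorem sqsubset_of_smul_ne_zero (hsplit : IsSplitCategory C) {lam mu : D.Label}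
    (hne : mu.1 ≠ lam.1) {f : grpAlg α (J.e_idem mu.1)} (hf : D.IsBlockIdempotent mu f)
    {z : D.Delta lam} (hz : f.1.1 • z ≠ 0) : D.sqsubset mu lam := by
  obtain ⟨g, hg⟩ := D.exists_isBlockIdempotent lam
  have hidem := primeIdem_isIdempotentElem α (J.e_idem lam.1)
  refine ⟨lt_of_le_of_ne ?_ fun h => hne (J.cls.injective h.symm), f, g, hf, hg, Or.inl ?_⟩
  · by_contra h
    refine hz (D.notAbove_smul_delta hsplit ?_ z)
    rw [← (corner_mem _ f.1).1]
    exact (mul_mem_notAbove (primeIdem_mem_notAbove (by rwa [J.e_mem])) _).2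
  · obtain ⟨a, t, hat⟩ : ∃ (a : TwAlg α) (t : D.T lam.1 lam.2), f.1.1 • a • D.unit lam t ≠ 0 := by
      by_contra! h
      have hall : ∀ y : D.Delta lam, f.1.1 • y = 0 := by
        intro y
        induction y using induced_induction with
        | h0 => exact smul_zero _
        | hadd y y' hy hy' => rw [smul_add, hy, hy', add_zero]
        | hs a t => exact h a t
      exact hz (hall z)
    -- If `f a e' g` were in `J_{j-1}`, it would act as zero on `Δ`. But `g` fixes `t` and `e'`
    -- fixes its image, so `f a` would kill that image, contrary to `hat`.
    refine ⟨a * primeIdem α (J.e lam.1), (mul_mem_idealLE (primeIdem_mem_idealLE lam.1) a).1,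
      fun h => hat ?_⟩
    have h0 := D.notAbove_smul_delta hsplit (idealLT_le_notAbove lam.1 h) (D.unit lam t)
    have h1 : (a * primeIdem α (J.e lam.1)) • D.unit lam t = a • D.unit lam t :=
      mul_idem_smul_inducedUnit hidem a _
    rwa [mul_smul, grpAlg_smul_unit, hg.smul_eq, mul_smul, h1] at h0

/-- A composition factor of the radical is killed by whatever kills the radical. Applied to the
idempotent of `lam`, this puts `mu` in a different class. Applied to the block idempotent of `mu`,
which is nonzero on `D.Head mu`, it shows that this idempotent acts nontrivially on `Δ`. -/
theorem compositionFactorsIn_jacobson_delta (hsplit : IsSplitCategory C) (lam : D.Label) :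
    CompositionFactorsIn (TwAlg α) D.Head (fun mu => D.sqsubset mu lam)
      (Module.jacobson (TwAlg α) (D.Delta lam)) := by
  refine compositionFactorsIn_of_forall_annihilator (fun Q _ _ _ => D.exists_head_equiv Q)
    fun mu hmu => ?_
  have hzero : ∀ a : TwAlg α, (∀ z ∈ Module.jacobson (TwAlg α) (D.Delta lam), a • z = 0) →
      ∀ y : D.Head mu, a • y = 0 := fun a ha => hmu a fun x => Subtype.ext (ha x.1 x.2)
  obtain ⟨t, ht⟩ := exists_ne (0 : D.T mu.1 mu.2)
  have hhead := D.headUnit_ne_zero mu ht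
  have hne : mu.1 ≠ lam.1 := by
    intro h
    refine hhead ?_
    have h1 : ∀ y : D.Head mu, primeIdem α (J.e lam.1) • y = 0 :=
      hzero _ (fun z hz => idem_smul_eq_zero_of_mem_jacobson
        (primeIdem_isIdempotentElem α (J.e_idem lam.1)) hz)
    rw [← h] at h1
    rw [← D.primeIdem_smul_headUnit, h1]
  obtain ⟨f, hf⟩ := D.exists_isBlockIdempotent mu
  by_contra hsq
  refine hhead ?_
  rw [← hf.smul_eq t, ← D.grpAlg_smul_headUnit]
  refine hzero _ (fun z _ => ?_) _
  by_contra hz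
  exact hsq (D.sqsubset_of_smul_ne_zero hsplit hne hf hz)

theorem le_of_unlhd {lam mu : D.Label} (h : D.unlhd lam mu) : D.le lam mu := by
  induction h with
  | refl => exact Or.inl rfl
  | tail _ h ih =>
    right
    rcases ih with rfl | ih
    · exact h.1
    · exact lt_trans h.1 ih

/-- A strict order on labels between `⊏` and `<`. -/
theorem between_of_eq {R : D.Label → D.Label → Prop} (hR : R = D.lt ∨ R = D.lhd) :
    (∀ lam mu, D.sqsubset lam mu → R lam mu) ∧ ∀ lam mu, R lam mu → D.lt lam mu := by
  rcases hR with rfl | rfl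
  · exact ⟨fun _ _ h => h.1, fun _ _ h => h⟩
  · refine ⟨fun lam mu h => ⟨Relation.ReflTransGen.single h, ?_⟩, fun lam mu h =>
      (D.le_of_unlhd h.1).resolve_left h.2⟩
    rintro rfl
    exact lt_irrefl _ h.1

/-- The module `Δ_λ` is the standard module with label `λ` for all strict orders between `⊏` and
`<`. -/
theorem exists_projectiveCover_isLeast (hsplit : IsSplitCategory C)
    {R : D.Label → D.Label → Prop} (h₁ : ∀ lam mu, D.sqsubset lam mu → R lam mu)
    (h₂ : ∀ lam mu, R lam mu → D.lt lam mu) (lam : D.Label) :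
    ∃ (P : Submodule (TwAlg α) (TwAlg α)) (π : P →ₗ[TwAlg α] D.Head lam)
      (K : Submodule (TwAlg α) P), IsProjectiveCover (TwAlg α) π ∧
      IsLeast {K' : Submodule (TwAlg α) P | CompositionFactorsIn (TwAlg α) D.Head
        (fun mu => R mu lam) (Module.jacobson (TwAlg α) (P ⧸ K'))} K ∧
      Nonempty (D.Delta lam ≃ₗ[TwAlg α] (P ⧸ K)) := by
  obtain ⟨P, π, hπ⟩ := exists_projectiveCover (A := TwAlg α) (D.Head lam)
  obtain ⟨K, hK, e⟩ := exists_isLeast_equiv_induced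
    (primeIdem_isIdempotentElem α (J.e_idem lam.1)) hπ (D := D.Head) (p := fun mu => R mu lam)
    (fun N₁ N₂ hN => (D.compositionFactorsIn_jacobson_delta hsplit lam N₁ N₂ hN).imp
      fun mu h => ⟨h₁ _ _ h.1, h.2⟩)
    (fun mu hmu d => D.primeIdem_smul_head hsplit (h₂ _ _ hmu).not_ge d)
  exact ⟨P, π, K, hπ, hK, e⟩

end SimpleData

end Factors

/-! ### Duals of heads of induced modules -/

section HeadDual

variable {k : Type*} [Field k] {A : Type*} [Ring A] [Algebra k A] {e : A}
  (he : IsIdempotentElem e)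
  {M : Type*} [AddCommGroup M] [Module k M] [Module he.Corner M]
  [IsScalarTower k he.Corner M] [IsSimpleModule he.Corner M]
  {M' : Type*} [AddCommGroup M'] [Module k M'] [Module he.Corner M']
  [IsScalarTower k he.Corner M'] [IsSimpleModule he.Corner M']

variable (k M) in
/-- The projection of the head of `Ae ⊗_{eAe} M` onto its `e`-component `M`. -/
noncomputable def headCounit : InducedHead k he M →ₗ[k] M :=
  ((Module.jacobson A (Induced k he M)).restrictScalars k).liftQ (inducedCounit k he M)
    fun z hz => by
      have h : z ∈ inducedRadical k he M := jacobson_induced k he M ▸ hz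
      have := h 1
      rwa [one_smul] at this

theorem headCounit_surjective : Function.Surjective (headCounit k he M) := fun m =>
  ⟨Submodule.Quotient.mk (inducedUnit k he M m), inducedCounit_unit (k := k) he m⟩

theorem headCounit_corner_smul (b : he.Corner) (z : InducedHead k he M) :
    headCounit k he M (b.1 • z) = b • headCounit k he M z := by
  obtain ⟨z, rfl⟩ := Submodule.mkQ_surjective _ z
  exact inducedCounit_corner_smul he b z

/-- Pulling forms on `M` back along the surjection from the head onto its `e`-component gives a
nonzero corner-linear map from `M'` to the dual of the head. This dual is simple, so it is the head
of the module induced from `M'`. -/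
theorem nonempty_inducedHead_circDual_equiv {σ : A →ₐ[k] Aᵐᵒᵖ}
    {τ : he.Corner →ₐ[k] he.Cornerᵐᵒᵖ} (hτ : ∀ b, (τ b).unop.1 = (σ b.1).unop)
    (hσ : ∀ a, (σ (σ a).unop).unop = a) [Module.Finite k (InducedHead k he M)]
    (g : M' ≃ₗ[he.Corner] CircDual τ M) :
    Nonempty (InducedHead k he M' ≃ₗ[A] CircDual σ (InducedHead k he M)) := by
  have := isSimpleModule_circDual (M := InducedHead k he M) hσ
  let φ : M' →ₗ[k] CircDual σ (InducedHead k he M) :=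
    (CircDual.toDual σ (InducedHead k he M)).symm.toLinearMap ∘ₗ (headCounit k he M).dualMap ∘ₗ
      (CircDual.toDual τ M).toLinearMap ∘ₗ (g.restrictScalars k).toLinearMap
  have hφ : ∀ m z, CircDual.toDual σ _ (φ m) z =
    CircDual.toDual τ M (g m) (headCounit k he M z) := fun m z => rfl
  refine nonempty_inducedHead_equiv he φ (fun b m => circDual_ext σ _ fun z => ?_) fun h => ?_
  · rw [hφ, circDual_smul_apply, hφ, map_smul, circDual_smul_apply, ← hτ, headCounit_corner_smul]
  · have := IsSimpleModule.nontrivial he.Corner M'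
    obtain ⟨m, hm⟩ := exists_ne (0 : M')
    refine hm (g.map_eq_zero_iff.mp (circDual_ext τ M fun x => ?_))
    obtain ⟨z, rfl⟩ := headCounit_surjective (k := k) he x
    rw [← hφ, h]
    rfl

end HeadDual

/-! ### Block idempotents under an anti-involution. -/

section BlockDual

variable {k : Type*} [Field k] {B : Type*} [Ring B] [Algebra k B] {σ : B →ₐ[k] Bᵐᵒᵖ}

theorem unop_map_mul (a b : B) : (σ (a * b)).unop = (σ b).unop * (σ a).unop := by
  rw [map_mul, MulOpposite.unop_mul]

theorem unop_map_mem_center (hσ : ∀ b, (σ (σ b).unop).unop = b) {f : B}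
    (hf : f ∈ Subring.center B) : (σ f).unop ∈ Subring.center B := by
  rw [Subring.mem_center_iff] at hf ⊢
  intro b
  rw [← hσ b, ← unop_map_mul, ← unop_map_mul, hf]

theorem isIdempotentElem_unop_map {f : B} (hf : IsIdempotentElem f) :
    IsIdempotentElem (σ f).unop := by
  rw [IsIdempotentElem, ← unop_map_mul, hf.eq]

theorem block_idempotent_unop_map (hσ : ∀ b, (σ (σ b).unop).unop = b) {f : B}
    (h : ∀ g ∈ Subring.center B, IsIdempotentElem g → g * f = g → g = 0 ∨ g = f) :
    ∀ g ∈ Subring.center B, IsIdempotentElem g → g * (σ f).unop = g →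
      g = 0 ∨ g = (σ f).unop := by
  intro g hg hgg hgf
  have hg' := unop_map_mem_center hσ hg
  rcases h _ hg' (isIdempotentElem_unop_map hgg) (by
    rw [← Subring.mem_center_iff.mp hg' f]
    conv_rhs => rw [← hgf]
    rw [unop_map_mul, hσ]) with h | h
  · left
    rw [← hσ g, h, map_zero, MulOpposite.unop_zero]
  · right
    rw [← hσ g, h]

/-- The action of `σ f` on the dual is the transpose of the action of `f`, and a map with zero
transpose is zero. -/
theorem exists_unop_smul_ne_zero (hσ : ∀ b, (σ (σ b).unop).unop = b) {T T' : Type*}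
    [AddCommGroup T] [Module k T] [Module B T] [IsScalarTower k B T] [AddCommGroup T']
    [Module B T'] (g : T' ≃ₗ[B] CircDual σ T) {f : B} (h : ∃ m : T, f • m ≠ 0) :
    ∃ m : T', (σ f).unop • m ≠ 0 := by
  obtain ⟨m, hm⟩ := h
  by_contra! hT'
  refine hm ((Module.forall_dual_apply_eq_zero_iff k _).mp fun φ => ?_)
  have h1 := hT' (g.symm ((CircDual.toDual σ T).symm φ))
  rw [← map_smul, g.symm.map_eq_zero_iff] at h1
  have h2 := LinearMap.congr_fun (congrArg (CircDual.toDual σ T) h1) m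
  rw [circDual_smul_apply, hσ] at h2
  exact h2

end BlockDual

/-! ### The duality on labels -/

section Labels

variable {k : Type u} [Field k] {C : Type v} [Category.{w} C] [Finite (Mor C)]
  {α : TwoCocycle k C} {J : JData C} (o : Duality α J)

namespace Duality

theorem circ_circ (x : TwAlg α) : (o.circ (o.circ x).unop).unop = x := o.circLin_circLin x

theorem circGrp_circGrp (i : Fin J.n) (x : grpAlg α (J.e_idem i)) :
    (o.circGrp i (o.circGrp i x).unop).unop = x :=
  Subtype.ext (Subtype.ext (o.circLin_circLin x.1.1))

theorem map_mem_unitMors {i : Fin J.n} {s : Mor C} (hs : s ∈ unitMors (J.e i)) :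
    mor (o.map s.2.2) ∈ unitMors (J.e i) := by
  obtain ⟨x, hx, rfl⟩ := hs
  exact ⟨_, o.map_mem_unitsAt i hx, rfl⟩

theorem projOn_circLin (i : Fin J.n) (x : TwAlg α) :
    projOn α (unitMors (J.e i)) (o.circLin x) = o.circLin (projOn α (unitMors (J.e i)) x) := by
  induction x using twAlg_induction with
  | h0 => simp
  | hadd a b ha hb => simp only [map_add, ha, hb]
  | hsmul c a ha => simp only [map_smul, ha]
  | hb s =>
    have hb : o.circLin (basisElt α s) = basisElt α (mor (o.map s.2.2)) := o.circLin_basis s.2.2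
    by_cases hs : s ∈ unitMors (J.e i)
    · rw [projOn_basis_mem α hs, hb, projOn_basis_mem α (o.map_mem_unitMors hs)]
    · rw [projOn_basis_notMem α hs, hb, projOn_basis_notMem, map_zero]
      intro h
      have := o.map_mem_unitMors h
      rw [o.map_map] at this
      exact hs this

theorem inflHom_circCorner (i : Fin J.n) (b : CornerAlg α (J.e_idem i)) :
    inflHom α (J.e_idem i) (o.circCorner i b).unop =
      (o.circGrp i (inflHom α (J.e_idem i) b)).unop :=
  Subtype.ext (Subtype.ext (o.projOn_circLin i b.1))

/-- Each of `s` and `s°` factors through the other, by `s ∘ s° ∘ s = s` applied to `s` and to `s°`.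
-/
theorem jClass_map {X Y : C} (s : X ⟶ Y) : jClass (mor (o.map s)) = jClass (mor s) := by
  refine le_antisymm (jClass_le_iff.mpr ⟨o.map s, o.map s, ?_⟩)
    (jClass_le_iff.mpr ⟨s, s, (o.comp_map_comp s).symm⟩)
  have h := o.comp_map_comp (o.map s)
  rw [o.map_map] at h
  exact h.symm

theorem circLin_mem_kSpan {T : Set (Mor C)} (hT : ∀ s t, s ∈ T → jClass t = jClass s → t ∈ T)
    {x : TwAlg α} (hx : x ∈ kSpan α T) : o.circLin x ∈ kSpan α T := by
  induction hx using Submodule.span_induction with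
  | mem x h =>
    obtain ⟨s, hs, rfl⟩ := h
    have hb : o.circLin (basisElt α s) = basisElt α (mor (o.map s.2.2)) := o.circLin_basis s.2.2
    rw [hb]
    exact basisElt_mem_kSpan (hT _ _ hs (o.jClass_map s.2.2))
  | zero => simp
  | add x y _ _ hx hy => rw [map_add]; exact add_mem hx hy
  | smul c x _ hx => rw [map_smul]; exact Submodule.smul_mem _ _ hx

theorem circLin_mem_idealLE {j : Fin J.n} {x : TwAlg α}
    (hx : x ∈ SimpleData.idealLE α J j) : o.circLin x ∈ SimpleData.idealLE α J j :=
  o.circLin_mem_kSpan (T := {s | ∃ i ≤ j, jClass s = J.cls i})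
    (fun _ _ ⟨i, hi, hs⟩ ht => ⟨i, hi, ht.trans hs⟩) hx

theorem circLin_mem_idealLT {j : Fin J.n} {x : TwAlg α}
    (hx : x ∈ SimpleData.idealLT α J j) : o.circLin x ∈ SimpleData.idealLT α J j :=
  o.circLin_mem_kSpan (T := {s | ∃ i < j, jClass s = J.cls i})
    (fun _ _ ⟨i, hi, hs⟩ ht => ⟨i, hi, ht.trans hs⟩) hx

variable (D : SimpleData α J)

theorem exists_dual_simple (i : Fin J.n) (r : Fin (D.l i)) :
    ∃ s, Nonempty (D.T i s ≃ₗ[grpAlg α (J.e_idem i)] CircDual (o.circGrp i) (D.T i r)) := by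
  have h : IsSimpleModule (grpAlg α (J.e_idem i)) (CircDual (o.circGrp i) (D.T i r)) :=
    isSimpleModule_circDual (B := grpAlg α (J.e_idem i)) (M := D.T i r) (o.circGrp_circGrp i)
  obtain ⟨s, ⟨g⟩⟩ := D.exists_equiv i (CircDual (o.circGrp i) (D.T i r)) h
  exact ⟨s, ⟨g.symm⟩⟩

/-- The index `r°`. -/
noncomputable def dualIndex (i : Fin J.n) (r : Fin (D.l i)) : Fin (D.l i) :=
  (o.exists_dual_simple D i r).choose

/-- The label `(i, r)° = (i, r°)`. -/
noncomputable abbrev dualLabel (lam : D.Label) : D.Label := ⟨lam.1, o.dualIndex D lam.1 lam.2⟩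

theorem nonempty_T_dualIndex_equiv (i : Fin J.n) (r : Fin (D.l i)) :
    Nonempty (D.T i (o.dualIndex D i r) ≃ₗ[grpAlg α (J.e_idem i)]
      CircDual (o.circGrp i) (D.T i r)) :=
  (o.exists_dual_simple D i r).choose_spec

theorem nonempty_T_equiv_iff (i : Fin J.n) (r s : Fin (D.l i)) :
    Nonempty (D.T i s ≃ₗ[grpAlg α (J.e_idem i)] CircDual (o.circGrp i) (D.T i r)) ↔
      s = o.dualIndex D i r := by
  obtain ⟨g⟩ := o.nonempty_T_dualIndex_equiv D i r
  refine ⟨fun ⟨g'⟩ => D.eq_of_equiv i _ _ ⟨g'.trans g.symm⟩, ?_⟩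
  rintro rfl
  exact ⟨g⟩

/-- A finite-dimensional module is its own double dual. -/
theorem dualIndex_dualIndex (i : Fin J.n) (r : Fin (D.l i)) :
    o.dualIndex D i (o.dualIndex D i r) = r := by
  obtain ⟨g⟩ := o.nonempty_T_dualIndex_equiv D i r
  obtain ⟨g'⟩ := nonempty_circBidual (B := grpAlg α (J.e_idem i)) (D.T i r) (o.circGrp_circGrp i)
  have g'' := circEquiv (B := grpAlg α (J.e_idem i)) (o.circGrp i) g
  exact ((o.nonempty_T_equiv_iff D i _ r).mp ⟨g'.trans g''.symm⟩).symm

theorem dualLabel_dualLabel (lam : D.Label) : o.dualLabel D (o.dualLabel D lam) = lam :=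
  congrArg (Sigma.mk lam.1) (o.dualIndex_dualIndex D lam.1 lam.2)

theorem dualLabel_injective : Function.Injective (o.dualLabel D) :=
  Function.LeftInverse.injective (o.dualLabel_dualLabel D)

/-- Inflation commutes with duals because the involution commutes with the projection of the corner
to the twisted group algebra (`inflHom_circCorner`). -/
theorem nonempty_infl_equiv (i : Fin J.n) (r : Fin (D.l i)) :
    Nonempty (D.Infl i (o.dualIndex D i r) ≃ₗ[CornerAlg α (J.e_idem i)]
      CircDual (o.circCorner i) (D.Infl i r)) := by
  obtain ⟨g⟩ := o.nonempty_T_dualIndex_equiv D i r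
  exact ⟨{
    toFun := g
    invFun := g.symm
    left_inv := g.left_inv
    right_inv := g.right_inv
    map_add' := g.map_add
    map_smul' := fun b x => by
      refine (g.map_smul (inflHom α (J.e_idem i) b) x).trans ?_
      refine circDual_ext (o.circGrp i) (D.T i r) fun m => ?_
      rw [circDual_smul_apply, ← inflHom_circCorner]
      rfl }⟩

theorem nonempty_head_dualLabel_equiv (lam : D.Label) :
    Nonempty (D.Head (o.dualLabel D lam) ≃ₗ[TwAlg α] CircDual o.circ (D.Head lam)) := by
  obtain ⟨g⟩ := o.nonempty_infl_equiv D lam.1 lam.2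
  exact nonempty_inducedHead_circDual_equiv (primeIdem_isIdempotentElem α (J.e_idem lam.1))
    (σ := o.circ) (τ := o.circCorner lam.1) (fun _ => rfl) o.circ_circ g

theorem nonempty_head_equiv_iff (hsplit : IsSplitCategory C) (lam mu : D.Label) :
    Nonempty (D.Head mu ≃ₗ[TwAlg α] CircDual o.circ (D.Head lam)) ↔ mu = o.dualLabel D lam := by
  obtain ⟨g⟩ := o.nonempty_head_dualLabel_equiv D lam
  refine ⟨fun ⟨g'⟩ => D.eq_of_head_equiv hsplit (g'.trans g.symm), ?_⟩
  rintro rfl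
  exact ⟨g⟩

theorem isBlockIdempotent_dualLabel {lam : D.Label} {f : grpAlg α (J.e_idem lam.1)}
    (hf : D.IsBlockIdempotent lam f) :
    D.IsBlockIdempotent (o.dualLabel D lam) (o.circGrp lam.1 f).unop := by
  obtain ⟨g⟩ := o.nonempty_T_dualIndex_equiv D lam.1 lam.2
  have hσ := o.circGrp_circGrp lam.1
  exact ⟨unop_map_mem_center (B := grpAlg α (J.e_idem lam.1)) hσ hf.1,
    isIdempotentElem_unop_map (B := grpAlg α (J.e_idem lam.1)) hf.2.1,
    block_idempotent_unop_map (B := grpAlg α (J.e_idem lam.1)) hσ hf.2.2.1,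
    exists_unop_smul_ne_zero (B := grpAlg α (J.e_idem lam.1)) hσ g hf.2.2.2⟩

/-- The involution turns `f x g` into `g° x° f°` and preserves both ideals, so it exchanges the two
alternatives in the definition of `⊏`. -/
theorem sqsubset_dualLabel {lam mu : D.Label} (h : D.sqsubset lam mu) :
    D.sqsubset (o.dualLabel D lam) (o.dualLabel D mu) := by
  obtain ⟨hlt, f, g, hf, hg, h⟩ := h
  refine ⟨hlt, _, _, o.isBlockIdempotent_dualLabel D hf, o.isBlockIdempotent_dualLabel D hg, ?_⟩
  have key : ∀ a b x : TwAlg α, a * x * b ∉ SimpleData.idealLT α J mu.1 →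
      o.circLin b * o.circLin x * o.circLin a ∉ SimpleData.idealLT α J mu.1 := by
    intro a b x hx hmem
    refine hx ?_
    have := o.circLin_mem_idealLT hmem
    rwa [← o.circLin_mul, ← o.circLin_mul, o.circLin_circLin, ← mul_assoc] at this
  rcases h with ⟨x, hx, hx'⟩ | ⟨x, hx, hx'⟩
  · exact Or.inr ⟨o.circLin x, o.circLin_mem_idealLE hx, key _ _ _ hx'⟩
  · exact Or.inl ⟨o.circLin x, o.circLin_mem_idealLE hx, key _ _ _ hx'⟩

theorem unlhd_dualLabel_iff (lam mu : D.Label) :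
    D.unlhd lam mu ↔ D.unlhd (o.dualLabel D lam) (o.dualLabel D mu) := by
  have h : ∀ {lam mu}, D.unlhd lam mu → D.unlhd (o.dualLabel D lam) (o.dualLabel D mu) :=
    fun h => h.lift (o.dualLabel D) (fun _ _ => o.sqsubset_dualLabel D)
  refine ⟨h, fun h' => ?_⟩
  have := h h'
  rwa [o.dualLabel_dualLabel, o.dualLabel_dualLabel] at this

theorem le_dualLabel_iff (lam mu : D.Label) :
    D.le lam mu ↔ D.le (o.dualLabel D lam) (o.dualLabel D mu) :=
  or_congr (o.dualLabel_injective D).eq_iff.symm Iff.rfl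

theorem strict_dualLabel {R : D.Label → D.Label → Prop} (hR : R = D.lt ∨ R = D.lhd)
    (lam mu : D.Label) (h : R lam mu) : R (o.dualLabel D lam) (o.dualLabel D mu) := by
  rcases hR with rfl | rfl
  · exact h
  · exact ⟨(o.unlhd_dualLabel_iff D lam mu).mp h.1, (o.dualLabel_injective D).ne h.2⟩

/-- Dualise the projective cover and the standard module belonging to the dual label. Uniqueness up
to isomorphism comes from that of injective envelopes. -/
theorem exists_isCostandardModule (hsplit : IsSplitCategory C)
    {R : D.Label → D.Label → Prop} (hR : R = D.lt ∨ R = D.lhd) (lam : D.Label) :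
    (∃ (N : Type (max u v w)) (_ : AddCommGroup N) (_ : Module (TwAlg α) N),
      IsCostandardModule (TwAlg α) D.Head R lam N) ∧
    ∀ (N : Type (max u v w)) [AddCommGroup N] [Module (TwAlg α) N],
      IsCostandardModule (TwAlg α) D.Head R lam N →
        Nonempty (N ≃ₗ[TwAlg α] CircDual o.circ (D.Delta (o.dualLabel D lam))) := by
  obtain ⟨h₁, h₂⟩ := D.between_of_eq hR
  obtain ⟨P, π, K, hπ, hK, ⟨e⟩⟩ :=
    D.exists_projectiveCover_isLeast hsplit h₁ h₂ (o.dualLabel D lam)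
  have : Module.Finite k P :=
    Module.Finite.of_injective (P.subtype.restrictScalars k) Subtype.val_injective
  have hD : ∀ mu nu, nu = o.dualLabel D mu →
      Nonempty (CircDual o.circ (D.Head mu) ≃ₗ[TwAlg α] D.Head nu) := by
    rintro mu _ rfl
    exact (o.nonempty_head_dualLabel_equiv D mu).map LinearEquiv.symm
  refine ⟨⟨CircDual o.circ (P ⧸ K), inferInstance, inferInstance, ?_⟩, fun N _ _ hN => ?_⟩
  · exact isCostandardModule_circDual.{u, max v w} o.circ_circ (o.dualLabel_dualLabel D) hD
      (o.strict_dualLabel D hR) hπ hK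
  · obtain ⟨g⟩ := IsCostandardModule.nonempty_equiv_circDual.{u, max v w} o.circ_circ
      (o.dualLabel_dualLabel D) hD (o.strict_dualLabel D hR) hπ hK hN
    exact ⟨g.trans (circEquiv o.circ e).symm⟩

end Duality

end Labels

end TwCat

theorem mainTheorem6 {k : Type u} [Field k] {C : Type v} [Category.{w} C] [Finite (Mor C)]
    (hsplit : IsSplitCategory C) (α : TwoCocycle k C) (J : JData C) (D : SimpleData α J)
    (hinv : ∀ i, (Nat.card (unitsAt (J.e i)) : k) ≠ 0) (o : Duality α J) :
    -- the labels `lam°` (for which `D_{lam°} ≅ (D_lam)°`) and `r°` (for which `T_{(i,r°)} ≅ T_{(i,r)}°`)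
    ∃ (dualLabel : D.Label → D.Label) (dualIndex : ∀ i, Fin (D.l i) → Fin (D.l i)),
      (∀ lam mu : D.Label,
        Nonempty (D.Head mu ≃ₗ[TwAlg α] CircDual o.circ (D.Head lam)) ↔ mu = dualLabel lam) ∧
      (∀ (i : Fin J.n) (r s : Fin (D.l i)),
        Nonempty (D.T i s ≃ₗ[grpAlg α (J.e_idem i)] CircDual (o.circGrp i) (D.T i r)) ↔
          s = dualIndex i r) ∧
      -- (a)
      (∀ (i : Fin J.n) (r : Fin (D.l i)),
        dualLabel ⟨i, r⟩ = ⟨i, dualIndex i r⟩ ∧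
        Nonempty (D.Delta (dualLabel ⟨i, r⟩) ≃ₗ[TwAlg α]
          Induced k (primeIdem_isIdempotentElem α (J.e_idem i))
            (CircDual (o.circCorner i) (D.Infl i r))) ∧
        Nonempty (Induced k (primeIdem_isIdempotentElem α (J.e_idem i))
            (CircDual (o.circCorner i) (D.Infl i r)) ≃ₗ[TwAlg α] D.Delta ⟨i, dualIndex i r⟩)) ∧
      -- (b)
      (∀ lam mu, D.le lam mu ↔ D.le (dualLabel lam) (dualLabel mu)) ∧
      -- (c)
      (∀ lam mu, D.unlhd lam mu ↔ D.unlhd (dualLabel lam) (dualLabel mu)) ∧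
      -- (d), with respect to `≤` and with respect to `⊴`
      (∀ R : D.Label → D.Label → Prop, R = D.lt ∨ R = D.lhd → ∀ lam : D.Label,
        IsStandardModule (TwAlg α) D.Head R lam (D.Delta lam) ∧
        (∃ (N : Type (max u v w)) (_ : AddCommGroup N) (_ : Module (TwAlg α) N),
          IsCostandardModule (TwAlg α) D.Head R lam N) ∧
        (∀ (N : Type (max u v w)) [AddCommGroup N] [Module k N] [Module (TwAlg α) N]
          [IsScalarTower k (TwAlg α) N], IsCostandardModule (TwAlg α) D.Head R lam N →
            Nonempty (D.Delta (dualLabel lam) ≃ₗ[TwAlg α] CircDual o.circ N)) ∧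
        (∀ (N : Type (max u v w)) [AddCommGroup N] [Module k N] [Module (TwAlg α) N]
          [IsScalarTower k (TwAlg α) N],
          IsCostandardModule (TwAlg α) D.Head R (dualLabel lam) N →
            Nonempty (N ≃ₗ[TwAlg α] CircDual o.circ (D.Delta lam)))) := by
  refine ⟨o.dualLabel D, o.dualIndex D, o.nonempty_head_equiv_iff D hsplit,
    o.nonempty_T_equiv_iff D, fun i r => ⟨rfl, ?_, ?_⟩, o.le_dualLabel_iff D,
    o.unlhd_dualLabel_iff D, fun R hR lam => ⟨?_, ?_, ?_, ?_⟩⟩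
  · obtain ⟨g⟩ := o.nonempty_infl_equiv D i r
    exact nonempty_induced_equiv (primeIdem_isIdempotentElem α (J.e_idem i)) g
  · obtain ⟨g⟩ := o.nonempty_infl_equiv D i r
    exact nonempty_induced_equiv (primeIdem_isIdempotentElem α (J.e_idem i)) g.symm
  · obtain ⟨h₁, h₂⟩ := D.between_of_eq hR
    obtain ⟨P, π, K, hπ, hK, e⟩ := D.exists_projectiveCover_isLeast hsplit h₁ h₂ lam
    exact ⟨P, inferInstance, inferInstance, π, K, hπ, hK, e⟩
  · exact (o.exists_isCostandardModule D hsplit hR lam).1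
  -- Here `N` is the dual of the standard module with the dual label; dualising once more recovers
  -- that standard module.
  · intro N _ _ _ _ hN
    obtain ⟨g⟩ := (o.exists_isCostandardModule D hsplit hR lam).2 N hN
    obtain ⟨g'⟩ := nonempty_circBidual (D.Delta (o.dualLabel D lam)) o.circ_circ
    exact ⟨g'.trans (circEquiv o.circ g).symm⟩
  -- The same description of costandard modules is used at the dual label, whose own dual is `lam`.
  · intro N _ _ _ _ hN
    have h := (o.exists_isCostandardModule D hsplit hR (o.dualLabel D lam)).2 N hN
    rwa [o.dualLabel_dualLabel] at h
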